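/- Let $G$ be a compact Lie group. Manifolds are smooth, Hausdorff, second countable, finite-dimensional and without boundary; a $G$-manifold is a manifold $M$ with a smooth action $G\times M\to M$, $(g,x)\mapsto gx$. For $G$-manifolds $N,M$ let $[N,M]^G$ be the set of equivariant homotopy classes of continuous equivariant maps $N\to M$. Regard $G$ as a $G$-manifold under conjugation; then $[M,G]^G$ is a group under pointwise multiplication. Let $\mathrm{Diff}^G(M)$ be the group (under composition) of equivariant diffeomorphisms of $M$, let $\pi_0\mathrm{Diff}^G(M)$ be the group of its equivariant isotopy classes, and let $\mathcal M^G$ be the collection of equivariant diffeomorphism classes of $G$-manifolds. For a smooth equivariant $\alpha:M\to G$ let $\hat\alpha\in\mathrm{Diff}^G(M)$ be the diffeomorphism $\hat\alpha(x)=\alpha(x)x$. A smooth $\star$-family on $M$ consists of a $G$-invariant open cover $\{U_i\}$ of $M$ and smooth maps $\phi_{ij}:U_i\cap U_j\to G$ such that $\phi_{ik}=\phi_{ij}\phi_{jk}$ on $U_i\cap U_j\cap U_k$ and $\phi_{ij}(gx)=g\phi_{ij}(x)g^{-1}$. The associated $\star$-bundle $\pi:P\to M$ is obtained by gluing the pieces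 $U_i\times G$ along $U_i\times G\ni(x,g)\sim(x,g\phi_{ij}(x))\in U_j\times G$, with $\pi(x,g)=x$ and with the action of $G\times G$ given on each piece by $(q,r)\cdot(x,g)=(qx,rgq^{-1})$; the action of the first factor is called the $\star$-action, that of the second factor the principal action. For an equivariant map $f:N\to M$ put $f^*P=\{(x,y)\in N\times P: f(x)=\pi(y)\}$, with the induced $\star$-action $q(x,y)=(qx,(q,1)y)$ and the induced principal action $r(x,y)=(x,(1,r)y)$. (1) Every continuous equivariant map $\alpha:M\to G$ has equivariant smooth approximations: for each open neighbourhood $W$ of the graph of $\alpha$ in $M\times G$ there is a smooth equivariant $\alpha'$, equivariantly homotopic to $\alpha$, whose graph lies in $W$. There is a unique group homomorphism $$DR:[M,G]^G\to\pi_0\mathrm{Diff}^G(M)$$ such that $DR([\alpha'])=[\hat\alpha'^{-1}]$ for every smooth equivariant $\alpha':M\to G$. In particular $DR([\alpha])=[\hat\alpha'^{-1}]$ for every smooth equivariant $\alpha'$ that is equivariantly homotopic to $\alpha$. (2) Let $\pi:P\to M$ be a $\star$-bundle and let $N$ be a $G$-manifold. Every continuous equivariant map $N\to M$ is equivariantly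 homotopic to a smooth one, and there is a unique map $$DR_\pi:[N,M]^G\to\mathcal M^G$$ such that, for every smooth equivariant $f:N\to M$, $DR_\pi([f])$ is the equivariant diffeomorphism class of the quotient of $f^*P$ by the induced $\star$-action; that is, of the $G$-manifolds $X$ that admit a surjective submersion $f^*P\to X$ whose fibres are the orbits of the $\star$-action and which carries the principal action of $G$ on $f^*P$ to the action of $G$ on $X$. -/

import Mathlib

open Set
open scoped Manifold ContDiff Topology

universe u

/-! ### Equivariant maps and equivariant homotopy classes -/

/-- Continuous `G`-equivariant maps `N → M`. -/
def EqMap (G N M : Type*) [TopologicalSpace N] [TopologicalSpace M] [SMul G N] [SMul G M] :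
    Type _ :=
  {f : C(N, M) // ∀ (g : G) (x : N), f (g • x) = g • f x}

instance EqMap.instFunLike {G N M : Type*} [TopologicalSpace N] [TopologicalSpace M]
    [SMul G N] [SMul G M] : FunLike (EqMap G N M) N M where
  coe f := f.1
  coe_injective _ _ h := Subtype.ext (DFunLike.coe_injective h)

/-- Two equivariant maps are equivariantly homotopic if there is a continuous homotopy between
them all of whose stages are equivariant. -/
def EqMap.Homotopic {G N M : Type*} [TopologicalSpace N] [TopologicalSpace M]
    [SMul G N] [SMul G M] (f₀ f₁ : EqMap G N M) : Prop :=
  ContinuousMap.HomotopicWith f₀.1 f₁.1 (fun f => ∀ (g : G) (x : N), f (g • x) = g • f x)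

/-- Equivariant homotopy, as an equivalence relation. -/
def EqMap.homotopySetoid (G N M : Type*) [TopologicalSpace N] [TopologicalSpace M]
    [SMul G N] [SMul G M] : Setoid (EqMap G N M) where
  r := EqMap.Homotopic
  iseqv :=
    { refl := fun f => ContinuousMap.HomotopicWith.refl f.1 f.2
      symm := fun h => ContinuousMap.HomotopicWith.symm h
      trans := fun h h' => ContinuousMap.HomotopicWith.trans h h' }

/-- The set `[N, M]^G` of equivariant homotopy classes of equivariant maps. -/
def EqHomotopyClasses (G N M : Type*) [TopologicalSpace N] [TopologicalSpace M]
    [SMul G N] [SMul G M] : Type _ :=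
  Quotient (EqMap.homotopySetoid G N M)

/-- The class `[f] ∈ [N, M]^G`. -/
def EqMap.toClass {G N M : Type*} [TopologicalSpace N] [TopologicalSpace M]
    [SMul G N] [SMul G M] (f : EqMap G N M) : EqHomotopyClasses G N M :=
  Quotient.mk (EqMap.homotopySetoid G N M) f

/-- Smoothness of an equivariant map between manifolds of dimensions `n` and `m`. -/
def EqMap.IsSmooth (n m : ℕ) {G N M : Type*} [TopologicalSpace N] [TopologicalSpace M]
    [SMul G N] [SMul G M] [ChartedSpace (EuclideanSpace ℝ (Fin n)) N]
    [ChartedSpace (EuclideanSpace ℝ (Fin m)) M] (f : EqMap G N M) : Prop :=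
  ContMDiff (𝓡 n) (𝓡 m) ∞ f

/-! ### The group `G` as a `G`-space under conjugation, and the group `[M, G]^G` -/

/-- A copy of the group `G`, regarded as a `G`-space with the conjugation action. -/
def ConjSelf (G : Type*) : Type _ := G

instance ConjSelf.instGroup (G : Type*) [Group G] : Group (ConjSelf G) := inferInstanceAs (Group G)

instance ConjSelf.instTopologicalSpace (G : Type*) [TopologicalSpace G] :
    TopologicalSpace (ConjSelf G) := inferInstanceAs (TopologicalSpace G)

instance ConjSelf.instIsTopologicalGroup (G : Type*) [Group G] [TopologicalSpace G]
    [IsTopologicalGroup G] : IsTopologicalGroup (ConjSelf G) :=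
  inferInstanceAs (IsTopologicalGroup G)

instance ConjSelf.instChartedSpace (H G : Type*) [TopologicalSpace H] [TopologicalSpace G]
    [ChartedSpace H G] : ChartedSpace H (ConjSelf G) := inferInstanceAs (ChartedSpace H G)

/-- The identity map from the copy `ConjSelf G` to `G`. -/
def ConjSelf.toG {G : Type*} [Group G] : ConjSelf G ≃* G := MulEquiv.refl G

/-- The inverse of `ConjSelf.toG`. -/
def ConjSelf.ofG {G : Type*} [Group G] : G ≃* ConjSelf G := MulEquiv.refl G

/-- The conjugation action `g • a = g a g⁻¹`. -/
instance ConjSelf.instMulAction (G : Type*) [Group G] : MulAction G (ConjSelf G) where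
  smul g a := ConjSelf.ofG g * a * (ConjSelf.ofG g)⁻¹
  one_smul a := by
    change ConjSelf.ofG 1 * a * (ConjSelf.ofG 1)⁻¹ = a
    simp
  mul_smul g h a := by
    change ConjSelf.ofG (g * h) * a * (ConjSelf.ofG (g * h))⁻¹ =
      ConjSelf.ofG g * (ConjSelf.ofG h * a * (ConjSelf.ofG h)⁻¹) * (ConjSelf.ofG g)⁻¹
    simp [mul_assoc]

theorem ConjSelf.smul_def {G : Type*} [Group G] (g : G) (a : ConjSelf G) :
    g • a = ConjSelf.ofG g * a * (ConjSelf.ofG g)⁻¹ := rfl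

/-- The equivariant maps `M → G` form a group under pointwise multiplication: they are a subgroup
of the group of all continuous maps. -/
def conjEqSubgroup (G M : Type*) [Group G] [TopologicalSpace G] [IsTopologicalGroup G]
    [TopologicalSpace M] [SMul G M] : Subgroup C(M, ConjSelf G) where
  carrier := {f | ∀ (g : G) (x : M), f (g • x) = g • f x}
  one_mem' := fun g x => by simp [ConjSelf.smul_def]
  mul_mem' := fun {a b} ha hb g x => by
    simp only [mem_ofPred_eq, ConjSelf.smul_def] at ha hb
    simp [ConjSelf.smul_def, ha, hb, mul_assoc]
  inv_mem' := fun {a} ha g x => by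
    simp only [mem_ofPred_eq, ConjSelf.smul_def] at ha
    simp [ConjSelf.smul_def, ha, mul_assoc]

instance EqMap.instGroup (G M : Type*) [Group G] [TopologicalSpace G] [IsTopologicalGroup G]
    [TopologicalSpace M] [SMul G M] : Group (EqMap G M (ConjSelf G)) :=
  inferInstanceAs (Group (conjEqSubgroup G M))

/-- Equivariant homotopy is compatible with pointwise multiplication. -/
def EqMap.homotopyCon (G M : Type*) [Group G] [TopologicalSpace G] [IsTopologicalGroup G]
    [TopologicalSpace M] [SMul G M] : Con (EqMap G M (ConjSelf G)) where
  toSetoid := EqMap.homotopySetoid G M (ConjSelf G)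
  mul' := by
    rintro a b c d ⟨F⟩ ⟨F'⟩
    exact ⟨{ toFun := fun p => F p * F' p
             continuous_toFun := F.continuous.mul F'.continuous
             map_zero_left := fun x => by simp; rfl
             map_one_left := fun x => by simp; rfl
             prop' := fun t => (conjEqSubgroup G M).mul_mem (F.prop' t) (F'.prop' t) }⟩

/-- The group structure on `[M, G]^G` given by pointwise multiplication. -/
instance EqHomotopyClasses.instGroup (G M : Type*) [Group G] [TopologicalSpace G]
    [IsTopologicalGroup G] [TopologicalSpace M] [SMul G M] :
    Group (EqHomotopyClasses G M (ConjSelf G)) :=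
  inferInstanceAs (Group (EqMap.homotopyCon G M).Quotient)

/-! ### Equivariant diffeomorphisms and `π₀ Diff^G(M)` -/

/-- `G`-equivariant diffeomorphisms from the `m`-manifold `M` onto the `n`-manifold `N`. -/
@[ext]
structure EqDiffeo (G : Type*) (m n : ℕ) (M N : Type*) [TopologicalSpace M] [TopologicalSpace N]
    [ChartedSpace (EuclideanSpace ℝ (Fin m)) M] [ChartedSpace (EuclideanSpace ℝ (Fin n)) N]
    [SMul G M] [SMul G N] where
  toDiffeo : Diffeomorph (𝓡 m) (𝓡 n) M N ∞
  map_smul : ∀ (g : G) (x : M), toDiffeo (g • x) = g • toDiffeo x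

namespace EqDiffeo

/-- The identity. -/
noncomputable def refl (G : Type*) (m : ℕ) (M : Type*) [TopologicalSpace M]
    [ChartedSpace (EuclideanSpace ℝ (Fin m)) M] [SMul G M] : EqDiffeo G m m M M :=
  ⟨Diffeomorph.refl (𝓡 m) M ∞, fun _ _ => rfl⟩

/-- The inverse. -/
noncomputable def symm {G : Type*} {m n : ℕ} {M N : Type*} [TopologicalSpace M] [TopologicalSpace N]
    [ChartedSpace (EuclideanSpace ℝ (Fin m)) M] [ChartedSpace (EuclideanSpace ℝ (Fin n)) N]
    [SMul G M] [SMul G N] (φ : EqDiffeo G m n M N) : EqDiffeo G n m N M :=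
  ⟨φ.toDiffeo.symm, fun g x => by
    apply φ.toDiffeo.injective
    change φ.toDiffeo (φ.toDiffeo.symm (g • x)) = φ.toDiffeo (g • φ.toDiffeo.symm x)
    rw [φ.map_smul, Diffeomorph.apply_symm_apply, Diffeomorph.apply_symm_apply]⟩

/-- The composition, first `φ` and then `ψ`. -/
noncomputable def trans {G : Type*} {m n k : ℕ} {M N K : Type*} [TopologicalSpace M] [TopologicalSpace N]
    [TopologicalSpace K]
    [ChartedSpace (EuclideanSpace ℝ (Fin m)) M] [ChartedSpace (EuclideanSpace ℝ (Fin n)) N]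
    [ChartedSpace (EuclideanSpace ℝ (Fin k)) K] [SMul G M] [SMul G N] [SMul G K]
    (φ : EqDiffeo G m n M N) (ψ : EqDiffeo G n k N K) : EqDiffeo G m k M K :=
  ⟨φ.toDiffeo.trans ψ.toDiffeo, fun g x => by simp [φ.map_smul, ψ.map_smul]⟩

end EqDiffeo

/-- The group `Diff^G(M)` of equivariant diffeomorphisms of `M`; the product is composition,
`(φ * ψ) x = φ (ψ x)`. -/
abbrev DiffG (G : Type*) (m : ℕ) (M : Type*) [TopologicalSpace M]
    [ChartedSpace (EuclideanSpace ℝ (Fin m)) M] [SMul G M] : Type _ :=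
  EqDiffeo G m m M M

noncomputable instance DiffG.instFunLike {G : Type*} {m : ℕ} {M : Type*} [TopologicalSpace M]
    [ChartedSpace (EuclideanSpace ℝ (Fin m)) M] [SMul G M] : FunLike (DiffG G m M) M M where
  coe φ := φ.toDiffeo
  coe_injective _ _ h := EqDiffeo.ext (DFunLike.coe_injective h)

noncomputable instance DiffG.instGroup (G : Type*) (m : ℕ) (M : Type*) [TopologicalSpace M]
    [ChartedSpace (EuclideanSpace ℝ (Fin m)) M] [SMul G M] : Group (DiffG G m M) where
  mul φ ψ := EqDiffeo.trans ψ φ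
  one := EqDiffeo.refl G m M
  inv φ := EqDiffeo.symm φ
  mul_assoc _ _ _ := rfl
  one_mul _ := rfl
  mul_one _ := rfl
  inv_mul_cancel φ := DFunLike.ext _ _ fun x => φ.toDiffeo.left_inv x

theorem DiffG.mul_apply {G : Type*} {m : ℕ} {M : Type*} [TopologicalSpace M]
    [ChartedSpace (EuclideanSpace ℝ (Fin m)) M] [SMul G M] (φ ψ : DiffG G m M) (x : M) :
    (φ * ψ) x = φ (ψ x) := rfl

theorem DiffG.contMDiff {G : Type*} {m : ℕ} {M : Type*} [TopologicalSpace M]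
    [ChartedSpace (EuclideanSpace ℝ (Fin m)) M] [SMul G M] (φ : DiffG G m M) :
    ContMDiff (𝓡 m) (𝓡 m) ∞ φ := φ.toDiffeo.contMDiff_toFun

/-- A family `H t` of self-maps of `M` depends smoothly on `(t, x) ∈ [0, 1] × M`. -/
def SmoothFamily {G : Type*} {m : ℕ} {M : Type*} [TopologicalSpace M]
    [ChartedSpace (EuclideanSpace ℝ (Fin m)) M] [SMul G M] (H : ℝ → DiffG G m M) : Prop :=
  ContMDiffOn (𝓘(ℝ, ℝ).prod (𝓡 m)) (𝓡 m) ∞ (fun p : ℝ × M => H p.1 p.2) (Icc 0 1 ×ˢ univ)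

theorem SmoothFamily.mul {G : Type*} {m : ℕ} {M : Type*} [TopologicalSpace M]
    [ChartedSpace (EuclideanSpace ℝ (Fin m)) M] [SMul G M] {H K : ℝ → DiffG G m M}
    (hH : SmoothFamily H) (hK : SmoothFamily K) : SmoothFamily (fun t => H t * K t) := by
  have h : ContMDiffOn (𝓘(ℝ, ℝ).prod (𝓡 m)) (𝓘(ℝ, ℝ).prod (𝓡 m)) ∞
      (fun p : ℝ × M => (p.1, K p.1 p.2)) (Icc 0 1 ×ˢ univ) :=
    contMDiffOn_fst.prodMk hK
  exact ContMDiffOn.comp (t := Icc 0 1 ×ˢ univ) hH h fun p hp => ⟨hp.1, mem_univ _⟩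

theorem SmoothFamily.const {G : Type*} {m : ℕ} {M : Type*} [TopologicalSpace M]
    [ChartedSpace (EuclideanSpace ℝ (Fin m)) M] [SMul G M] (φ : DiffG G m M) :
    SmoothFamily (fun _ : ℝ => φ) :=
  (φ.contMDiff.comp contMDiff_snd).contMDiffOn

/-- The normal subgroup of those equivariant diffeomorphisms `φ` that are equivariantly isotopic
to the identity: there are equivariant diffeomorphisms `H t`, `t ∈ [0, 1]`, from `H 0 = id` to
`H 1 = φ`, such that `(t, x) ↦ (t, H t x)` is a diffeomorphism of `[0, 1] × M`. -/
def isotopicToId (G : Type*) (m : ℕ) (M : Type*) [TopologicalSpace M]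
    [ChartedSpace (EuclideanSpace ℝ (Fin m)) M] [SMul G M] : Subgroup (DiffG G m M) where
  carrier := {φ | ∃ H : ℝ → DiffG G m M,
    SmoothFamily H ∧ SmoothFamily (fun t => (H t)⁻¹) ∧ H 0 = 1 ∧ H 1 = φ}
  one_mem' := ⟨fun _ => 1, .const _, .const _, rfl, rfl⟩
  mul_mem' := by
    rintro φ ψ ⟨H, h1, h2, h3, h4⟩ ⟨K, k1, k2, k3, k4⟩
    refine ⟨fun t => H t * K t, h1.mul k1, ?_, by simp [h3, k3], by simp [h4, k4]⟩
    simpa only [mul_inv_rev] using k2.mul h2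
  inv_mem' := by
    rintro φ ⟨H, h1, h2, h3, h4⟩
    exact ⟨fun t => (H t)⁻¹, h2, by simpa only [inv_inv] using h1, by simp [h3], by simp [h4]⟩

instance isotopicToId.instNormal (G : Type*) (m : ℕ) (M : Type*) [TopologicalSpace M]
    [ChartedSpace (EuclideanSpace ℝ (Fin m)) M] [SMul G M] : (isotopicToId G m M).Normal where
  conj_mem := by
    rintro φ ⟨H, h1, h2, h3, h4⟩ ψ
    refine ⟨fun t => ψ * H t * ψ⁻¹, ((SmoothFamily.const ψ).mul h1).mul (.const _), ?_,
      by simp [h3], by simp [h4]⟩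
    simpa only [mul_inv_rev, inv_inv, mul_assoc] using
      ((SmoothFamily.const ψ).mul h2).mul (.const ψ⁻¹)

/-- The group `π₀ Diff^G(M)` of equivariant isotopy classes of equivariant diffeomorphisms. -/
abbrev PiZeroDiffG (G : Type*) (m : ℕ) (M : Type*) [TopologicalSpace M]
    [ChartedSpace (EuclideanSpace ℝ (Fin m)) M] [SMul G M] : Type _ :=
  DiffG G m M ⧸ isotopicToId G m M

/-- For a smooth equivariant map `α : M → G` (conjugation action on `G`), the equivariant
diffeomorphism `α̂ : M → M`, `α̂(x) = α(x) x`. -/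
noncomputable def hatDiffeo {d m : ℕ} {G M : Type*} [Group G] [TopologicalSpace G]
    [ChartedSpace (EuclideanSpace ℝ (Fin d)) G] [LieGroup (𝓡 d) ∞ G]
    [TopologicalSpace M] [ChartedSpace (EuclideanSpace ℝ (Fin m)) M]
    [MulAction G M] [ContMDiffSMul (𝓡 d) (𝓡 m) ∞ G M]
    (α : EqMap G M (ConjSelf G)) (hα : α.IsSmooth m d) : DiffG G m M where
  toDiffeo :=
    { toFun := fun x => ConjSelf.toG (α x) • x
      invFun := fun x => (ConjSelf.toG (α x))⁻¹ • x
      left_inv := fun x => by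
        have h : ConjSelf.toG (α (ConjSelf.toG (α x) • x)) = ConjSelf.toG (α x) := by
          rw [show α (ConjSelf.toG (α x) • x) = ConjSelf.toG (α x) • α x from α.2 _ _]
          exact mul_inv_cancel_right _ _
        simp only [h, inv_smul_smul]
      right_inv := fun x => by
        have h : ConjSelf.toG (α ((ConjSelf.toG (α x))⁻¹ • x)) = ConjSelf.toG (α x) := by
          rw [show α ((ConjSelf.toG (α x))⁻¹ • x) = (ConjSelf.toG (α x))⁻¹ • α x from α.2 _ _]
          change (ConjSelf.toG (α x))⁻¹ * ConjSelf.toG (α x) * (ConjSelf.toG (α x))⁻¹⁻¹ = _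
          group
        simp only [h, smul_inv_smul]
      contMDiff_toFun := by
        have h : ContMDiff (𝓡 m) (𝓡 d) ∞ (fun x => ConjSelf.toG (α x)) := hα
        exact h.smul contMDiff_id
      contMDiff_invFun := by
        have h : ContMDiff (𝓡 m) (𝓡 d) ∞ (fun x => ConjSelf.toG (α x)) := hα
        exact h.inv.smul contMDiff_id }
  map_smul := fun g x => by
    change ConjSelf.toG (α (g • x)) • (g • x) = g • (ConjSelf.toG (α x) • x)
    rw [show α (g • x) = g • α x from α.2 _ _]
    change (g * ConjSelf.toG (α x) * g⁻¹) • (g • x) = _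
    simp [mul_smul]

/-! ### Smooth `G`-manifolds up to equivariant diffeomorphism -/

/-- A smooth `G`-manifold (Hausdorff, second countable, finite-dimensional, without boundary). -/
structure SmoothGManifold (d : ℕ) (G : Type u) [TopologicalSpace G]
    [ChartedSpace (EuclideanSpace ℝ (Fin d)) G] [Group G] : Type (u + 1) where
  carrier : Type u
  dim : ℕ
  [topology : TopologicalSpace carrier]
  [t2 : T2Space carrier]
  [secondCountable : SecondCountableTopology carrier]
  [charted : ChartedSpace (EuclideanSpace ℝ (Fin dim)) carrier]
  [isManifold : IsManifold (𝓡 dim) ∞ carrier]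
  [action : MulAction G carrier]
  [smoothAction : ContMDiffSMul (𝓡 d) (𝓡 dim) ∞ G carrier]

attribute [instance] SmoothGManifold.topology SmoothGManifold.t2
  SmoothGManifold.secondCountable SmoothGManifold.charted SmoothGManifold.isManifold
  SmoothGManifold.action SmoothGManifold.smoothAction

/-- Existence of an equivariant diffeomorphism, as an equivalence relation. -/
def SmoothGManifold.diffeoSetoid (d : ℕ) (G : Type u) [TopologicalSpace G]
    [ChartedSpace (EuclideanSpace ℝ (Fin d)) G] [Group G] : Setoid (SmoothGManifold d G) where
  r X Y := Nonempty (EqDiffeo G X.dim Y.dim X.carrier Y.carrier)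
  iseqv :=
    { refl := fun _ => ⟨EqDiffeo.refl _ _ _⟩
      symm := fun ⟨φ⟩ => ⟨φ.symm⟩
      trans := fun ⟨φ⟩ ⟨ψ⟩ => ⟨φ.trans ψ⟩ }

/-- The collection `𝓜^G` of equivariant diffeomorphism classes of smooth `G`-manifolds. -/
def GManifoldClasses (d : ℕ) (G : Type u) [TopologicalSpace G]
    [ChartedSpace (EuclideanSpace ℝ (Fin d)) G] [Group G] : Type (u + 1) :=
  Quotient (SmoothGManifold.diffeoSetoid d G)

/-- The class of a smooth `G`-manifold in `𝓜^G`. -/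
def SmoothGManifold.toClass {d : ℕ} {G : Type u} [TopologicalSpace G]
    [ChartedSpace (EuclideanSpace ℝ (Fin d)) G] [Group G] (X : SmoothGManifold d G) :
    GManifoldClasses d G :=
  Quotient.mk (SmoothGManifold.diffeoSetoid d G) X

/-! ### `⋆`-bundles -/

/-- A smooth `⋆`-family on the `G`-manifold `M`: a `G`-invariant open cover `U i` and smooth maps
`φ i j : U i ∩ U j → G` with the cocycle condition `φ i k = φ i j * φ j k` and
`φ i j (g x) = g * φ i j x * g⁻¹`. The values of `φ i j` off `U i ∩ U j` play no role. -/
structure StarFamily (d m : ℕ) (G M : Type u) [Group G] [TopologicalSpace G]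
    [ChartedSpace (EuclideanSpace ℝ (Fin d)) G] [TopologicalSpace M]
    [ChartedSpace (EuclideanSpace ℝ (Fin m)) M] [SMul G M] where
  ι : Type u
  U : ι → Set M
  isOpen_U : ∀ i, IsOpen (U i)
  smul_mem_U : ∀ i (g : G), ∀ x ∈ U i, g • x ∈ U i
  cover : ∀ x, ∃ i, x ∈ U i
  φ : ι → ι → M → G
  smooth_φ : ∀ i j, ContMDiffOn (𝓡 m) (𝓡 d) ∞ (φ i j) (U i ∩ U j)
  cocycle : ∀ i j k, ∀ x ∈ U i ∩ U j ∩ U k, φ i k x = φ i j x * φ j k x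
  φ_smul : ∀ i j (g : G), ∀ x ∈ U i ∩ U j, φ i j (g • x) = g * φ i j x * g⁻¹

/-- A `⋆`-bundle `π : P → M`: the principal bundle obtained from a `⋆`-family by gluing the pieces
`U i × G` along `(x, g) ∈ U i × G ∼ (x, g * φ i j x) ∈ U j × G`, with `π (x, g) = x` and with the
action of `G × G` given on every piece by `(q, r) • (x, g) = (q x, r g q⁻¹)`. The `⋆`-action is
that of the first factor and the principal (`•`-)action is that of the second factor. The gluing is
expressed through the inclusions `triv i` of the pieces, which are diffeomorphisms of `U i × G`
onto `π ⁻¹ (U i)`. -/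
structure StarBundle (d m : ℕ) {EP HP : Type*} [NormedAddCommGroup EP] [NormedSpace ℝ EP]
    [TopologicalSpace HP] (IP : ModelWithCorners ℝ EP HP) (G M P : Type u)
    [Group G] [TopologicalSpace G] [ChartedSpace (EuclideanSpace ℝ (Fin d)) G]
    [TopologicalSpace M] [ChartedSpace (EuclideanSpace ℝ (Fin m)) M] [SMul G M]
    [TopologicalSpace P] [ChartedSpace HP P] [SMul (G × G) P]
    extends StarFamily d m G M where
  proj : P → M
  triv : ι → PartialDiffeomorph ((𝓡 m).prod (𝓡 d)) IP (M × G) P ∞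
  triv_source : ∀ i, (triv i).source = U i ×ˢ univ
  triv_target : ∀ i, (triv i).target = proj ⁻¹' U i
  proj_triv : ∀ i, ∀ x ∈ U i, ∀ g : G, proj (triv i (x, g)) = x
  triv_change : ∀ i j, ∀ x ∈ U i ∩ U j, ∀ g : G, triv i (x, g) = triv j (x, g * φ i j x)
  smul_triv : ∀ i, ∀ x ∈ U i, ∀ g q r : G,
    (q, r) • triv i (x, g) = triv i (q • x, r * g * q⁻¹)

/-- The total space `f^*P = {(x, y) ∈ N × P | f x = π y}` of the induced bundle. -/
def StarBundle.pullback {d m : ℕ} {EP HP : Type*} [NormedAddCommGroup EP] [NormedSpace ℝ EP]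
    [TopologicalSpace HP] {IP : ModelWithCorners ℝ EP HP} {G M P : Type u}
    [Group G] [TopologicalSpace G] [ChartedSpace (EuclideanSpace ℝ (Fin d)) G]
    [TopologicalSpace M] [ChartedSpace (EuclideanSpace ℝ (Fin m)) M] [SMul G M]
    [TopologicalSpace P] [ChartedSpace HP P] [SMul (G × G) P]
    (B : StarBundle d m IP G M P) {N : Type*} (f : N → M) : Set (N × P) :=
  {a | f a.1 = B.proj a.2}

/-- The smooth `G`-manifold `X` is the quotient of `f^*P` by the induced `⋆`-action
`q (x, y) = (q x, (q, 1) y)`, with the `G`-action induced by the principal action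
`r (x, y) = (x, (1, r) y)`. That is, there is a surjective submersion `f^*P → X` whose fibres are
exactly the orbits of the `⋆`-action and which intertwines the principal action on `f^*P` with the
action on `X`; this determines `X` up to equivariant diffeomorphism.
Here `f^*P` is a closed embedded submanifold of `N × P`. For functions on it, smoothness on the
submanifold is the same as smoothness on the subset in the sense of `ContMDiffOn` (both amount to
having smooth local extensions), and being a submersion is the same as having, through each point,
a smooth local section (a smooth map to `N × P` with values in `f^*P`). -/
def StarBundle.IsStarQuotient {d m : ℕ} {EP HP : Type*} [NormedAddCommGroup EP]
    [NormedSpace ℝ EP] [TopologicalSpace HP] {IP : ModelWithCorners ℝ EP HP} {G M P : Type u}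
    [Group G] [TopologicalSpace G] [ChartedSpace (EuclideanSpace ℝ (Fin d)) G]
    [TopologicalSpace M] [ChartedSpace (EuclideanSpace ℝ (Fin m)) M] [SMul G M]
    [TopologicalSpace P] [ChartedSpace HP P] [SMul (G × G) P]
    (B : StarBundle d m IP G M P) (n : ℕ) {N : Type*} [TopologicalSpace N]
    [ChartedSpace (EuclideanSpace ℝ (Fin n)) N] [SMul G N] (f : EqMap G N M)
    (X : SmoothGManifold d G) : Prop :=
  ∃ q : N × P → X.carrier,
    ContMDiffOn ((𝓡 n).prod IP) (𝓡 X.dim) ∞ q (B.pullback f) ∧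
    q '' B.pullback f = univ ∧
    (∀ a ∈ B.pullback f, ∀ b ∈ B.pullback f,
      q a = q b ↔ ∃ g : G, b = (g • a.1, (g, (1 : G)) • a.2)) ∧
    (∀ a ∈ B.pullback f, ∀ r : G, q (a.1, ((1 : G), r) • a.2) = r • q a) ∧
    (∀ a ∈ B.pullback f, ∃ V : Set X.carrier, IsOpen V ∧ q a ∈ V ∧ ∃ s : X.carrier → N × P,
      ContMDiffOn (𝓡 X.dim) ((𝓡 n).prod IP) ∞ s V ∧ s (q a) = a ∧
      ∀ y ∈ V, s y ∈ B.pullback f ∧ q (s y) = y)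

/-! Smoothing is done by centres of mass, without Riemannian metrics or embeddings. A function `ρ`
on `M × M` that behaves like a squared distance is built from charts and made invariant by Haar
averaging (`exists_isSeparating`, `IsSeparating.orbitAverage`). Near `f`, choose local smooth maps
and a partition of unity; the weighted sum of the `ρ`-distances to these maps, averaged over `G`, is
a function `Φ x` on `M`, and `f' x` is its minimum point. For `w` in a small set, `ρ · w` is
strongly convex on a chart ball and larger off the ball than at its centre (`IsGood`). These are
linear inequalities between at most three values, so they pass to averages (`IsAverageOf`). Hence
the minimum is unique, therefore equivariant; it is continuous in parameters by compactness and
smooth by the implicit function theorem. Minimising `(1 - t) ρ(·, f x) + t Φ x` gives a homotopy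
from `f` to `f'`. Over a closed invariant set where all local maps equal `f`, nothing changes;
applied to `ℝ × N` this relative form makes homotopies between smooth maps smooth
(`EqMap.Homotopic.exists_smooth_homotopy`).

For `DR`, equivariance of `β` shows that the hat construction reverses products (`hatDiffeo_mul`),
so its inverse is multiplicative, and smooth homotopies give isotopies (`mk_hatDiffeo_inv_eq`).

For `DR_π`, a point of `f^*P` over `x` with fibre coordinate `g` is sent to `g x`. This is constant
on `⋆`-orbits and identifies the quotient over `U i` with `f⁻¹ (U i)`; the transition maps are `z ↦
φ i j (f z) z` (`exists_isStarQuotient`). For homotopy invariance one compares `f₀^*P` and `f₁^*P`.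
If `f₀` and `f₁` agree off a closed set that both map into one `U i`, keeping the fibre coordinate
is an isomorphism (`starIsoOn_of_trivialization`). A smooth homotopy `F` splits into such moves:
consider the maps `x ↦ F (s x) x` for invariant time functions `s`, and push `s` from `0` past `1`
by small steps supported in a locally finite family of invariant sets (`exists_advance`,
`starIsoOn_of_locally_eventually_eq`). An isomorphism of induced bundles descends to an equivariant
diffeomorphism of the quotients, since smoothness can be tested on local sections. -/

/-! ### Smooth dependence of derivatives on parameters -/

open MeasureTheory Filter in
/-- The partial derivative in a vector variable of a jointly smooth function is jointly smooth. -/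
theorem ContMDiffAt.fderiv_partial {EX HX : Type*} [NormedAddCommGroup EX] [NormedSpace ℝ EX]
    [TopologicalSpace HX] {IX : ModelWithCorners ℝ EX HX} {X : Type*} [TopologicalSpace X]
    [ChartedSpace HX X] [IsManifold IX ∞ X] {E F : Type*} [NormedAddCommGroup E] [NormedSpace ℝ E]
    [NormedAddCommGroup F] [NormedSpace ℝ F] {f : X → E → F} {x₀ : X} {u₀ : E}
    (hf : ContMDiffAt (IX.prod 𝓘(ℝ, E)) 𝓘(ℝ, F) ∞ (Function.uncurry f) (x₀, u₀)) :
    ContMDiffAt (IX.prod 𝓘(ℝ, E)) 𝓘(ℝ, E →L[ℝ] F) ∞ (fun p : X × E => fderiv ℝ (f p.1) p.2)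
      (x₀, u₀) := by
  -- The parameter space is enlarged to `X × E`, so that the point of differentiation becomes part
  -- of the parameter.
  have h1 : ContMDiffAt ((IX.prod 𝓘(ℝ, E)).prod 𝓘(ℝ, E)) 𝓘(ℝ, F) ∞
      (Function.uncurry fun (p : X × E) (u : E) => f p.1 u) ((x₀, u₀), u₀) := by
    have : (Function.uncurry fun (p : X × E) (u : E) => f p.1 u) =
      Function.uncurry f ∘ fun q : (X × E) × E => (q.1.1, q.2) := rfl
    rw [this]
    exact ContMDiffAt.comp (x := ((x₀, u₀), u₀)) (g := Function.uncurry f) hf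
      ((contMDiff_fst.comp contMDiff_fst).prodMk contMDiff_snd).contMDiffAt
  have h2 := ContMDiffAt.mfderiv (m := ∞) (fun (p : X × E) (u : E) => f p.1 u) Prod.snd h1
    contMDiffAt_snd (by simp)
  have h3 := inTangentCoordinates_model_space (I := 𝓘(ℝ, E)) (I' := 𝓘(ℝ, F)) Prod.snd
    (fun x : X × E => f x.1 x.2) (fun x => fderiv ℝ (f x.1) x.2) (x₀, u₀)
  have h4 : (fun x : X × E => fderiv ℝ (f x.1) x.2) =
      fun x => mfderiv 𝓘(ℝ, E) 𝓘(ℝ, F) (f x.1) x.2 := by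
    ext1 x
    exact mfderiv_eq_fderiv.symm
  rw [← h3, h4]
  exact h2

/-! ### Integrals over a compact manifold -/

section ParametricIntegral
open MeasureTheory Filter

variable {EK HK : Type*} [NormedAddCommGroup EK] [NormedSpace ℝ EK]
    [TopologicalSpace HK] {IK : ModelWithCorners ℝ EK HK} {K : Type*} [TopologicalSpace K]
    [ChartedSpace HK K] [IsManifold IK ∞ K]

theorem contMDiffOn_fderiv_left {E F : Type*} [NormedAddCommGroup E] [NormedSpace ℝ E]
    [NormedAddCommGroup F] [NormedSpace ℝ F] {U : Set E}
    (hU : IsOpen U) {f : E → K → F}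
    (hf : ContMDiffOn (𝓘(ℝ, E).prod IK) 𝓘(ℝ, F) ∞ (Function.uncurry f) (U ×ˢ univ)) :
    ContMDiffOn (𝓘(ℝ, E).prod IK) 𝓘(ℝ, E →L[ℝ] F) ∞
      (Function.uncurry fun u k => fderiv ℝ (fun u => f u k) u) (U ×ˢ univ) := by
  rintro ⟨u, k⟩ hp
  have hnhds : U ×ˢ (univ : Set K) ∈ 𝓝 (u, k) := (hU.prod isOpen_univ).mem_nhds hp
  have h1 : ContMDiffAt (IK.prod 𝓘(ℝ, E)) 𝓘(ℝ, F) ∞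
      (Function.uncurry fun (k : K) (u : E) => f u k) (k, u) :=
    ContMDiffAt.comp (x := (k, u)) (g := Function.uncurry f) (hf.contMDiffAt hnhds)
      (contMDiff_snd.prodMk contMDiff_fst).contMDiffAt
  exact (ContMDiffAt.comp (x := (u, k)) (f := Prod.swap) h1.fderiv_partial
      (contMDiff_snd.prodMk contMDiff_fst).contMDiffAt).contMDiffWithinAt

variable [CompactSpace K] [MeasurableSpace K] [BorelSpace K]
    [SecondCountableTopology K] (μ : Measure K) [IsFiniteMeasure μ]

theorem Continuous.integrable_of_compactSpace {F : Type*} [NormedAddCommGroup F] {f : K → F}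
    (hf : Continuous f) : Integrable f μ := by
  obtain ⟨C, hC⟩ := isCompact_univ.exists_bound_of_continuousOn hf.continuousOn
  exact Integrable.of_bound hf.aestronglyMeasurable C (Eventually.of_forall fun x => hC x trivial)

/-- By compactness of `K`, the continuous partial derivative is bounded uniformly in `k` for all
parameters near `u`. A constant thus dominates it, and one may differentiate under the integral. -/
theorem hasFDerivAt_integral_of_compactSpace {E F : Type*} [NormedAddCommGroup E] [NormedSpace ℝ E]
    [NormedAddCommGroup F] [NormedSpace ℝ F] {U : Set E}
    (hU : IsOpen U) {f : E → K → F}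
    (hf : ContMDiffOn (𝓘(ℝ, E).prod IK) 𝓘(ℝ, F) ∞ (Function.uncurry f) (U ×ˢ univ))
    {u : E} (hu : u ∈ U) :
    HasFDerivAt (fun u => ∫ k, f u k ∂μ) (∫ k, fderiv ℝ (fun u => f u k) u ∂μ) u := by
  have hf' := contMDiffOn_fderiv_left hU hf
  have hs (u' : E) (hu' : u' ∈ U) : Continuous (f u') :=
    continuousOn_univ.1 (hf.continuousOn.comp (f := fun k : K => (u', k)) (by fun_prop)
      fun k _ => ⟨hu', trivial⟩)
  have hs' (u' : E) (hu' : u' ∈ U) : Continuous fun k => fderiv ℝ (fun u => f u k) u' :=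
    continuousOn_univ.1 (hf'.continuousOn.comp (f := fun k : K => (u', k)) (by fun_prop)
      fun k _ => ⟨hu', trivial⟩)
  obtain ⟨C, hC⟩ := isCompact_univ.exists_bound_of_continuousOn (hs' u hu).continuousOn
  have hbd : ∀ᶠ u' in 𝓝 u, ∀ k ∈ (univ : Set K), ‖fderiv ℝ (fun u => f u k) u'‖ ≤ C + 1 := by
    refine isCompact_univ.eventually_forall_of_forall_eventually fun k _ => ?_
    have hc : ContinuousAt (fun p : E × K => ‖fderiv ℝ (fun u => f u p.2) p.1‖) (u, k) :=
      (hf'.continuousOn.continuousAt ((hU.prod isOpen_univ).mem_nhds ⟨hu, trivial⟩)).norm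
    filter_upwards [hc.eventually_lt_const (show _ < C + 1 by linarith [hC k trivial])]
      with p hp using hp.le
  refine hasFDerivAt_integral_of_dominated_of_fderiv_le (bound := fun _ => C + 1)
    (F' := fun u k => fderiv ℝ (fun u => f u k) u)
    (hbd.and (hU.mem_nhds hu)) ?_ ((hs u hu).integrable_of_compactSpace μ)
    (hs' u hu).aestronglyMeasurable (.of_forall fun k u' hu' => hu'.1 k trivial)
    (integrable_const _) (.of_forall fun k u' hu' => ?_)
  · filter_upwards [hU.mem_nhds hu] with u' hu' using (hs u' hu').aestronglyMeasurable
  · have h1 : ContMDiffAt 𝓘(ℝ, E) 𝓘(ℝ, F) ∞ (fun u => f u k) u' :=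
      ContMDiffAt.comp (x := u') (g := Function.uncurry f) (f := fun u => (u, k))
        (hf.contMDiffAt ((hU.prod isOpen_univ).mem_nhds ⟨hu'.2, trivial⟩))
        (contMDiffAt_id.prodMk contMDiffAt_const)
    exact (h1.contDiffAt.differentiableAt (by simp)).hasFDerivAt

/-- The derivative of the integral is the integral of the derivative, a function of the same kind
with values in `E →L[ℝ] F`. The induction on the order of differentiability therefore runs over all
target spaces at once. -/
theorem contDiffOn_integral_of_compactSpace {E F : Type} [NormedAddCommGroup E] [NormedSpace ℝ E]
    [NormedAddCommGroup F] [NormedSpace ℝ F] [CompleteSpace F] {U : Set E} (hU : IsOpen U)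
    {f : E → K → F}
    (hf : ContMDiffOn (𝓘(ℝ, E).prod IK) 𝓘(ℝ, F) ∞ (Function.uncurry f) (U ×ˢ univ)) :
    ContDiffOn ℝ ∞ (fun u => ∫ k, f u k ∂μ) U := by
  suffices h : ∀ n : ℕ, ∀ (F : Type) [NormedAddCommGroup F] [NormedSpace ℝ F]
      (f : E → K → F),
      ContMDiffOn (𝓘(ℝ, E).prod IK) 𝓘(ℝ, F) ∞ (Function.uncurry f) (U ×ˢ univ) →
      ContDiffOn ℝ n (fun u => ∫ k, f u k ∂μ) U from
    contDiffOn_infty.2 fun n => h n F f hf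
  intro n
  induction n with
  | zero =>
    intro F _ _ f hf
    simp only [CharP.cast_eq_zero, contDiffOn_zero]
    exact fun u hu =>
      (hasFDerivAt_integral_of_compactSpace μ hU hf hu).continuousAt.continuousWithinAt
  | succ n ih =>
    intro F _ _ f hf
    push_cast
    rw [contDiffOn_succ_iff_fderiv_of_isOpen hU]
    refine ⟨fun u hu => (hasFDerivAt_integral_of_compactSpace μ hU
      hf hu).differentiableAt.differentiableWithinAt, by simp, ?_⟩
    exact (ih _ _ (contMDiffOn_fderiv_left hU hf)).congr fun u hu =>
      (hasFDerivAt_integral_of_compactSpace μ hU hf hu).fderiv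

/-- Integrals of jointly smooth functions over a compact manifold are smooth in the parameter. -/
theorem contMDiff_integral_of_compactSpace {EX HX : Type} [NormedAddCommGroup EX] [NormedSpace ℝ EX]
    [TopologicalSpace HX] {IX : ModelWithCorners ℝ EX HX} [IX.Boundaryless]
    {X : Type*} [TopologicalSpace X]
    [ChartedSpace HX X] [IsManifold IX ∞ X] {f : X → K → ℝ}
    (hf : ContMDiff (IX.prod IK) 𝓘(ℝ, ℝ) ∞ (Function.uncurry f)) :
    ContMDiff IX 𝓘(ℝ, ℝ) ∞ (fun x => ∫ k, f x k ∂μ) := by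
  intro x₀
  have h1 : ContDiffOn ℝ ∞ (fun u => ∫ k, f ((extChartAt IX x₀).symm u) k ∂μ)
      (extChartAt IX x₀).target := by
    refine contDiffOn_integral_of_compactSpace (IK := IK) μ (isOpen_extChartAt_target x₀) ?_
    refine hf.comp_contMDiffOn (f := fun p : EX × K => ((extChartAt IX x₀).symm p.1, p.2)) ?_
    refine ContMDiffOn.prodMk ?_ contMDiffOn_snd
    exact (contMDiffOn_extChartAt_symm x₀).comp contMDiffOn_fst fun p hp => hp.1
  have h2 : ContMDiffAt IX 𝓘(ℝ, ℝ) ∞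
      ((fun u => ∫ k, f ((extChartAt IX x₀).symm u) k ∂μ) ∘ extChartAt IX x₀) x₀ :=
    (h1.contDiffAt ((isOpen_extChartAt_target x₀).mem_nhds
      (mem_extChartAt_target x₀))).contMDiffAt.comp x₀ contMDiffAt_extChartAt
  refine h2.congr_of_eventuallyEq ?_
  filter_upwards [extChartAt_source_mem_nhds (I := IX) x₀] with x hx
  simp only [Function.comp_apply, (extChartAt IX x₀).left_inv hx]

end ParametricIntegral

open Filter in
/-- A jointly smooth function is locally Lipschitz in a vector variable, uniformly in the other. -/
theorem ContMDiffAt.exists_eventually_norm_sub_le {EX HX : Type*} [NormedAddCommGroup EX]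
    [NormedSpace ℝ EX] [TopologicalSpace HX] {IX : ModelWithCorners ℝ EX HX} [IX.Boundaryless]
    {X : Type*} [TopologicalSpace X] [ChartedSpace HX X] [IsManifold IX ∞ X] {E F : Type*}
    [NormedAddCommGroup E] [NormedSpace ℝ E] [NormedAddCommGroup F] [NormedSpace ℝ F]
    {T : X × E → F} {x₀ : X} {u₀ : E}
    (hT : ContMDiffAt (IX.prod 𝓘(ℝ, E)) 𝓘(ℝ, F) ∞ T (x₀, u₀)) :
    ∃ K : ℝ, 0 ≤ K ∧ ∀ᶠ p : X × E × E in 𝓝 (x₀, u₀, u₀),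
      ‖T (p.1, p.2.1) - T (p.1, p.2.2)‖ ≤ K * ‖p.2.1 - p.2.2‖ := by
  set φ := extChartAt IX x₀
  have h1 : ContMDiffAt (𝓘(ℝ, EX).prod 𝓘(ℝ, E)) 𝓘(ℝ, F) ∞
      (fun q : EX × E => T (φ.symm q.1, q.2)) (φ x₀, u₀) := by
    refine ContMDiffAt.comp_of_eq (g := T) (y := (x₀, u₀)) hT ?_ (by simp [φ])
    refine ContMDiffAt.prodMk ?_ contMDiffAt_snd
    exact ((contMDiffOn_extChartAt_symm x₀).contMDiffAt ((isOpen_extChartAt_target x₀).mem_nhds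
      (mem_extChartAt_target x₀))).comp (x := (φ x₀, u₀)) (f := Prod.fst) contMDiffAt_fst
  rw [← modelWithCornersSelf_prod, chartedSpaceSelf_prod, contMDiffAt_iff_contDiffAt] at h1
  obtain ⟨K, t, ht, hK⟩ := (h1.of_le (m := 1) (by exact_mod_cast le_top)).exists_lipschitzOnWith
  refine ⟨K, K.2, ?_⟩
  have hc : ContinuousAt φ x₀ := continuousAt_extChartAt x₀
  have t1 : ∀ᶠ p : X × E × E in 𝓝 (x₀, u₀, u₀), (φ p.1, p.2.1) ∈ t :=
    ContinuousAt.eventually_mem (f := fun p : X × E × E => (φ p.1, p.2.1))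
      ((hc.comp_of_eq continuousAt_fst rfl).prodMk (by fun_prop)) ht
  have t2 : ∀ᶠ p : X × E × E in 𝓝 (x₀, u₀, u₀), (φ p.1, p.2.2) ∈ t :=
    ContinuousAt.eventually_mem (f := fun p : X × E × E => (φ p.1, p.2.2))
      ((hc.comp_of_eq continuousAt_fst rfl).prodMk (by fun_prop)) ht
  have t3 : ∀ᶠ p : X × E × E in 𝓝 (x₀, u₀, u₀), p.1 ∈ φ.source :=
    continuousAt_fst.eventually_mem (extChartAt_source_mem_nhds x₀)
  filter_upwards [t1, t2, t3] with p h1 h2 h3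
  have := hK.norm_sub_le h1 h2
  simpa [φ.left_inv h3, Prod.norm_def] using this

open Filter in
/-- A sum `∑ᶠ i, λ i x * k i x y` with a smooth partition of unity `λ` and functions `k i` that are
smooth over an open neighbourhood of the support of `λ i` is smooth. -/
theorem SmoothPartitionOfUnity.contMDiff_finsum_mul {EN HN : Type*} [NormedAddCommGroup EN]
    [NormedSpace ℝ EN] [TopologicalSpace HN] {IN : ModelWithCorners ℝ EN HN}
    {N : Type*} [TopologicalSpace N] [ChartedSpace HN N] {EM HM : Type*} [NormedAddCommGroup EM]
    [NormedSpace ℝ EM] [TopologicalSpace HM] {IM : ModelWithCorners ℝ EM HM}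
    {M : Type*} [TopologicalSpace M] [ChartedSpace HM M] {ι : Type*}
    (lam : SmoothPartitionOfUnity ι IN N univ) {V : ι → Set N} (hV : ∀ i, IsOpen (V i))
    (hlam : ∀ i, tsupport (lam i) ⊆ V i) {k : ι → N → M → ℝ}
    (hk : ∀ i, ContMDiffOn (IN.prod IM) 𝓘(ℝ, ℝ) ∞ (Function.uncurry (k i)) (V i ×ˢ univ)) :
    ContMDiff (IN.prod IM) 𝓘(ℝ, ℝ) ∞ (fun p : N × M => ∑ᶠ i, lam i p.1 * k i p.1 p.2) := by
  refine contMDiff_finsum (fun i => ?_) ?_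
  · rintro ⟨x, y⟩
    by_cases hx : x ∈ tsupport (lam i)
    · have h1 := (hk i).contMDiffAt (x := (x, y))
        (((hV i).prod isOpen_univ).mem_nhds ⟨hlam i hx, trivial⟩)
      have h2 : ContMDiffAt (IN.prod IM) 𝓘(ℝ, ℝ) ∞ (fun p : N × M => lam i p.1) (x, y) :=
        ((lam i).contMDiff.comp contMDiff_fst).contMDiffAt
      exact h2.mul h1
    · refine contMDiffAt_const (c := (0 : ℝ)) |>.congr_of_eventuallyEq ?_
      have : ∀ᶠ p : N × M in 𝓝 (x, y), p.1 ∈ (tsupport (lam i))ᶜ :=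
        continuousAt_fst.eventually_mem ((isClosed_tsupport _).isOpen_compl.mem_nhds hx)
      filter_upwards [this] with p hp
      rw [image_eq_zero_of_notMem_tsupport hp, zero_mul]
  · refine (lam.locallyFinite.preimage_continuous (g := (Prod.fst : N × M → N))
      continuous_fst).subset fun i p hp => ?_
    exact left_ne_zero_of_mul hp

/-! ### A smooth substitute for the squared distance -/

section Separating
variable {m : ℕ} {M : Type*} [TopologicalSpace M] [ChartedSpace (EuclideanSpace ℝ (Fin m)) M]

/-- A smooth nonnegative function on `M × M` which behaves like the square of a distance. -/
structure IsSeparating (m : ℕ) {M : Type*} [TopologicalSpace M]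
    [ChartedSpace (EuclideanSpace ℝ (Fin m)) M] (ρ : M → M → ℝ) : Prop where
  smooth : ContMDiff ((𝓡 m).prod (𝓡 m)) 𝓘(ℝ, ℝ) ∞ (Function.uncurry ρ)
  nonneg : ∀ y z, 0 ≤ ρ y z
  self_eq_zero : ∀ z, ρ z z = 0
  away : ∀ z₀, ∀ B ∈ 𝓝 z₀, ∃ δ > 0, ∀ᶠ z in 𝓝 z₀, ∀ y ∉ B, δ ≤ ρ y z
  quadratic : ∀ z₀, ∃ c > 0, ∀ᶠ p : M × M in 𝓝 (z₀, z₀),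
    c * ‖extChartAt (𝓡 m) z₀ p.1 - extChartAt (𝓡 m) z₀ p.2‖ ^ 2 ≤ ρ p.1 p.2

/-- The square of the chart distance, cut off by a bump function. -/
noncomputable def chartSqDist {c : M} (χ : SmoothBumpFunction (𝓡 m) c) (z y : M) : ℝ :=
  ‖χ y • extChartAt (𝓡 m) c y - extChartAt (𝓡 m) c z‖ ^ 2 + (1 - χ y) ^ 2

-- If the value is small, then `χ y` is close to `1` and `χ y • φ y` is close to `φ z`, hence to `φ
-- z₀`. Then `χ y ≠ 0` puts `y` in the chart domain, and `y = φ.symm ((χ y)⁻¹ • (χ y • φ y))` is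
-- close to `z₀` by continuity of `(a, v) ↦ φ.symm (a⁻¹ • v)` at `(1, φ z₀)`.
open Filter in
theorem chartSqDist_away {c z₀ : M} (χ : SmoothBumpFunction (𝓡 m) c)
    (hz₀ : z₀ ∈ (extChartAt (𝓡 m) c).source) {B : Set M} (hB : B ∈ 𝓝 z₀) :
    ∃ δ > 0, ∀ᶠ z in 𝓝 z₀, ∀ y ∉ B, δ ≤ chartSqDist χ z y := by
  set φ := extChartAt (𝓡 m) c
  have h1 : ∀ᶠ p : ℝ × EuclideanSpace ℝ (Fin m) in 𝓝 (1, φ z₀),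
      φ.symm (p.1⁻¹ • p.2) ∈ B ∧ p.1 ≠ 0 := by
    have hc : ContinuousAt (fun p : ℝ × EuclideanSpace ℝ (Fin m) => p.1⁻¹ • p.2) (1, φ z₀) :=
      (continuousAt_fst.inv₀ (by simp)).smul continuousAt_snd
    have hc' : ContinuousAt (fun p : ℝ × EuclideanSpace ℝ (Fin m) => φ.symm (p.1⁻¹ • p.2))
        (1, φ z₀) :=
      ContinuousAt.comp_of_eq (continuousAt_extChartAt_symm' hz₀) hc (by simp [φ])
    refine (hc'.eventually_mem (by simpa [φ.left_inv hz₀] using hB)).and ?_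
    exact continuousAt_fst.eventually_ne (by simp)
  obtain ⟨ε, hε, h1⟩ := Metric.eventually_nhds_iff.1 h1
  refine ⟨(ε / 2) ^ 2, by positivity, ?_⟩
  have hcz : ContinuousAt φ z₀ := continuousAt_extChartAt' hz₀
  filter_upwards [hcz.eventually_mem (Metric.ball_mem_nhds _ (half_pos hε))] with z hz y hy
  by_contra! hlt
  rw [Metric.mem_ball, dist_eq_norm] at hz
  have h2 : |1 - χ y| < ε / 2 :=
    abs_lt_of_sq_lt_sq (lt_of_le_of_lt (le_add_of_nonneg_left (by positivity)) hlt) (by positivity)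
  have h3 : ‖χ y • φ y - φ z‖ < ε / 2 :=
    lt_of_pow_lt_pow_left₀ 2 (by positivity)
      (lt_of_le_of_lt (le_add_of_nonneg_right (by positivity)) hlt)
  have h4 : dist ((χ y, χ y • φ y) : ℝ × EuclideanSpace ℝ (Fin m)) (1, φ z₀) < ε := by
    rw [Prod.dist_eq, max_lt_iff]
    constructor
    · rw [dist_comm, Real.dist_eq]; linarith
    · rw [dist_eq_norm]
      calc _ = ‖(χ y • φ y - φ z) + (φ z - φ z₀)‖ := by simp
        _ ≤ _ := norm_add_le _ _
        _ < ε := by linarith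
  obtain ⟨h5, h6⟩ := h1 h4
  have h7 : y ∈ φ.source := by
    simpa [φ] using χ.support_subset_source h6
  rw [smul_smul, inv_mul_cancel₀ h6, one_smul, φ.left_inv h7] at h5
  exact hy h5

variable [IsManifold (𝓡 m) ∞ M]

-- Where `χ = 1` the function is the squared distance in the chart at `c`, and the change to the
-- chart at `z₀` is locally Lipschitz.
open Filter in
theorem chartSqDist_quadratic {c z₀ : M} (χ : SmoothBumpFunction (𝓡 m) c)
    (hz₀ : z₀ ∈ (extChartAt (𝓡 m) c).source) (hχ : ∀ᶠ y in 𝓝 z₀, χ y = 1) :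
    ∃ a > 0, ∀ᶠ p : M × M in 𝓝 (z₀, z₀),
      a * ‖extChartAt (𝓡 m) z₀ p.1 - extChartAt (𝓡 m) z₀ p.2‖ ^ 2 ≤ chartSqDist χ p.2 p.1 := by
  set φ := extChartAt (𝓡 m) c with hφ
  set ψ := extChartAt (𝓡 m) z₀ with hψ
  have h1 : ContMDiffAt ((𝓡 m).prod (𝓡 m)) (𝓡 m) ∞
      (fun p : M × EuclideanSpace ℝ (Fin m) => ψ (φ.symm p.2)) (z₀, φ z₀) := by
    refine ContMDiffAt.comp_of_eq (y := z₀) contMDiffAt_extChartAt ?_ (by simp [φ.left_inv hz₀])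
    exact ((contMDiffOn_extChartAt_symm c).contMDiffAt
      ((isOpen_extChartAt_target c).mem_nhds (φ.map_source hz₀))).comp (z₀, φ z₀) contMDiffAt_snd
  obtain ⟨K, hK0, hK⟩ := h1.exists_eventually_norm_sub_le
  have hc : ContinuousAt φ z₀ := continuousAt_extChartAt' hz₀
  have hK' : ∀ᶠ p : M × M in 𝓝 (z₀, z₀), ‖ψ (φ.symm (φ p.1)) - ψ (φ.symm (φ p.2))‖ ≤
      K * ‖φ p.1 - φ p.2‖ := by
    have : Tendsto (fun p : M × M => (z₀, φ p.1, φ p.2)) (𝓝 (z₀, z₀)) (𝓝 (z₀, φ z₀, φ z₀)) :=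
      ContinuousAt.prodMk (continuousAt_const) ((hc.comp_of_eq continuousAt_fst rfl).prodMk
        (hc.comp_of_eq continuousAt_snd rfl))
    exact this.eventually hK
  -- The summand `1` keeps the constant positive when the Lipschitz constant `K` is `0`.
  refine ⟨(K ^ 2 + 1)⁻¹, by positivity, ?_⟩
  have hs : φ.source ∈ 𝓝 z₀ := extChartAt_source_mem_nhds' hz₀
  filter_upwards [hK', hχ.prod_inl_nhds z₀,
    continuousAt_fst.eventually_mem (x := (z₀, z₀)) hs,
    continuousAt_snd.eventually_mem (x := (z₀, z₀)) hs] with p h1 h2 h3 h4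
  rw [φ.left_inv h3, φ.left_inv h4] at h1
  rw [chartSqDist, h2, one_smul, sub_self]
  rw [inv_mul_le_iff₀ (by positivity)]
  have : ‖ψ p.1 - ψ p.2‖ ^ 2 ≤ (K * ‖φ p.1 - φ p.2‖) ^ 2 := by gcongr
  nlinarith [sq_nonneg ‖φ p.1 - φ p.2‖]

variable [T2Space M]

/-- The cutoff makes `χ y • φ y` smooth for all `y`, so only `z` has to stay in the chart domain. -/
theorem chartSqDist_contMDiffOn {c : M} (χ : SmoothBumpFunction (𝓡 m) c) :
    ContMDiffOn ((𝓡 m).prod (𝓡 m)) 𝓘(ℝ, ℝ) ∞ (Function.uncurry (chartSqDist χ))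
      ((extChartAt (𝓡 m) c).source ×ˢ univ) := by
  have h1 : ContMDiff (𝓡 m) 𝓘(ℝ, EuclideanSpace ℝ (Fin m)) ∞
      (fun y => χ y • extChartAt (𝓡 m) c y) :=
    χ.contMDiff_smul contMDiffOn_extChartAt
  have h2 : ContMDiffOn ((𝓡 m).prod (𝓡 m)) 𝓘(ℝ, EuclideanSpace ℝ (Fin m)) ∞
      (fun p : M × M => χ p.2 • extChartAt (𝓡 m) c p.2 - extChartAt (𝓡 m) c p.1)
      ((extChartAt (𝓡 m) c).source ×ˢ univ) := by
    refine (h1.comp contMDiff_snd).contMDiffOn.sub ?_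
    refine contMDiffOn_extChartAt.comp (t := (chartAt _ c).source) contMDiffOn_fst fun p hp => ?_
    simpa using hp.1
  have h3 : ContMDiff ((𝓡 m).prod (𝓡 m)) 𝓘(ℝ, ℝ) ∞ (fun p : M × M => χ p.2) :=
    χ.contMDiff.comp contMDiff_snd
  have h4 : ContDiff ℝ ∞ (fun v : EuclideanSpace ℝ (Fin m) => ‖v‖ ^ 2) := contDiff_norm_sq ℝ
  have h5 : ContDiff ℝ ∞ (fun v : ℝ => (1 - v) ^ 2) := by fun_prop
  exact (h4.contMDiff.comp_contMDiffOn h2).add (h5.contMDiff.comp h3).contMDiffOn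

/-- Sum the functions `chartSqDist (χ c) z y` with a partition of unity in `z` subordinate to the
interiors of `{χ c = 1}`. On the diagonal every term with nonzero weight vanishes. All terms are
nonnegative, so the two lower bounds follow from a single term whose weight is bounded below near
`z₀`. -/
theorem exists_isSeparating [SecondCountableTopology M] : ∃ ρ : M → M → ℝ, IsSeparating m ρ := by
  have : LocallyCompactSpace M := ChartedSpace.locallyCompactSpace (EuclideanSpace ℝ (Fin m)) M
  let χ (c : M) : SmoothBumpFunction (𝓡 m) c := Classical.arbitrary _
  let V (c : M) : Set M := interior {y | χ c y = 1}
  have hV (c y : M) (hy : y ∈ V c) : χ c y = 1 := by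
    have : y ∈ {y | χ c y = 1} := interior_subset hy
    simpa using this
  have hV1 (c : M) : V c ⊆ (extChartAt (𝓡 m) c).source := fun y hy => by
    simpa using (χ c).support_subset_source (show χ c y ≠ 0 by simp [hV c y hy])
  obtain ⟨lam, hlam⟩ := SmoothPartitionOfUnity.exists_isSubordinate (𝓡 m) isClosed_univ V
    (fun c => isOpen_interior) (fun c _ => mem_iUnion.2 ⟨c, mem_interior_iff_mem_nhds.2
      (χ c).eventuallyEq_one⟩)
  have hle (c y z : M) : lam c z * chartSqDist (χ c) z y ≤
      ∑ᶠ c, lam c z * chartSqDist (χ c) z y := by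
    refine single_le_finsum (f := fun c => lam c z * chartSqDist (χ c) z y) c ((lam.locallyFinite.point_finite z).subset fun i hi => ?_)
      fun i => mul_nonneg (lam.nonneg _ _) (by unfold chartSqDist; positivity)
    exact left_ne_zero_of_mul hi
  have hpos (z₀ : M) : ∃ c, z₀ ∈ V c ∧ ∃ η > 0, ∀ᶠ z in 𝓝 z₀, η ≤ lam c z := by
    obtain ⟨c, hc⟩ := lam.exists_pos_of_mem (mem_univ z₀)
    refine ⟨c, hlam c (subset_tsupport _ hc.ne'), lam c z₀ / 2, half_pos hc, ?_⟩
    exact ((lam c).contMDiff.continuous.continuousAt.eventually_const_lt (half_lt_self hc)).mono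
      fun _ h => h.le
  refine ⟨fun y z => ∑ᶠ c, lam c z * chartSqDist (χ c) z y, ?_, ?_, ?_, ?_, ?_⟩
  · have := lam.contMDiff_finsum_mul (IM := 𝓡 m) (M := M) (V := V) (fun c => isOpen_interior) hlam
      (k := fun c => chartSqDist (χ c)) fun c => (chartSqDist_contMDiffOn (χ c)).mono
        (prod_mono_left (hV1 c))
    exact this.comp (contMDiff_snd.prodMk contMDiff_fst)
  · exact fun y z => finsum_nonneg fun c =>
      mul_nonneg (lam.nonneg _ _) (by unfold chartSqDist; positivity)
  · refine fun z => finsum_eq_zero_of_forall_eq_zero fun c => ?_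
    by_cases hc : lam c z = 0
    · rw [hc, zero_mul]
    · simp [chartSqDist, hV c z (hlam c (subset_tsupport _ hc))]
  · intro z₀ B hB
    obtain ⟨c, hc, η, hη, h1⟩ := hpos z₀
    obtain ⟨δ, hδ, h2⟩ := chartSqDist_away (χ c) (hV1 c hc) hB
    refine ⟨η * δ, by positivity, ?_⟩
    filter_upwards [h1, h2] with z h1 h2 y hy
    exact (mul_le_mul h1 (h2 y hy) hδ.le (hη.le.trans h1)).trans (hle c y z)
  · intro z₀
    obtain ⟨c, hc, η, hη, h1⟩ := hpos z₀
    obtain ⟨a, ha, h2⟩ := chartSqDist_quadratic (χ c) (hV1 c hc) (mem_interior_iff_mem_nhds.1 hc)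
    refine ⟨η * a, by positivity, ?_⟩
    filter_upwards [h1.prod_inr_nhds z₀, h2] with p h1 h2
    rw [mul_assoc]
    exact (mul_le_mul h1 h2 (by positivity) (hη.le.trans h1)).trans (hle c _ _)

end Separating

/-! ### Averaging over the group -/

section Average
open MeasureTheory Filter

variable {d : ℕ} {G : Type*} [Group G] [TopologicalSpace G] [IsTopologicalGroup G] [CompactSpace G]
  [ChartedSpace (EuclideanSpace ℝ (Fin d)) G] [LieGroup (𝓡 d) ∞ G]
  [MeasurableSpace G] [BorelSpace G] (μ : Measure G)

/-- The average of a function of two variables over the diagonal action of a compact group. -/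
noncomputable def orbitAverage {X Y : Type*} [SMul G X] [SMul G Y] (F : X → Y → ℝ) (x : X) (y : Y) :
    ℝ :=
  ∫ g, F (g⁻¹ • x) (g⁻¹ • y) ∂μ

omit [ChartedSpace (EuclideanSpace ℝ (Fin d)) G] [LieGroup (𝓡 d) ∞ G] [CompactSpace G] in
theorem orbitAverage_smul [μ.IsMulLeftInvariant] {X Y : Type*} [MulAction G X] [MulAction G Y]
    (F : X → Y → ℝ) (h : G) (x : X) (y : Y) :
    orbitAverage μ F (h • x) (h • y) = orbitAverage μ F x y := by
  unfold orbitAverage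
  rw [← integral_mul_left_eq_self _ h]
  simp [mul_smul]

section
variable {EX HX : Type} [NormedAddCommGroup EX] [NormedSpace ℝ EX]
    [TopologicalSpace HX] {IX : ModelWithCorners ℝ EX HX}
    {X : Type*} [TopologicalSpace X] [ChartedSpace HX X]
    [MulAction G X] [ContMDiffSMul (𝓡 d) IX ∞ G X]

include d in
omit [MeasurableSpace G] [BorelSpace G] [IsTopologicalGroup G] [CompactSpace G] in
theorem ContMDiffSMul.contMDiff_inv_smul :
    ContMDiff ((𝓡 d).prod IX) IX ∞ fun p : G × X => p.1⁻¹ • p.2 :=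
  (contMDiff_fst.inv).smul contMDiff_snd

variable [IX.Boundaryless] [IsManifold IX ∞ X] {EY HY : Type} [NormedAddCommGroup EY]
    [NormedSpace ℝ EY] [TopologicalSpace HY] {IY : ModelWithCorners ℝ EY HY} [IY.Boundaryless]
    {Y : Type*} [TopologicalSpace Y] [ChartedSpace HY Y] [IsManifold IY ∞ Y]
    [MulAction G Y] [ContMDiffSMul (𝓡 d) IY ∞ G Y]

include d in
omit [IsTopologicalGroup G] in
theorem orbitAverage_contMDiff [IsFiniteMeasure μ] {F : X → Y → ℝ}
    (hF : ContMDiff (IX.prod IY) 𝓘(ℝ, ℝ) ∞ (Function.uncurry F)) :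
    ContMDiff (IX.prod IY) 𝓘(ℝ, ℝ) ∞ (Function.uncurry (orbitAverage μ F)) := by
  have : SecondCountableTopology G :=
    ChartedSpace.secondCountable_of_sigmaCompact (EuclideanSpace ℝ (Fin d)) G
  have hG : IsManifold (𝓡 d) ∞ G := inferInstance
  refine contMDiff_integral_of_compactSpace (IK := 𝓡 d) (IX := IX.prod IY) (X := X × Y) μ
    (f := fun p g => F (g⁻¹ • p.1) (g⁻¹ • p.2)) ?_
  refine hF.comp (ContMDiff.prodMk ?_ ?_)
  · exact (contMDiff_snd.inv).smul (contMDiff_fst.comp contMDiff_fst)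
  · exact (contMDiff_snd.inv).smul (contMDiff_snd.comp contMDiff_fst)

end

include d in
omit [Group G] [IsTopologicalGroup G] [LieGroup (𝓡 d) ∞ G] in
theorem integral_ge_of_le_on_open [IsFiniteMeasure μ] {f : G → ℝ} (hf : Continuous f)
    (h0 : ∀ g, 0 ≤ f g) {A : Set G} (hA : IsOpen A) {c : ℝ} (hc : ∀ g ∈ A, c ≤ f g) :
    c * μ.real A ≤ ∫ g, f g ∂μ := by
  have : SecondCountableTopology G :=
    ChartedSpace.secondCountable_of_sigmaCompact (EuclideanSpace ℝ (Fin d)) G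
  have hi := hf.integrable_of_compactSpace μ
  refine le_trans ?_ (setIntegral_le_integral (s := A) hi (.of_forall h0))
  exact setIntegral_ge_of_const_le_real hA.measurableSet (measure_ne_top _ _) hc hi.integrableOn

variable {m : ℕ} {M : Type*} [TopologicalSpace M] [ChartedSpace (EuclideanSpace ℝ (Fin m)) M]
  [IsManifold (𝓡 m) ∞ M] [MulAction G M] [ContMDiffSMul (𝓡 d) (𝓡 m) ∞ G M]

-- As `ρ` is nonnegative, the integral is at least its part over a neighbourhood of `1`, which has
-- positive measure. For `g` in it, `g⁻¹` moves points near `z₀` only slightly, and the action is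
-- Lipschitz in charts uniformly in `g`, so the local bounds for `ρ` carry over with smaller
-- constants.
include d in
omit [IsTopologicalGroup G] in
theorem IsSeparating.orbitAverage [IsFiniteMeasure μ] [μ.IsOpenPosMeasure] {ρ : M → M → ℝ}
    (hρ : IsSeparating m ρ) : IsSeparating m (orbitAverage μ ρ) := by
  have hact := (ContMDiffSMul.contMDiff_inv_smul (d := d) (G := G) (IX := 𝓡 m) (X := M)).continuous
  have hact' := (contMDiff_smul (G := G) (M := M) (I := 𝓡 d) (I' := 𝓡 m) (n := ∞)).continuous
  have hcont (y z : M) : Continuous fun g : G => ρ (g⁻¹ • y) (g⁻¹ • z) :=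
    hρ.smooth.continuous.comp (f := fun g : G => (g⁻¹ • y, g⁻¹ • z))
      ((hact.comp (f := fun g : G => (g, y)) (by fun_prop)).prodMk
        (hact.comp (f := fun g : G => (g, z)) (by fun_prop)))
  have hpos {A : Set G} (hA : IsOpen A) (h1 : (1 : G) ∈ A) : 0 < μ.real A :=
    ENNReal.toReal_pos (hA.measure_pos μ ⟨1, h1⟩).ne' (measure_ne_top _ _)
  refine ⟨orbitAverage_contMDiff (d := d) μ hρ.smooth, fun y z => integral_nonneg fun g =>
    hρ.nonneg _ _, fun z => by simp [_root_.orbitAverage, hρ.self_eq_zero], ?_, ?_⟩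
  · intro z₀ B hB
    have h1 : ∀ᶠ p : G × M in 𝓝 (1, z₀), p.1 • p.2 ∈ B :=
      hact'.continuousAt.eventually_mem (by simpa using hB)
    obtain ⟨A, B', hA, hA1, hB', hB'z, h1⟩ := mem_nhds_prod_iff'.1 h1
    obtain ⟨δ, hδ, h2⟩ := hρ.away z₀ B' (hB'.mem_nhds hB'z)
    have h3 : ∀ᶠ p : G × M in 𝓝 (1, z₀), ∀ y ∉ B', δ ≤ ρ y (p.1⁻¹ • p.2) :=
      Tendsto.eventually (p := fun z => ∀ y ∉ B', δ ≤ ρ y z) hact.continuousAt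
        (by simpa using h2)
    obtain ⟨A', W, hA', hA'1, hW, hWz, h3⟩ := mem_nhds_prod_iff'.1 h3
    refine ⟨δ * μ.real (A ∩ A'), mul_pos hδ (hpos (hA.inter hA') ⟨hA1, hA'1⟩), ?_⟩
    filter_upwards [hW.mem_nhds hWz] with z hz y hy
    refine integral_ge_of_le_on_open (d := d) μ (hcont y z) (fun g => hρ.nonneg _ _)
      (hA.inter hA') fun g hg => ?_
    have h4 : (g, z) ∈ A' ×ˢ W := ⟨hg.2, hz⟩
    -- If `g⁻¹ • y` were in `B'`, then `y = g • g⁻¹ • y` would lie in `B`.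
    refine h3 h4 _ fun hmem => hy ?_
    have h5 : (g, g⁻¹ • y) ∈ A ×ˢ B' := ⟨hg.1, hmem⟩
    simpa using h1 h5
  · intro z₀
    set φ := extChartAt (𝓡 m) z₀
    obtain ⟨c, hc, h1⟩ := hρ.quadratic z₀
    have h2 : ContMDiffAt ((𝓡 d).prod (𝓡 m)) (𝓡 m) ∞
        (fun p : G × EuclideanSpace ℝ (Fin m) => φ (p.1 • φ.symm p.2)) (1, φ z₀) := by
      refine ContMDiffAt.comp_of_eq (y := z₀) contMDiffAt_extChartAt ?_ (by simp [φ])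
      refine contMDiffAt_fst.smul ?_
      exact ((contMDiffOn_extChartAt_symm z₀).contMDiffAt ((isOpen_extChartAt_target z₀).mem_nhds
        (mem_extChartAt_target z₀))).comp (x := (1, φ z₀)) (f := Prod.snd) contMDiffAt_snd
    obtain ⟨K, hK0, hK⟩ := h2.exists_eventually_norm_sub_le
    have hφ : ContinuousAt φ z₀ := continuousAt_extChartAt z₀
    have c1 : ContinuousAt (fun q : G × M × M => q.1⁻¹ • q.2.1) (1, z₀, z₀) :=
      (hact.comp (f := fun q : G × M × M => (q.1, q.2.1)) (by fun_prop)).continuousAt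
    have c2 : ContinuousAt (fun q : G × M × M => q.1⁻¹ • q.2.2) (1, z₀, z₀) :=
      (hact.comp (f := fun q : G × M × M => (q.1, q.2.2)) (by fun_prop)).continuousAt
    have e1 : ∀ᶠ q : G × M × M in 𝓝 (1, z₀, z₀),
        ‖φ (q.1 • φ.symm (φ (q.1⁻¹ • q.2.1))) - φ (q.1 • φ.symm (φ (q.1⁻¹ • q.2.2)))‖ ≤
          K * ‖φ (q.1⁻¹ • q.2.1) - φ (q.1⁻¹ • q.2.2)‖ := by
      have hc3 : ContinuousAt (fun q : G × M × M => (q.1, φ (q.1⁻¹ • q.2.1), φ (q.1⁻¹ • q.2.2)))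
          (1, z₀, z₀) :=
        continuousAt_fst.prodMk ((hφ.comp_of_eq c1 (by simp)).prodMk (hφ.comp_of_eq c2 (by simp)))
      exact hc3.eventually (by simpa using hK)
    have e2 : ∀ᶠ q : G × M × M in 𝓝 (1, z₀, z₀), c * ‖φ (q.1⁻¹ • q.2.1) - φ (q.1⁻¹ • q.2.2)‖ ^ 2 ≤
        ρ (q.1⁻¹ • q.2.1) (q.1⁻¹ • q.2.2) :=
      (c1.prodMk c2).eventually (by simpa using h1)
    have hs : φ.source ∈ 𝓝 z₀ := extChartAt_source_mem_nhds z₀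
    have e3 : ∀ᶠ q : G × M × M in 𝓝 (1, z₀, z₀), q.1⁻¹ • q.2.1 ∈ φ.source :=
      c1.eventually_mem (by simpa using hs)
    have e4 : ∀ᶠ q : G × M × M in 𝓝 (1, z₀, z₀), q.1⁻¹ • q.2.2 ∈ φ.source :=
      c2.eventually_mem (by simpa using hs)
    have e5 : ∀ᶠ q : G × M × M in 𝓝 (1, z₀, z₀), c * (K ^ 2 + 1)⁻¹ * ‖φ q.2.1 - φ q.2.2‖ ^ 2 ≤
        ρ (q.1⁻¹ • q.2.1) (q.1⁻¹ • q.2.2) := by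
      filter_upwards [e1, e2, e3, e4] with q h1 h2 h3 h4
      rw [φ.left_inv h3, φ.left_inv h4, smul_inv_smul, smul_inv_smul] at h1
      refine le_trans ?_ h2
      rw [mul_assoc]
      refine mul_le_mul_of_nonneg_left ?_ hc.le
      rw [inv_mul_le_iff₀ (by positivity)]
      have := pow_le_pow_left₀ (norm_nonneg _) h1 2
      nlinarith [sq_nonneg ‖φ (q.1⁻¹ • q.2.1) - φ (q.1⁻¹ • q.2.2)‖]
    obtain ⟨A, W, hA, hA1, hW, hWz, h3⟩ := mem_nhds_prod_iff'.1 e5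
    refine ⟨c * (K ^ 2 + 1)⁻¹ * μ.real A, mul_pos (by positivity) (hpos hA hA1), ?_⟩
    filter_upwards [hW.mem_nhds hWz] with p hp
    have h4 (g : G) (hg : g ∈ A) :
        c * (K ^ 2 + 1)⁻¹ * ‖φ p.1 - φ p.2‖ ^ 2 ≤ ρ (g⁻¹ • p.1) (g⁻¹ • p.2) := by
      have h5 : (g, p) ∈ A ×ˢ W := ⟨hg, hp⟩
      have h6 := h3 h5
      rwa [mem_ofPred_eq] at h6
    have h7 := integral_ge_of_le_on_open (d := d) μ (hcont p.1 p.2) (fun g => hρ.nonneg _ _) hA h4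
    rw [mul_right_comm]
    exact h7

end Average

/-! ### Second derivatives, growth and convexity -/

section Hessian
variable {E : Type*} [NormedAddCommGroup E] [NormedSpace ℝ E]

theorem HasDerivAt.fderiv_line {F : E → ℝ} {u v : E} {t : ℝ}
    (hF : DifferentiableAt ℝ F (u + t • v)) :
    HasDerivAt (fun t : ℝ => F (u + t • v)) (fderiv ℝ F (u + t • v) v) t := by
  have h2 : HasDerivAt (fun t : ℝ => u + t • v) v t := by
    simpa using ((hasDerivAt_id t).smul_const v).const_add u
  exact hF.hasFDerivAt.comp_hasDerivAt t h2

theorem HasDerivAt.fderiv_fderiv_line {F : E → ℝ} {u v : E} {t : ℝ}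
    (hF : DifferentiableAt ℝ (fderiv ℝ F) (u + t • v)) :
    HasDerivAt (fun t : ℝ => fderiv ℝ F (u + t • v) v)
      (fderiv ℝ (fderiv ℝ F) (u + t • v) v v) t := by
  have h2 : HasDerivAt (fun t : ℝ => u + t • v) v t := by
    simpa using ((hasDerivAt_id t).smul_const v).const_add u
  have h3 := hF.hasFDerivAt.comp_hasDerivAt t h2
  simpa using h3.clm_apply (hasDerivAt_const t v)

open Filter in
/-- Quadratic growth at a point bounds the second derivative from below. -/
theorem le_fderiv_fderiv_of_quadratic_growth {F : E → ℝ} {u : E} (hF : ContDiffAt ℝ ∞ F u)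
    {c : ℝ} (hc : 0 < c) (h : ∀ᶠ w in 𝓝 u, F u + c * ‖w - u‖ ^ 2 ≤ F w) (v : E) :
    c * ‖v‖ ^ 2 ≤ fderiv ℝ (fderiv ℝ F) u v v := by
  by_contra! hlt
  have hv : 0 < ‖v‖ := by
    rcases (norm_nonneg v).eq_or_lt' with h0 | h0
    · simp [norm_eq_zero.1 h0] at hlt
    · exact h0
  have h0 : fderiv ℝ F u = 0 := by
    refine IsLocalMin.fderiv_eq_zero ?_
    filter_upwards [h] with w hw
    nlinarith [sq_nonneg ‖w - u‖]
  have hd : ∀ᶠ w in 𝓝 u, DifferentiableAt ℝ F w := by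
    filter_upwards [(hF.of_le (m := 1) (by exact_mod_cast le_top)).eventually (by simp)] with w hw
    exact hw.differentiableAt (by simp)
  have hd2 : DifferentiableAt ℝ (fderiv ℝ F) u :=
    (hF.fderiv_right (m := ∞) (by simp)).differentiableAt (by simp)
  have hline : Tendsto (fun t : ℝ => u + t • v) (𝓝 0) (𝓝 u) := by
    have : Continuous fun t : ℝ => u + t • v := by fun_prop
    simpa using this.tendsto 0
  -- If the bound fails, `k` has vanishing first and positive second derivative at `0`, hence a
  -- local minimum there. So `F` grows along `v` at most like `c / 2 * ‖v‖ ^ 2 * t ^ 2`, against the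
  -- assumed rate `c`. The sharp bound would be `2 * c`; the slack does no harm.
  set k : ℝ → ℝ := fun t => c / 2 * ‖v‖ ^ 2 * t ^ 2 - F (u + t • v) with hk
  have hk1 : ∀ᶠ t in 𝓝 (0 : ℝ),
      HasDerivAt k (c * ‖v‖ ^ 2 * t - fderiv ℝ F (u + t • v) v) t := by
    filter_upwards [hline.eventually hd] with t ht
    have h1 := ((hasDerivAt_pow 2 t).const_mul (c / 2 * ‖v‖ ^ 2)).sub (HasDerivAt.fderiv_line ht)
    refine h1.congr_deriv ?_
    push_cast; ring
  have hk2 : HasDerivAt (fun t => c * ‖v‖ ^ 2 * t - fderiv ℝ F (u + t • v) v)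
      (c * ‖v‖ ^ 2 - fderiv ℝ (fderiv ℝ F) u v v) 0 := by
    have h1 := ((hasDerivAt_id (0 : ℝ)).const_mul (c * ‖v‖ ^ 2)).sub
      (HasDerivAt.fderiv_fderiv_line (F := F) (u := u) (v := v) (t := 0) (by simpa using hd2))
    exact h1.congr_deriv (by simp)
  have hk3 : deriv k =ᶠ[𝓝 0] fun t => c * ‖v‖ ^ 2 * t - fderiv ℝ F (u + t • v) v :=
    hk1.mono fun t ht => ht.deriv
  have hmin : IsLocalMin k 0 := by
    refine isLocalMin_of_deriv_deriv_pos ?_ ?_ hk1.self_of_nhds.continuousAt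
    · rw [hk3.deriv_eq, hk2.deriv]; linarith
    · rw [hk3.self_of_nhds]; simp [h0]
  have hcontra : ∀ᶠ t in 𝓝 (0 : ℝ), t = 0 := by
    filter_upwards [hmin, hline.eventually h] with t h1 h2
    simp only [hk, zero_smul, add_zero, add_sub_cancel_left, norm_smul, mul_pow, Real.norm_eq_abs,
      sq_abs] at h1 h2
    by_contra hne
    have h3 : 0 < c * ‖v‖ ^ 2 * t ^ 2 := by positivity
    nlinarith
  obtain ⟨ε, hε, h4⟩ := Metric.eventually_nhds_iff.1 hcontra
  have := h4 (y := ε / 2) (by rw [Real.dist_eq, sub_zero, abs_of_pos] <;> linarith)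
  linarith

/-- The function `t ↦ F (u + t v) - c / 2 * ‖v‖² t²` is convex on `[0, 1]`. Comparing its value at
`1 / 2` with those at the ends leaves the gain `c / 4 - c / 8 = c / 8`. -/
theorem midpoint_le_of_le_fderiv_fderiv {F : E → ℝ} {s : Set E} (hs : IsOpen s)
    (hconv : Convex ℝ s) (hF : ContDiffOn ℝ ∞ F s) {c : ℝ}
    (h : ∀ u ∈ s, ∀ v, c * ‖v‖ ^ 2 ≤ fderiv ℝ (fderiv ℝ F) u v v) {u u' : E} (hu : u ∈ s)
    (hu' : u' ∈ s) :
    F (midpoint ℝ u u') + c / 8 * ‖u' - u‖ ^ 2 ≤ (F u + F u') / 2 := by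
  set v := u' - u
  have hmem (t : ℝ) (ht : t ∈ Icc (0 : ℝ) 1) : u + t • v ∈ s :=
    hconv.add_smul_sub_mem hu hu' ht
  have hd (t : ℝ) (ht : t ∈ Icc (0 : ℝ) 1) : DifferentiableAt ℝ F (u + t • v) :=
    ((hF.contDiffAt (hs.mem_nhds (hmem t ht))).differentiableAt (by simp))
  have hd2 (t : ℝ) (ht : t ∈ Icc (0 : ℝ) 1) : DifferentiableAt ℝ (fderiv ℝ F) (u + t • v) :=
    (((hF.contDiffAt (hs.mem_nhds (hmem t ht))).fderiv_right (m := ∞)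
      (by simp)).differentiableAt (by simp))
  set k : ℝ → ℝ := fun t => F (u + t • v) - c / 2 * ‖v‖ ^ 2 * t ^ 2
  have hk1 (t : ℝ) (ht : t ∈ Icc (0 : ℝ) 1) :
      HasDerivAt k (fderiv ℝ F (u + t • v) v - c * ‖v‖ ^ 2 * t) t := by
    refine ((HasDerivAt.fderiv_line (hd t ht)).sub
      ((hasDerivAt_pow 2 t).const_mul (c / 2 * ‖v‖ ^ 2))).congr_deriv ?_
    push_cast; ring
  have hk2 (t : ℝ) (ht : t ∈ Icc (0 : ℝ) 1) :
      HasDerivAt (fun t => fderiv ℝ F (u + t • v) v - c * ‖v‖ ^ 2 * t)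
        (fderiv ℝ (fderiv ℝ F) (u + t • v) v v - c * ‖v‖ ^ 2) t := by
    exact ((HasDerivAt.fderiv_fderiv_line (hd2 t ht)).sub
      ((hasDerivAt_id t).const_mul (c * ‖v‖ ^ 2))).congr_deriv (by simp)
  have hk3 (t : ℝ) (ht : t ∈ Ioo (0 : ℝ) 1) :
      deriv k =ᶠ[𝓝 t] fun t => fderiv ℝ F (u + t • v) v - c * ‖v‖ ^ 2 * t := by
    filter_upwards [isOpen_Ioo.mem_nhds ht] with t' ht'
    exact (hk1 t' (Ioo_subset_Icc_self ht')).deriv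
  have hcv : ConvexOn ℝ (Icc 0 1) k := by
    refine convexOn_of_deriv2_nonneg (convex_Icc 0 1)
      (fun t ht => (hk1 t ht).continuousAt.continuousWithinAt) ?_ ?_ ?_ <;> rw [interior_Icc]
    · exact fun t ht =>
        (hk1 t (Ioo_subset_Icc_self ht)).differentiableAt.differentiableWithinAt
    · exact fun t ht => ((hk3 t ht).differentiableAt_iff.2
        (hk2 t (Ioo_subset_Icc_self ht)).differentiableAt).differentiableWithinAt
    · intro t ht
      rw [Function.iterate_succ, Function.iterate_one, Function.comp_apply, (hk3 t ht).deriv_eq,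
        (hk2 t (Ioo_subset_Icc_self ht)).deriv]
      linarith [h _ (hmem t (Ioo_subset_Icc_self ht)) v]
  have := hcv.2 (left_mem_Icc.2 zero_le_one) (right_mem_Icc.2 zero_le_one)
    (by norm_num : (0 : ℝ) ≤ 1 / 2) (by norm_num : (0 : ℝ) ≤ 1 / 2) (by norm_num)
  have hm : midpoint ℝ u u' = u + (1 / 2 : ℝ) • v := by
    rw [midpoint_eq_smul_add]
    simp only [v, smul_sub, smul_add]
    have : u = (1 / 2 : ℝ) • u + (1 / 2 : ℝ) • u := by rw [← add_smul]; norm_num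
    rw [invOf_eq_inv, ← one_div]
    nth_rw 2 [this]
    abel
  simp only [k, smul_eq_mul, mul_zero, mul_one, zero_add, zero_smul, add_zero, one_smul, v,
    add_sub_cancel] at this
  rw [hm]
  simp only [v]
  linarith

end Hessian

/-! ### Uniform convexity near a point -/

section Good

variable {m : ℕ} {M : Type*} [TopologicalSpace M] [ChartedSpace (EuclideanSpace ℝ (Fin m)) M]

/-- The preimage of a ball in the preferred chart at a point. -/
def chartBall (m : ℕ) {M : Type*} [TopologicalSpace M] [ChartedSpace (EuclideanSpace ℝ (Fin m)) M]
    (z₀ : M) (r : ℝ) : Set M :=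
  (extChartAt (𝓡 m) z₀).source ∩ extChartAt (𝓡 m) z₀ ⁻¹' Metric.ball (extChartAt (𝓡 m) z₀ z₀) r

theorem isOpen_chartBall (z₀ : M) (r : ℝ) : IsOpen (chartBall m z₀ r) :=
  (continuousOn_extChartAt z₀).isOpen_inter_preimage (isOpen_extChartAt_source z₀) Metric.isOpen_ball

/-- The functions `ρ · w`, `w ∈ W`, are uniformly strongly convex on the chart ball of radius `r`
around `z₀`, and are uniformly larger off this ball than at its centre. -/
structure IsGood (ρ : M → M → ℝ) (z₀ : M) (r : ℝ) (W : Set M) : Prop where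
  pos : 0 < r
  closedBall_subset : Metric.closedBall (extChartAt (𝓡 m) z₀ z₀) r ⊆ (extChartAt (𝓡 m) z₀).target
  convex : ∃ c > 0, ∀ w ∈ W, ∀ u ∈ Metric.ball (extChartAt (𝓡 m) z₀ z₀) r,
    ∀ u' ∈ Metric.ball (extChartAt (𝓡 m) z₀ z₀) r,
    ρ ((extChartAt (𝓡 m) z₀).symm (midpoint ℝ u u')) w + c * ‖u' - u‖ ^ 2 ≤
      (ρ ((extChartAt (𝓡 m) z₀).symm u) w + ρ ((extChartAt (𝓡 m) z₀).symm u') w) / 2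
  away : ∃ δ > 0, ∀ w ∈ W, ∀ y ∉ chartBall m z₀ r, ρ z₀ w + δ ≤ ρ y w

-- Quadratic growth bounds the Hessian of `ρ · z₀` at the centre of the chart from below by `c`. The
-- Hessian is jointly continuous in both variables, so it stays above `c / 2` on a product
-- neighbourhood, and there strong midpoint convexity follows. Off the ball `ρ · w` is at least some
-- `δ`, while `ρ z₀ w` is below `δ / 2` for `w` near `z₀`.
open Filter in
theorem IsSeparating.exists_isGood [IsManifold (𝓡 m) ∞ M] {ρ : M → M → ℝ}
    (hρ : IsSeparating m ρ) (z₀ : M) {O : Set M} (hO : O ∈ 𝓝 z₀) :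
    ∃ r W, IsOpen W ∧ z₀ ∈ W ∧ chartBall m z₀ r ⊆ O ∧ IsGood (m := m) ρ z₀ r W := by
  set φ := extChartAt (𝓡 m) z₀ with hφ
  set u₀ := φ z₀ with hu₀
  have hH (z : M) (u : EuclideanSpace ℝ (Fin m)) (hu : u ∈ φ.target) :
      ContMDiffAt ((𝓡 m).prod (𝓡 m)) 𝓘(ℝ, ℝ) ∞
      (Function.uncurry fun (z : M) u => ρ (φ.symm u) z) (z, u) := by
    refine ContMDiffAt.comp (x := (z, u)) (g := Function.uncurry ρ)
      (f := fun p : M × EuclideanSpace ℝ (Fin m) => (φ.symm p.2, p.1)) hρ.smooth.contMDiffAt ?_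
    exact ((contMDiffOn_extChartAt_symm z₀).contMDiffAt ((isOpen_extChartAt_target z₀).mem_nhds
        hu)).comp (x := (z, u)) (f := Prod.snd) contMDiffAt_snd |>.prodMk contMDiffAt_fst
  have hHz (z : M) : ContDiffOn ℝ ∞ (fun u => ρ (φ.symm u) z) φ.target := fun u hu =>
    (((hH z u hu).comp (x := u) (f := fun u => (z, u))
      (contMDiffAt_const.prodMk contMDiffAt_id)).contDiffAt).contDiffWithinAt
  have hu₀t : u₀ ∈ φ.target := mem_extChartAt_target z₀
  have ht : φ.target ∈ 𝓝 u₀ := (isOpen_extChartAt_target z₀).mem_nhds hu₀t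
  have hA := ((hH z₀ u₀ hu₀t).fderiv_partial).fderiv_partial
    (f := fun z u => fderiv ℝ (fun u => ρ (φ.symm u) z) u)
  obtain ⟨c, hc, hq⟩ := hρ.quadratic z₀
  have hsymm : ContinuousAt φ.symm u₀ := continuousAt_extChartAt_symm z₀
  have hq' : ∀ᶠ u in 𝓝 u₀, ρ (φ.symm u₀) z₀ + c * ‖u - u₀‖ ^ 2 ≤ ρ (φ.symm u) z₀ := by
    have h1 : Tendsto (fun u => (φ.symm u, z₀)) (𝓝 u₀) (𝓝 (z₀, z₀)) := by
      have := hsymm.prodMk (continuousAt_const (y := z₀))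
      rwa [ContinuousAt, show φ.symm u₀ = z₀ from extChartAt_to_inv z₀] at this
    filter_upwards [h1.eventually hq, ht] with u hu hu'
    rw [φ.right_inv hu'] at hu
    rw [show φ.symm u₀ = z₀ from extChartAt_to_inv z₀, hρ.self_eq_zero, zero_add]
    exact hu
  have hA0 := le_fderiv_fderiv_of_quadratic_growth ((hHz z₀).contDiffAt ht) hc hq'
  have hA1 : ∀ᶠ p : M × EuclideanSpace ℝ (Fin m) in 𝓝 (z₀, u₀), ∀ v,
      c / 2 * ‖v‖ ^ 2 ≤ fderiv ℝ (fderiv ℝ fun u => ρ (φ.symm u) p.1) p.2 v v := by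
    filter_upwards [hA.continuousAt.eventually_mem (Metric.ball_mem_nhds _ (half_pos hc))]
      with p hp v
    rw [Metric.mem_ball, dist_eq_norm] at hp
    set A := fderiv ℝ (fderiv ℝ fun u => ρ (φ.symm u) z₀) u₀
    set A' := fderiv ℝ (fderiv ℝ fun u => ρ (φ.symm u) p.1) p.2
    have h1 : ‖(A' - A) v v‖ ≤ c / 2 * ‖v‖ * ‖v‖ :=
      ((A' - A).le_opNorm₂ v v).trans (by gcongr)
    have h2 := hA0 v
    rw [Real.norm_eq_abs, abs_le] at h1
    have h3 : (A' - A) v v = A' v v - A v v := rfl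
    rw [h3] at h1
    nlinarith [h1.1]
  obtain ⟨W₁, S, hW₁, hW₁z, hS, hSu, hWS⟩ := mem_nhds_prod_iff'.1 hA1
  have hS' : S ∩ φ.target ∩ φ.symm ⁻¹' O ∈ 𝓝 u₀ :=
    inter_mem (inter_mem (hS.mem_nhds hSu) ht)
      (hsymm.preimage_mem_nhds (by rwa [show φ.symm u₀ = z₀ from extChartAt_to_inv z₀]))
  obtain ⟨r, hr, hrS⟩ := Metric.nhds_basis_closedBall.mem_iff.1 hS'
  have hB : chartBall m z₀ r ∈ 𝓝 z₀ :=
    (isOpen_chartBall z₀ r).mem_nhds ⟨mem_extChartAt_source z₀, Metric.mem_ball_self hr⟩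
  obtain ⟨δ, hδ, h1⟩ := hρ.away z₀ _ hB
  have h2 : ∀ᶠ z in 𝓝 z₀, ρ z₀ z < δ / 2 := by
    have : Continuous fun z => ρ z₀ z := hρ.smooth.continuous.comp (Continuous.prodMk_right z₀)
    exact this.continuousAt.eventually_lt_const (by simpa [hρ.self_eq_zero] using hδ)
  obtain ⟨W₂, hW₂s, hW₂, hW₂z⟩ := eventually_nhds_iff.1 (h1.and h2)
  refine ⟨r, W₁ ∩ W₂, hW₁.inter hW₂, ⟨hW₁z, hW₂z⟩, ?_, hr, fun u hu => (hrS hu).1.2, ?_, ?_⟩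
  · rintro y ⟨hy1, hy2⟩
    have := (hrS (Metric.ball_subset_closedBall hy2)).2
    rwa [mem_preimage, φ.left_inv hy1] at this
  -- Here `c / 2` is the Hessian bound and `1 / 8` comes from the midpoint inequality.
  · refine ⟨c / 2 / 8, by positivity, fun w hw u hu u' hu' => ?_⟩
    refine midpoint_le_of_le_fderiv_fderiv (F := fun u => ρ (φ.symm u) w)
      (s := Metric.ball u₀ r) Metric.isOpen_ball (convex_ball _ _)
      ((hHz w).mono fun u hu => (hrS (Metric.ball_subset_closedBall hu)).1.2) ?_ hu hu'
    intro u hu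
    have h3 : (w, u) ∈ W₁ ×ˢ S := ⟨hw.1, (hrS (Metric.ball_subset_closedBall hu)).1.1⟩
    have h4 := hWS h3
    rwa [mem_ofPred_eq] at h4
  · refine ⟨δ / 2, by positivity, fun w hw y hy => ?_⟩
    obtain ⟨h3, h4⟩ := hW₂s w hw.2
    linarith [h3 y hy]

end Good

/-- The function `h` satisfies all linear inequalities between three values that hold for the
functions `ρ · w`, `w ∈ W`. -/
def IsAverageOf {M : Type*} (ρ : M → M → ℝ) (W : Set M) (h : M → ℝ) : Prop :=
  ∀ (a₁ a₂ a₃ η : ℝ) (y₁ y₂ y₃ : M),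
    (∀ w ∈ W, η ≤ a₁ * ρ y₁ w + a₂ * ρ y₂ w + a₃ * ρ y₃ w) →
      η ≤ a₁ * h y₁ + a₂ * h y₂ + a₃ * h y₃

theorem IsAverageOf.of_mem {M : Type*} {ρ : M → M → ℝ} {W : Set M} {w : M} (hw : w ∈ W) :
    IsAverageOf ρ W fun y => ρ y w :=
  fun _ _ _ _ _ _ _ h => h w hw

theorem IsAverageOf.convex_comb {M : Type*} {ρ : M → M → ℝ} {W : Set M} {h k : M → ℝ}
    (hh : IsAverageOf ρ W h) (hk : IsAverageOf ρ W k) {t : ℝ} (ht : t ∈ Icc (0 : ℝ) 1) :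
    IsAverageOf ρ W fun y => (1 - t) * h y + t * k y := by
  intro a₁ a₂ a₃ η y₁ y₂ y₃ H
  have h1 := mul_le_mul_of_nonneg_left (hh a₁ a₂ a₃ η y₁ y₂ y₃ H) (sub_nonneg.2 ht.2)
  have h2 := mul_le_mul_of_nonneg_left (hk a₁ a₂ a₃ η y₁ y₂ y₃ H) ht.1
  nlinarith

/-- The point `y` is the unique minimum of `h`. -/
def IsStrictArgmin {M : Type*} (h : M → ℝ) (y : M) : Prop :=
  ∀ y', y' ≠ y → h y < h y'

theorem IsStrictArgmin.eq {M : Type*} {h : M → ℝ} {y y' : M} (hy : IsStrictArgmin h y)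
    (hy' : IsStrictArgmin h y') : y = y' := by
  by_contra hne
  exact lt_asymm (hy y' (Ne.symm hne)) (hy' y hne)

theorem IsStrictArgmin.le {M : Type*} {h : M → ℝ} {y : M} (hy : IsStrictArgmin h y) (y' : M) :
    h y ≤ h y' := by
  rcases eq_or_ne y' y with rfl | hne
  exacts [le_rfl, (hy y' hne).le]

/-! ### Existence, continuity and smoothness of minima -/

section Argmin

variable {m : ℕ} {M : Type*} [TopologicalSpace M] [ChartedSpace (EuclideanSpace ℝ (Fin m)) M]

theorem chartBall_subset_image {z₀ : M} {r : ℝ} :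
    chartBall m z₀ r ⊆
      (extChartAt (𝓡 m) z₀).symm '' Metric.closedBall (extChartAt (𝓡 m) z₀ z₀) r := by
  rintro y ⟨hy1, hy2⟩
  exact ⟨_, Metric.ball_subset_closedBall hy2, (extChartAt (𝓡 m) z₀).left_inv hy1⟩

namespace IsGood
variable {ρ : M → M → ℝ} {z₀ : M} {r : ℝ} {W : Set M} (hW : IsGood (m := m) ρ z₀ r W)
include hW

theorem isCompact_image :
    IsCompact ((extChartAt (𝓡 m) z₀).symm '' Metric.closedBall (extChartAt (𝓡 m) z₀ z₀) r) :=
  (isCompact_closedBall _ _).image_of_continuousOn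
    ((continuousOn_extChartAt_symm z₀).mono hW.closedBall_subset)

theorem lt_of_notMem {h : M → ℝ} (hh : IsAverageOf ρ W h) {y : M} (hy : y ∉ chartBall m z₀ r) :
    h z₀ < h y := by
  obtain ⟨δ, hδ, H⟩ := hW.away
  -- Only two values are compared; the third point is a dummy with weight `0`.
  have := hh 1 (-1) 0 δ y z₀ z₀ fun w hw => by linarith [H w hw y hy]
  linarith

/-- The midpoint inequality is linear with weights `1 / 2`, `1 / 2`, `-1`; it is the reason why
`IsAverageOf` allows three values. -/
theorem midpoint_le {h : M → ℝ} (hh : IsAverageOf ρ W h) :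
    ∃ c > 0, ∀ u ∈ Metric.ball (extChartAt (𝓡 m) z₀ z₀) r,
      ∀ u' ∈ Metric.ball (extChartAt (𝓡 m) z₀ z₀) r,
      h ((extChartAt (𝓡 m) z₀).symm (midpoint ℝ u u')) + c * ‖u' - u‖ ^ 2 ≤
        (h ((extChartAt (𝓡 m) z₀).symm u) + h ((extChartAt (𝓡 m) z₀).symm u')) / 2 := by
  obtain ⟨c, hc, H⟩ := hW.convex
  refine ⟨c, hc, fun u hu u' hu' => ?_⟩
  have := hh (1 / 2) (1 / 2) (-1) (c * ‖u' - u‖ ^ 2) ((extChartAt (𝓡 m) z₀).symm u)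
    ((extChartAt (𝓡 m) z₀).symm u') ((extChartAt (𝓡 m) z₀).symm (midpoint ℝ u u'))
    fun w hw => by linarith [H w hw u hu u' hu']
  linarith

theorem mem_chartBall {h : M → ℝ} (hh : IsAverageOf ρ W h) {y : M} (hy : IsStrictArgmin h y) :
    y ∈ chartBall m z₀ r := by
  by_contra hn
  exact absurd (hW.lt_of_notMem hh hn) (not_lt.2 (hy.le z₀))

/-- Apply the midpoint inequality to the coordinates of `y` and `u`. The midpoint value is at least
`h y`, so `h` exceeds `h y` at `u` by at least twice `c ‖·‖²`. -/
theorem quadratic_growth {h : M → ℝ} (hh : IsAverageOf ρ W h) {y : M} (hyB : y ∈ chartBall m z₀ r)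
    (hy : ∀ y', h y ≤ h y') :
    ∃ c > 0, ∀ u ∈ Metric.ball (extChartAt (𝓡 m) z₀ z₀) r,
      h y + c * ‖u - extChartAt (𝓡 m) z₀ y‖ ^ 2 ≤ h ((extChartAt (𝓡 m) z₀).symm u) := by
  obtain ⟨c, hc, H⟩ := hW.midpoint_le hh
  refine ⟨c, hc, fun u hu => ?_⟩
  have h1 := H _ hyB.2 u hu
  rw [(extChartAt (𝓡 m) z₀).left_inv hyB.1] at h1
  have h2 := hy ((extChartAt (𝓡 m) z₀).symm (midpoint ℝ (extChartAt (𝓡 m) z₀ y) u))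
  nlinarith [mul_nonneg hc.le (sq_nonneg ‖u - extChartAt (𝓡 m) z₀ y‖)]

/-- A minimum over the compact image of the closed ball is global, since off the open chart ball the
values exceed `h z₀`. Quadratic growth makes it strict inside the ball. -/
theorem exists_isStrictArgmin {h : M → ℝ} (hc : Continuous h) (hh : IsAverageOf ρ W h) :
    ∃ y, IsStrictArgmin h y := by
  set φ := extChartAt (𝓡 m) z₀
  have hz₀ : z₀ ∈ chartBall m z₀ r := ⟨mem_extChartAt_source z₀, Metric.mem_ball_self hW.pos⟩
  obtain ⟨y, hyK, hy⟩ := hW.isCompact_image.exists_isMinOn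
    ⟨z₀, chartBall_subset_image hz₀⟩ hc.continuousOn
  have hy' (y' : M) : h y ≤ h y' := by
    by_cases hy' : y' ∈ chartBall m z₀ r
    · exact hy (chartBall_subset_image hy')
    · exact (hy (chartBall_subset_image hz₀)).trans (hW.lt_of_notMem hh hy').le
  have hyB : y ∈ chartBall m z₀ r := by
    by_contra hn
    exact absurd (hW.lt_of_notMem hh hn) (not_lt.2 (hy' z₀))
  obtain ⟨c, hc, hq⟩ := hW.quadratic_growth hh hyB hy'
  refine ⟨y, fun y' hne => ?_⟩
  by_cases hB : y' ∈ chartBall m z₀ r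
  · have h1 := hq _ hB.2
    rw [φ.left_inv hB.1] at h1
    have h2 : 0 < ‖φ y' - φ y‖ := norm_pos_iff.2 (sub_ne_zero.2
      fun he => hne (φ.injOn hB.1 hyB.1 he))
    nlinarith [mul_pos hc (pow_pos h2 2)]
  · exact (hy' z₀).trans_lt (hW.lt_of_notMem hh hB)

end IsGood

open Filter in
/-- Strict minima of a locally good continuous family depend continuously on the parameter. -/
theorem continuous_of_isStrictArgmin [T2Space M] {X : Type*} [TopologicalSpace X] {ρ : M → M → ℝ}
    {H : X → M → ℝ} (hH : Continuous (Function.uncurry H)) {F : X → M}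
    (hF : ∀ x, IsStrictArgmin (H x) (F x))
    (hgood : ∀ x₀, ∃ z₀ r W, IsGood (m := m) ρ z₀ r W ∧ ∀ᶠ x in 𝓝 x₀, IsAverageOf ρ W (H x)) :
    Continuous F := by
  rw [continuous_iff_continuousAt]
  intro x₀
  obtain ⟨z₀, r, W, hW, hav⟩ := hgood x₀
  rw [ContinuousAt, tendsto_def]
  intro O hO
  obtain ⟨O', hO'O, hO', hxO'⟩ := mem_nhds_iff.1 hO
  set K := (extChartAt (𝓡 m) z₀).symm '' Metric.closedBall (extChartAt (𝓡 m) z₀ z₀) r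
  have hK : IsCompact (K \ O') := hW.isCompact_image.diff hO'
  -- On the compact set `K \ O'` the strict inequality persists for `x` near `x₀`. As `F x` stays in
  -- `K`, it must then lie in `O'`.
  have h1 : ∀ᶠ x in 𝓝 x₀, ∀ y ∈ K \ O', H x (F x₀) < H x y := by
    refine hK.eventually_forall_of_forall_eventually fun y hy => ?_
    have hne : y ≠ F x₀ := fun he => hy.2 (he ▸ hxO')
    have c1 : Continuous fun p : X × M => H p.1 (F x₀) :=
      hH.comp (continuous_fst.prodMk continuous_const)
    exact c1.continuousAt.eventually_lt hH.continuousAt (hF x₀ y hne)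
  filter_upwards [h1, hav] with x hx hx'
  refine hO'O ?_
  by_contra hn
  exact absurd (hx _ ⟨chartBall_subset_image (hW.mem_chartBall hx' (hF x)), hn⟩)
    (not_lt.2 ((hF x).le _))

/-- Positivity gives injectivity, and `E` and its dual have the same dimension. -/
theorem ContinuousLinearMap.isInvertible_of_pos {E : Type*} [NormedAddCommGroup E]
    [NormedSpace ℝ E] [FiniteDimensional ℝ E] {A : E →L[ℝ] E →L[ℝ] ℝ}
    (hA : ∀ v, v ≠ 0 → 0 < A v v) : A.IsInvertible := by
  have hinj : Function.Injective A.toLinearMap := by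
    rw [← LinearMap.ker_eq_bot, LinearMap.ker_eq_bot']
    intro v hv
    by_contra hne
    have h1 := hA v hne
    have h2 : A v = 0 := hv
    simp [h2] at h1
  have hdim : Module.finrank ℝ E = Module.finrank ℝ (E →L[ℝ] ℝ) := by
    rw [← (LinearMap.toContinuousLinearMap (𝕜 := ℝ) (E := E) (F' := ℝ)).finrank_eq]
    exact (Subspace.dual_finrank_eq (K := ℝ) (V := E)).symm
  refine ⟨(LinearEquiv.ofInjectiveOfFinrankEq A.toLinearMap hinj hdim).toContinuousLinearEquiv, ?_⟩
  ext v w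
  rfl

open Filter in
/-- Strict minima of a locally good smooth family depend smoothly on the parameter. -/
theorem contMDiff_of_isStrictArgmin [IsManifold (𝓡 m) ∞ M] {EX HX : Type*} [NormedAddCommGroup EX]
    [NormedSpace ℝ EX] [CompleteSpace EX] [TopologicalSpace HX] {IX : ModelWithCorners ℝ EX HX}
    [IX.Boundaryless] {X : Type*} [TopologicalSpace X] [ChartedSpace HX X] [IsManifold IX ∞ X]
    {ρ : M → M → ℝ} {H : X → M → ℝ}
    (hH : ContMDiff (IX.prod (𝓡 m)) 𝓘(ℝ, ℝ) ∞ (Function.uncurry H)) {F : X → M}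
    (hFc : Continuous F) (hF : ∀ x, IsStrictArgmin (H x) (F x))
    (hgood : ∀ x, ∃ z₀ r W, IsGood (m := m) ρ z₀ r W ∧ IsAverageOf ρ W (H x)) :
    ContMDiff IX (𝓡 m) ∞ F := by
  intro x₀
  obtain ⟨z₀, r, W, hW, hav⟩ := hgood x₀
  set φ := extChartAt (𝓡 m) z₀
  set ψ := extChartAt IX x₀
  have hB := hW.mem_chartBall hav (hF x₀)
  set u₀ := φ (F x₀)
  have hu₀ : u₀ ∈ φ.target := φ.map_source hB.1
  have ht : φ.target ∈ 𝓝 u₀ := (isOpen_extChartAt_target z₀).mem_nhds hu₀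
  have hH1 (x : X) (u : EuclideanSpace ℝ (Fin m)) (hu : u ∈ φ.target) :
      ContMDiffAt (IX.prod (𝓡 m)) 𝓘(ℝ, ℝ) ∞
      (Function.uncurry fun (x : X) u => H x (φ.symm u)) (x, u) := by
    refine ContMDiffAt.comp (x := (x, u)) (g := Function.uncurry H)
      (f := fun p : X × EuclideanSpace ℝ (Fin m) => (p.1, φ.symm p.2)) hH.contMDiffAt ?_
    exact contMDiffAt_fst.prodMk (((contMDiffOn_extChartAt_symm z₀).contMDiffAt
      ((isOpen_extChartAt_target z₀).mem_nhds hu)).comp (x := (x, u)) (f := Prod.snd)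
        contMDiffAt_snd)
  have hHx (x : X) (u : EuclideanSpace ℝ (Fin m)) (hu : u ∈ φ.target) :
      ContDiffAt ℝ ∞ (fun u => H x (φ.symm u)) u :=
    ((hH1 x u hu).comp (x := u) (f := fun u => (x, u))
      (contMDiffAt_const.prodMk contMDiffAt_id)).contDiffAt
  have hD := (hH1 x₀ u₀ hu₀).fderiv_partial
  -- The minimum solves the equation `D = 0`; it is to be recovered as the implicit function of `D`.
  set D : EX × EuclideanSpace ℝ (Fin m) → (EuclideanSpace ℝ (Fin m) →L[ℝ] ℝ) :=
    fun q => fderiv ℝ (fun u => H (ψ.symm q.1) (φ.symm u)) q.2 with hDdef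
  have hD1 : ContDiffAt ℝ ∞ D (ψ x₀, u₀) := by
    have h1 : ContMDiffAt (𝓘(ℝ, EX).prod (𝓡 m)) 𝓘(ℝ, EuclideanSpace ℝ (Fin m) →L[ℝ] ℝ) ∞
        D (ψ x₀, u₀) := by
      refine ContMDiffAt.comp_of_eq (y := (x₀, u₀))
        (f := fun q : EX × EuclideanSpace ℝ (Fin m) => (ψ.symm q.1, q.2)) hD ?_ (by simp [ψ])
      refine ContMDiffAt.prodMk ?_ contMDiffAt_snd
      exact ((contMDiffOn_extChartAt_symm x₀).contMDiffAt ((isOpen_extChartAt_target x₀).mem_nhds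
        (mem_extChartAt_target x₀))).comp (x := (ψ x₀, u₀)) (f := Prod.fst) contMDiffAt_fst
    rwa [← modelWithCornersSelf_prod, chartedSpaceSelf_prod, contMDiffAt_iff_contDiffAt] at h1
  have hψ : ψ.symm (ψ x₀) = x₀ := extChartAt_to_inv x₀
  have hpart : fderiv ℝ D (ψ x₀, u₀) ∘L .inr ℝ EX (EuclideanSpace ℝ (Fin m)) =
      fderiv ℝ (fderiv ℝ fun u => H x₀ (φ.symm u)) u₀ := by
    have h1 : HasFDerivAt (fun u : EuclideanSpace ℝ (Fin m) => (ψ x₀, u))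
        (.inr ℝ EX (EuclideanSpace ℝ (Fin m))) u₀ := hasFDerivAt_prodMk_right _ _
    have h2 := ((hD1.differentiableAt (by simp)).hasFDerivAt.comp u₀ h1).fderiv
    rw [← h2]
    congr 1
    ext1 u
    simp [hDdef, hψ]
  obtain ⟨c, hc, hq⟩ := hW.quadratic_growth hav hB (hF x₀).le
  -- The partial derivative of `D` in `u` is the Hessian at the minimum, which is positive definite
  -- by quadratic growth.
  have hinv : (fderiv ℝ D (ψ x₀, u₀) ∘L
      .inr ℝ EX (EuclideanSpace ℝ (Fin m))).IsInvertible := by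
    rw [hpart]
    refine ContinuousLinearMap.isInvertible_of_pos fun v hv => ?_
    refine lt_of_lt_of_le (b := c * ‖v‖ ^ 2) (by positivity)
      (le_fderiv_fderiv_of_quadratic_growth (hHx x₀ u₀ hu₀) hc ?_ v)
    filter_upwards [Metric.isOpen_ball.mem_nhds hB.2] with u hu
    rw [φ.left_inv hB.1]
    exact hq u hu
  have hcrit (x : X) (hx : F x ∈ φ.source) :
      fderiv ℝ (fun u => H x (φ.symm u)) (φ (F x)) = 0 := by
    refine IsLocalMin.fderiv_eq_zero (.of_forall fun u => ?_)
    change H x (φ.symm (φ (F x))) ≤ H x (φ.symm u)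
    rw [φ.left_inv hx]
    exact (hF x).le _
  have hn : (∞ : ℕ∞ω) ≠ 0 := by simp
  have hφF : ContinuousAt φ (F x₀) := continuousAt_extChartAt' hB.1
  have h1 : ∀ᶠ x in 𝓝 x₀, F x ∈ φ.source :=
    hFc.continuousAt.eventually_mem (extChartAt_source_mem_nhds' hB.1)
  have hcψ : ContinuousAt ψ x₀ := continuousAt_extChartAt x₀
  have h2 : Tendsto (fun x => (ψ x, φ (F x))) (𝓝 x₀) (𝓝 (ψ x₀, u₀)) :=
    hcψ.prodMk (hφF.comp hFc.continuousAt)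
  have h3 := h2.eventually (hD1.eventually_apply_eq_iff_implicitFunction hn hinv)
  have h4 : ContMDiffAt IX (𝓡 m) ∞
      (fun x => φ.symm (hD1.implicitFunction hn hinv (ψ x))) x₀ := by
    have h5 : ContMDiffAt IX 𝓘(ℝ, EuclideanSpace ℝ (Fin m)) ∞
        (fun x => hD1.implicitFunction hn hinv (ψ x)) x₀ :=
      ContMDiffAt.comp x₀ (hD1.contDiffAt_implicitFunction hn hinv).contMDiffAt
        contMDiffAt_extChartAt
    refine ContMDiffAt.comp_of_eq (y := u₀) ((contMDiffOn_extChartAt_symm z₀).contMDiffAt ht) h5 ?_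
    exact hD1.implicitFunction_apply_self hn hinv
  refine h4.congr_of_eventuallyEq ?_
  filter_upwards [h1, h3, extChartAt_source_mem_nhds (I := IX) x₀] with x hx1 hx3 hx4
  -- The implicit function describes the level set of `D` through the base point. Both sides vanish,
  -- because `F x` and `F x₀` are critical points.
  have h6 : D (ψ x, φ (F x)) = D (ψ x₀, u₀) := by
    simp only [hDdef, hψ]
    rw [show ψ.symm (ψ x) = x from ψ.left_inv hx4, hcrit x hx1, hcrit x₀ hB.1]
  rw [hx3.1 h6, φ.left_inv hx1]

end Argmin

theorem IsSeparating.isStrictArgmin {m : ℕ} {M : Type*} [TopologicalSpace M] [T1Space M]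
    [ChartedSpace (EuclideanSpace ℝ (Fin m)) M] {ρ : M → M → ℝ} (hρ : IsSeparating m ρ) (z : M) :
    IsStrictArgmin (fun y => ρ y z) z := by
  intro y hy
  obtain ⟨δ, hδ, h⟩ := hρ.away z {y}ᶜ (isOpen_compl_singleton.mem_nhds hy.symm)
  have := h.self_of_nhds y (by simp)
  simp only [hρ.self_eq_zero]
  linarith

theorem IsAverageOf.finsum {M ι : Type*} {ρ : M → M → ℝ} {W : Set M} {a : ι → ℝ} {w : ι → M}
    (ha : ∀ i, 0 ≤ a i) (hfin : (Function.support a).Finite) (hsum : ∑ᶠ i, a i = 1)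
    (hw : ∀ i, a i ≠ 0 → w i ∈ W) : IsAverageOf ρ W fun y => ∑ᶠ i, a i * ρ y (w i) := by
  intro a₁ a₂ a₃ η y₁ y₂ y₃ H
  have key (y : M) : ∑ᶠ i, a i * ρ y (w i) = ∑ i ∈ hfin.toFinset, a i * ρ y (w i) :=
    finsum_eq_sum_of_support_subset _ fun i hi => by
      simpa using left_ne_zero_of_mul hi
  rw [finsum_eq_sum_of_support_subset _ (s := hfin.toFinset) (by simp)] at hsum
  simp only [key, Finset.mul_sum, ← Finset.sum_add_distrib]
  calc η = ∑ i ∈ hfin.toFinset, a i * η := by rw [← Finset.sum_mul, hsum, one_mul]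
    _ ≤ _ := Finset.sum_le_sum fun i hi => by
      have := mul_le_mul_of_nonneg_left (H (w i) (hw i (by simpa using hi))) (ha i)
      linarith

open MeasureTheory in
theorem IsAverageOf.integral {M G : Type*} [TopologicalSpace G] [CompactSpace G] [MeasurableSpace G]
    [BorelSpace G] [SecondCountableTopology G] (μ : Measure G) [IsProbabilityMeasure μ]
    {ρ : M → M → ℝ} {W : Set M} {h : G → M → ℝ}
    (hc : ∀ y, Continuous fun g => h g y) (hav : ∀ g, IsAverageOf ρ W (h g)) :
    IsAverageOf ρ W fun y => ∫ g, h g y ∂μ := by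
  intro a₁ a₂ a₃ η y₁ y₂ y₃ H
  have hi (y : M) : Integrable (fun g => h g y) μ := (hc y).integrable_of_compactSpace μ
  have h1 := integral_mono (μ := μ) (integrable_const η) ((((hi y₁).const_mul a₁).add
    ((hi y₂).const_mul a₂)).add ((hi y₃).const_mul a₃)) fun g => hav g a₁ a₂ a₃ η y₁ y₂ y₃ H
  simp only [integral_const, probReal_univ, one_smul] at h1
  rw [integral_add' (((hi y₁).const_mul a₁).add ((hi y₂).const_mul a₂)) ((hi y₃).const_mul a₃),
    integral_add' ((hi y₁).const_mul a₁) ((hi y₂).const_mul a₂)] at h1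
  simpa only [integral_const_mul] using h1

/-! ### Equivariant smooth approximation -/

section Smoothing

variable {d m : ℕ} {G : Type*} [Group G] [TopologicalSpace G] [IsTopologicalGroup G]
  [CompactSpace G]
  [ChartedSpace (EuclideanSpace ℝ (Fin d)) G] [LieGroup (𝓡 d) ∞ G]
  {M : Type*} [TopologicalSpace M] [T2Space M]
  [ChartedSpace (EuclideanSpace ℝ (Fin m)) M] [IsManifold (𝓡 m) ∞ M]
  [MulAction G M] [ContMDiffSMul (𝓡 d) (𝓡 m) ∞ G M]
  {EN HN : Type} [NormedAddCommGroup EN] [NormedSpace ℝ EN] [FiniteDimensional ℝ EN]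
  [TopologicalSpace HN] {IN : ModelWithCorners ℝ EN HN} [IN.Boundaryless]
  {N : Type*} [TopologicalSpace N] [T2Space N] [SigmaCompactSpace N] [ChartedSpace HN N]
  [IsManifold IN ∞ N] [MulAction G N] [ContMDiffSMul (𝓡 d) IN ∞ G N]

open Filter in
include d IN in
omit [IsTopologicalGroup G] [LieGroup (𝓡 d) ∞ G] [T2Space M] [IN.Boundaryless] in
/-- The graph of an equivariant map has an invariant neighbourhood that is locally contained in good
sets. -/
theorem IsSeparating.exists_invariant_nhd {ρ : M → M → ℝ} (hρ : IsSeparating m ρ) {f : N → M}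
    (hf : Continuous f) (heq : ∀ (g : G) x, f (g • x) = g • f x) {Ω : Set (N × M)}
    (hΩ : IsOpen Ω) (hfΩ : ∀ x, (x, f x) ∈ Ω) :
    ∃ 𝒲 : Set (N × M), IsOpen 𝒲 ∧ (∀ (g : G) x y, (x, y) ∈ 𝒲 → (g • x, g • y) ∈ 𝒲) ∧
      (∀ x, (x, f x) ∈ 𝒲) ∧ ∀ x₀, ∃ z₀ r W, IsGood (m := m) ρ z₀ r W ∧ ∀ᶠ x in 𝓝 x₀,
        (∀ z, (x, z) ∈ 𝒲 → z ∈ W) ∧ ∀ y ∈ chartBall m z₀ r, (x, y) ∈ Ω := by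
  have hdata (x₁ : N) : ∃ (A : Set N) (r : ℝ) (W : Set M), IsOpen A ∧ x₁ ∈ A ∧ IsOpen W ∧
      (∀ x ∈ A, f x ∈ W) ∧ IsGood (m := m) ρ (f x₁) r W ∧
      ∀ x ∈ A, ∀ y ∈ chartBall m (f x₁) r, (x, y) ∈ Ω := by
    obtain ⟨A, O, hA, hxA, hO, hxO, hAO⟩ := mem_nhds_prod_iff'.1 (hΩ.mem_nhds (hfΩ x₁))
    obtain ⟨r, W, hW, hxW, hrO, hgood⟩ := hρ.exists_isGood (f x₁) (hO.mem_nhds hxO)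
    exact ⟨A ∩ f ⁻¹' W, r, W, hA.inter (hW.preimage hf), ⟨hxA, hxW⟩, hW, fun x hx => hx.2, hgood,
      fun x hx y hy => hAO (show (x, y) ∈ A ×ˢ O from ⟨hx.1, hrO hy⟩)⟩
  choose A r W hA hxA hW hfW hgood hΩA using hdata
  obtain ⟨lam, hlam⟩ := SmoothPartitionOfUnity.exists_isSubordinate IN isClosed_univ A hA
    (fun x _ => mem_iUnion.2 ⟨x, hxA x⟩)
  -- Over `x`, this set consists of the `z` that lie in `W j` for every `j` with `x` in the support
  -- of `lam j`. It is open because the supports are locally finite.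
  set 𝒲₀ : Set (N × M) := ⋂ j, (tsupport (lam j) ×ˢ (W j)ᶜ)ᶜ
  have h𝒲₀ : IsOpen 𝒲₀ := by
    have h1 : LocallyFinite fun j => tsupport (lam j) ×ˢ (W j)ᶜ :=
      (lam.locallyFinite.closure.preimage_continuous (g := (Prod.fst : N × M → N))
        continuous_fst).subset fun j p hp => hp.1
    have h2 := h1.isClosed_iUnion fun j =>
      (isClosed_tsupport (lam j)).prod (hW j).isClosed_compl
    simpa only [compl_iUnion] using h2.isOpen_compl
  have hmem (x : N) (z : M) : (x, z) ∈ 𝒲₀ ↔ ∀ j, x ∈ tsupport (lam j) → z ∈ W j := by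
    simp [𝒲₀, mem_iInter]
  have hN := (contMDiff_smul (G := G) (M := N) (I := 𝓡 d) (I' := IN) (n := ∞)).continuous
  have hM := (contMDiff_smul (G := G) (M := M) (I := 𝓡 d) (I' := 𝓡 m) (n := ∞)).continuous
  -- The intersection of all translates of `𝒲₀`. It stays open because `G` is compact, and it
  -- contains the graph because `f` is equivariant.
  refine ⟨{p | ∀ g ∈ (univ : Set G), (g • p.1, g • p.2) ∈ 𝒲₀}, ?_, ?_, ?_, ?_⟩
  · rw [isOpen_iff_eventually]
    intro p hp
    refine isCompact_univ.eventually_forall_of_forall_eventually fun g _ => ?_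
    have hc : Continuous fun q : (N × M) × G => (q.2 • q.1.1, q.2 • q.1.2) :=
      (hN.comp (f := fun q : (N × M) × G => (q.2, q.1.1)) (by fun_prop)).prodMk
        (hM.comp (f := fun q : (N × M) × G => (q.2, q.1.2)) (by fun_prop))
    exact hc.continuousAt.eventually_mem (h𝒲₀.mem_nhds (hp g trivial))
  · intro g x y h g' _
    have := h (g' * g) trivial
    simpa [mul_smul] using this
  · intro x g _
    rw [← heq, hmem]
    exact fun j hj => hfW j _ (hlam j hj)
  · intro x₀
    obtain ⟨j, hj⟩ := lam.exists_pos_of_mem (mem_univ x₀)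
    refine ⟨f j, r j, W j, hgood j, ?_⟩
    filter_upwards [(lam j).contMDiff.continuous.continuousAt.eventually_const_lt hj] with x hx
    have hxj : x ∈ tsupport (lam j) := subset_tsupport _ hx.ne'
    refine ⟨fun z hz => ?_, hΩA j x (hlam j hxj)⟩
    have := hz 1 trivial
    simp only [one_smul] at this
    exact (hmem x z).1 this j hxj

open Filter MeasureTheory in
include d in
/-- **Equivariant smooth approximation**, relative to a closed invariant set near which the map is
already smooth. -/
theorem exists_equivariant_smooth_approximation [SecondCountableTopology M] {f : N → M}
    (hf : Continuous f) (heq : ∀ (g : G) x, f (g • x) = g • f x) {O C : Set N} (hO : IsOpen O)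
    (hC : IsClosed C) (hCO : C ⊆ O) (hCG : ∀ (g : G), ∀ x ∈ C, g • x ∈ C)
    (hfO : ContMDiffOn IN (𝓡 m) ∞ f O) {Ω : Set (N × M)}
    (hΩ : IsOpen Ω) (hfΩ : ∀ x, (x, f x) ∈ Ω) :
    ∃ f' : N → M, ContMDiff IN (𝓡 m) ∞ f' ∧ (∀ (g : G) x, f' (g • x) = g • f' x) ∧
      (∀ x ∈ C, f' x = f x) ∧ (∀ x, (x, f' x) ∈ Ω) ∧
      ∃ K : unitInterval × N → M, Continuous K ∧ (∀ x, K (0, x) = f x) ∧ (∀ x, K (1, x) = f' x) ∧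
        ∀ t (g : G) x, K (t, g • x) = g • K (t, x) := by
  classical
  have : SecondCountableTopology G :=
    ChartedSpace.secondCountable_of_sigmaCompact (EuclideanSpace ℝ (Fin d)) G
  let _ : MeasurableSpace G := borel G
  have : BorelSpace G := ⟨rfl⟩
  let μ : Measure G := Measure.haarMeasure ⊤
  have : IsProbabilityMeasure μ := ⟨Measure.haarMeasure_self (G := G) (K₀ := ⊤)⟩
  obtain ⟨ρ₀, hρ₀⟩ := exists_isSeparating (m := m) (M := M)
  obtain ⟨ρ, hρ, hρG⟩ : ∃ ρ : M → M → ℝ, IsSeparating m ρ ∧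
      ∀ (g : G) y z, ρ (g • y) (g • z) = ρ y z :=
    ⟨_, hρ₀.orbitAverage (d := d) μ, fun g y z => orbitAverage_smul μ ρ₀ g y z⟩
  obtain ⟨𝒲, h𝒲, h𝒲G, hf𝒲, h𝒲good⟩ := hρ.exists_invariant_nhd (d := d) (IN := IN) hf heq hΩ hfΩ
  -- local smooth maps that are close to `f`
  let s (i : N) : N → M := if i ∈ O then f else fun _ => f i
  -- The constant maps are used only off `C`, so over `C` every local map with nonzero weight is `f`
  -- itself.
  let V (i : N) : Set N := if i ∈ O then O else {x | (x, f i) ∈ 𝒲} ∩ Cᶜ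
  have hV (i : N) : IsOpen (V i) := by
    by_cases hi : i ∈ O
    · simpa [V, hi] using hO
    · simp only [V, hi, if_false]
      exact (h𝒲.preimage (Continuous.prodMk_left (f i))).inter hC.isOpen_compl
  have hiV (i : N) : i ∈ V i := by
    by_cases hi : i ∈ O
    · simp [V, hi]
    · simp only [V, hi, if_false]
      exact ⟨hf𝒲 i, fun h => hi (hCO h)⟩
  have hsV (i x : N) (hx : x ∈ V i) : (x, s i x) ∈ 𝒲 := by
    by_cases hi : i ∈ O
    · simpa [s, hi] using hf𝒲 x
    · simp only [V, hi, if_false] at hx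
      simpa [s, hi] using hx.1
  have hsC (i x : N) (hx : x ∈ V i) (hxC : x ∈ C) : s i x = f x := by
    by_cases hi : i ∈ O
    · simp [s, hi]
    · simp only [V, hi, if_false] at hx
      exact absurd hxC hx.2
  have hssm (i : N) : ContMDiffOn IN (𝓡 m) ∞ (s i) (V i) := by
    by_cases hi : i ∈ O
    · simpa [s, V, hi] using hfO
    · simp only [s, hi, if_false]
      exact contMDiffOn_const
  obtain ⟨lam, hlam⟩ := SmoothPartitionOfUnity.exists_isSubordinate IN isClosed_univ V hV
    (fun x _ => mem_iUnion.2 ⟨x, hiV x⟩)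
  have hlamV {i x : N} (h : lam i x ≠ 0) : x ∈ V i := hlam i (subset_tsupport _ h)
  -- Neither the partition of unity nor the local maps are equivariant, so `Ψ` is not invariant;
  -- averaging repairs this.
  let Ψ : N → M → ℝ := fun x y => ∑ᶠ i, lam i x * ρ y (s i x)
  have hΨ : ContMDiff (IN.prod (𝓡 m)) 𝓘(ℝ, ℝ) ∞ (Function.uncurry Ψ) := by
    refine lam.contMDiff_finsum_mul hV hlam (k := fun i x y => ρ y (s i x)) fun i => ?_
    refine hρ.smooth.comp_contMDiffOn (f := fun p : N × M => (p.2, s i p.1)) ?_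
    exact contMDiffOn_snd.prodMk ((hssm i).comp contMDiffOn_fst fun p hp => hp.1)
  let Φ : N → M → ℝ := orbitAverage μ Ψ
  have hΦ : ContMDiff (IN.prod (𝓡 m)) 𝓘(ℝ, ℝ) ∞ (Function.uncurry Φ) :=
    orbitAverage_contMDiff (d := d) μ hΨ
  have hΦG (g : G) (x : N) (y : M) : Φ (g • x) (g • y) = Φ x y := orbitAverage_smul μ Ψ g x y
  -- Invariance of `ρ` moves `g` onto the local maps. A translate of `Ψ` is thus again a weighted
  -- sum of functions `ρ · w`, where `w = g • s i (g⁻¹ • x)` remains in the slice of `𝒲` over `x`.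
  have hΨg (g : G) (x : N) (y : M) :
      Ψ (g⁻¹ • x) (g⁻¹ • y) = ∑ᶠ i, lam i (g⁻¹ • x) * ρ y (g • s i (g⁻¹ • x)) := by
    simp only [Ψ]
    congr 1; ext1 i
    rw [← hρG g, smul_inv_smul]
  have hΨc (x : N) (y : M) : Continuous fun g : G => Ψ (g⁻¹ • x) (g⁻¹ • y) := by
    have hN := (ContMDiffSMul.contMDiff_inv_smul (d := d) (G := G) (IX := IN) (X := N)).continuous
    have hM := (ContMDiffSMul.contMDiff_inv_smul (d := d) (G := G) (IX := 𝓡 m) (X := M)).continuous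
    exact hΨ.continuous.comp (f := fun g : G => (g⁻¹ • x, g⁻¹ • y))
      ((hN.comp (f := fun g : G => (g, x)) (by fun_prop)).prodMk
        (hM.comp (f := fun g : G => (g, y)) (by fun_prop)))
  have hΦav (x : N) {W : Set M} (hW : ∀ z, (x, z) ∈ 𝒲 → z ∈ W) : IsAverageOf ρ W (Φ x) := by
    refine IsAverageOf.integral μ (h := fun g y => Ψ (g⁻¹ • x) (g⁻¹ • y)) (hΨc x) fun g => ?_
    simp only [hΨg]
    refine IsAverageOf.finsum (fun i => lam.nonneg _ _) (lam.locallyFinite.point_finite _)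
      (lam.sum_eq_one trivial) fun i hi => hW _ ?_
    have := h𝒲G g _ _ (hsV i _ (hlamV hi))
    rwa [smul_inv_smul] at this
  have hΦC (x : N) (hx : x ∈ C) (y : M) : Φ x y = ρ y (f x) := by
    have h1 (g : G) : Ψ (g⁻¹ • x) (g⁻¹ • y) = ρ y (f x) := by
      rw [hΨg]
      have h2 (i : N) : lam i (g⁻¹ • x) * ρ y (g • s i (g⁻¹ • x)) =
          lam i (g⁻¹ • x) * ρ y (f x) := by
        by_cases hi : lam i (g⁻¹ • x) = 0
        · simp [hi]
        · rw [hsC i _ (hlamV hi) (hCG _ _ hx), heq, smul_inv_smul]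
      simp only [h2]
      rw [← finsum_mul, lam.sum_eq_one trivial, one_mul]
    simp [Φ, orbitAverage, h1]
  -- At time `0` the minimum is `f x`, at time `1` it is the smooth approximation. All intermediate
  -- functions are averages over the same sets, so they too have strict minima.
  let H : unitInterval × N → M → ℝ := fun p y => (1 - p.1) * ρ y (f p.2) + p.1 * Φ p.2 y
  have hHc : Continuous (Function.uncurry H) := by
    have h1 : Continuous fun q : (unitInterval × N) × M => ρ q.2 (f q.1.2) :=
      hρ.smooth.continuous.comp (f := fun q : (unitInterval × N) × M => (q.2, f q.1.2))
        (by fun_prop)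
    have h2 : Continuous fun q : (unitInterval × N) × M => Φ q.1.2 q.2 :=
      hΦ.continuous.comp (f := fun q : (unitInterval × N) × M => (q.1.2, q.2)) (by fun_prop)
    have h3 : Continuous fun q : (unitInterval × N) × M => (q.1.1 : ℝ) := by fun_prop
    exact ((continuous_const.sub h3).mul h1).add (h3.mul h2)
  have hHav (t : unitInterval) (x : N) {W : Set M} (hW : ∀ z, (x, z) ∈ 𝒲 → z ∈ W) :
      IsAverageOf ρ W (H (t, x)) :=
    (IsAverageOf.of_mem (hW _ (hf𝒲 x))).convex_comb (hΦav x hW) t.2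
  have hmin (p : unitInterval × N) : ∃ y, IsStrictArgmin (H p) y := by
    obtain ⟨z₀, r, W, hgood, hev⟩ := h𝒲good p.2
    exact hgood.exists_isStrictArgmin (hHc.comp (Continuous.prodMk_right p))
      (hHav p.1 p.2 hev.self_of_nhds.1)
  choose K hK using hmin
  have hKc : Continuous K := by
    refine continuous_of_isStrictArgmin (m := m) (ρ := ρ) hHc hK fun p => ?_
    obtain ⟨z₀, r, W, hgood, hev⟩ := h𝒲good p.2
    refine ⟨z₀, r, W, hgood, ?_⟩
    filter_upwards [continuousAt_snd.eventually hev] with q hq using hHav q.1 q.2 hq.1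
  have hK1 (x : N) : IsStrictArgmin (Φ x) (K (1, x)) := by
    have := hK (1, x)
    simpa [H] using this
  have hKG (t : unitInterval) (g : G) (x : N) : K (t, g • x) = g • K (t, x) := by
    refine (hK _).eq fun y hy => ?_
    -- The functions are invariant, so by uniqueness their minima are equivariant.
    have h1 (y : M) : H (t, g • x) y = H (t, x) (g⁻¹ • y) := by
      simp only [H]
      rw [heq, ← hρG g (g⁻¹ • y), ← hΦG g x, smul_inv_smul]
    rw [h1, h1, inv_smul_smul]
    exact hK (t, x) _ fun he => hy (by rw [← he, smul_inv_smul])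
  refine ⟨fun x => K (1, x), ?_, hKG 1, ?_, ?_, K, hKc, ?_, fun _ => rfl, hKG⟩
  · refine contMDiff_of_isStrictArgmin (ρ := ρ) hΦ (hKc.comp (Continuous.prodMk_right 1)) hK1
      fun x => ?_
    obtain ⟨z₀, r, W, hgood, hev⟩ := h𝒲good x
    exact ⟨z₀, r, W, hgood, hΦav x hev.self_of_nhds.1⟩
  · intro x hx
    refine (hK1 x).eq ?_
    rw [show Φ x = fun y => ρ y (f x) from funext (hΦC x hx)]
    exact hρ.isStrictArgmin _
  · intro x
    obtain ⟨z₀, r, W, hgood, hev⟩ := h𝒲good x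
    exact hev.self_of_nhds.2 _ (hgood.mem_chartBall (hΦav x hev.self_of_nhds.1) (hK1 x))
  · intro x
    refine (hK (0, x)).eq ?_
    simpa [H] using hρ.isStrictArgmin (f x)

end Smoothing

/-! ### Smooth representatives and smooth homotopies -/

section EqMapSmoothing

variable {d m n : ℕ} {G : Type*} [Group G] [TopologicalSpace G] [IsTopologicalGroup G]
  [CompactSpace G]
  [ChartedSpace (EuclideanSpace ℝ (Fin d)) G] [LieGroup (𝓡 d) ∞ G]
  {M : Type*} [TopologicalSpace M] [T2Space M] [SecondCountableTopology M]
  [ChartedSpace (EuclideanSpace ℝ (Fin m)) M] [IsManifold (𝓡 m) ∞ M]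
  [MulAction G M] [ContMDiffSMul (𝓡 d) (𝓡 m) ∞ G M]
  {N : Type*} [TopologicalSpace N] [T2Space N] [SecondCountableTopology N]
  [ChartedSpace (EuclideanSpace ℝ (Fin n)) N]
  [IsManifold (𝓡 n) ∞ N] [MulAction G N] [ContMDiffSMul (𝓡 d) (𝓡 n) ∞ G N]

include d in
theorem EqMap.exists_smooth_homotopic (f : EqMap G N M) {Ω : Set (N × M)} (hΩ : IsOpen Ω)
    (hf : ∀ x, (x, f x) ∈ Ω) :
    ∃ f' : EqMap G N M, f'.IsSmooth n m ∧ f.Homotopic f' ∧ ∀ x, (x, f' x) ∈ Ω := by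
  have : LocallyCompactSpace N := ChartedSpace.locallyCompactSpace (EuclideanSpace ℝ (Fin n)) N
  obtain ⟨f', h1, h2, -, h3, K, hK, hK0, hK1, hKG⟩ :=
    exists_equivariant_smooth_approximation (d := d) (m := m) (IN := 𝓡 n) (G := G) f.1.continuous
      f.2 isOpen_empty isClosed_empty subset_rfl (by simp) (by simp [ContMDiffOn]) hΩ hf
  refine ⟨⟨⟨f', h1.continuous⟩, h2⟩, h1, ⟨?_⟩, h3⟩
  exact
    { toFun := K
      continuous_toFun := hK
      map_zero_left := hK0
      map_one_left := hK1
      prop' := fun t g x => hKG t g x }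

-- Let `G` act trivially on `ℝ` and make the homotopy constant near both ends. It is then already
-- smooth there, and the relative approximation theorem on `ℝ × N` leaves it unchanged for `t ≤ 0`
-- and `1 ≤ t`.
include d in
theorem EqMap.Homotopic.exists_smooth_homotopy {f₀ f₁ : EqMap G N M} (h : f₀.Homotopic f₁)
    (h₀ : f₀.IsSmooth n m) (h₁ : f₁.IsSmooth n m) :
    ∃ F : ℝ → EqMap G N M,
      ContMDiff (𝓘(ℝ, ℝ).prod (𝓡 n)) (𝓡 m) ∞ (fun p : ℝ × N => F p.1 p.2) ∧
      (∀ t ≤ 0, F t = f₀) ∧ ∀ t, 1 ≤ t → F t = f₁ := by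
  obtain ⟨h⟩ := h
  have : LocallyCompactSpace N := ChartedSpace.locallyCompactSpace (EuclideanSpace ℝ (Fin n)) N
  let _ : MulAction G (ℝ × N) :=
    { smul := fun g p => (p.1, g • p.2)
      one_smul := fun p => Prod.ext rfl (one_smul G p.2)
      mul_smul := fun g h p => Prod.ext rfl (mul_smul g h p.2) }
  have : ContMDiffSMul (𝓡 d) (𝓘(ℝ, ℝ).prod (𝓡 n)) ∞ G (ℝ × N) :=
    ⟨(contMDiff_fst.comp contMDiff_snd).prodMk
      (contMDiff_fst.smul (contMDiff_snd.comp contMDiff_snd))⟩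
  -- The whole homotopy takes place for times in `[1/3, 2/3]`.
  let f : ℝ × N → M := fun p => h (projIcc 0 1 zero_le_one (3 * p.1 - 1), p.2)
  have hf : Continuous f :=
    h.continuous.comp ((continuous_projIcc.comp (by fun_prop)).prodMk continuous_snd)
  have hfG (g : G) (p : ℝ × N) : f (g • p) = g • f p :=
    h.prop' (projIcc 0 1 zero_le_one (3 * p.1 - 1)) g p.2
  have e₀ (p : ℝ × N) (hp : p.1 < 1 / 3) : f p = f₀ p.2 := by
    simp only [f, projIcc_of_le_left (show (0 : ℝ) ≤ 1 from zero_le_one)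
      (show 3 * p.1 - 1 ≤ 0 by linarith)]
    exact h.map_zero_left p.2
  have e₁ (p : ℝ × N) (hp : 2 / 3 < p.1) : f p = f₁ p.2 := by
    simp only [f, projIcc_of_right_le (show (0 : ℝ) ≤ 1 from zero_le_one)
      (show 1 ≤ 3 * p.1 - 1 by linarith)]
    exact h.map_one_left p.2
  have hO₀ : IsOpen {p : ℝ × N | p.1 < 1 / 3} := isOpen_lt continuous_fst continuous_const
  have hO₁ : IsOpen {p : ℝ × N | 2 / 3 < p.1} := isOpen_lt continuous_const continuous_fst
  have hfO : ContMDiffOn (𝓘(ℝ, ℝ).prod (𝓡 n)) (𝓡 m) ∞ f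
      ({p : ℝ × N | p.1 < 1 / 3} ∪ {p : ℝ × N | 2 / 3 < p.1}) := by
    rintro p (hp | hp)
    · refine ContMDiffAt.contMDiffWithinAt ?_
      have : ContMDiff (𝓘(ℝ, ℝ).prod (𝓡 n)) (𝓡 m) ∞ fun p : ℝ × N => f₀ p.2 :=
        ContMDiff.comp h₀ contMDiff_snd
      refine this.contMDiffAt.congr_of_eventuallyEq ?_
      filter_upwards [hO₀.mem_nhds hp] with q hq using e₀ q hq
    · refine ContMDiffAt.contMDiffWithinAt ?_
      have : ContMDiff (𝓘(ℝ, ℝ).prod (𝓡 n)) (𝓡 m) ∞ fun p : ℝ × N => f₁ p.2 :=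
        ContMDiff.comp h₁ contMDiff_snd
      refine this.contMDiffAt.congr_of_eventuallyEq ?_
      filter_upwards [hO₁.mem_nhds hp] with q hq using e₁ q hq
  obtain ⟨F, hF, hFG, hFC, -⟩ :=
    exists_equivariant_smooth_approximation (d := d) (m := m) (IN := 𝓘(ℝ, ℝ).prod (𝓡 n)) (G := G)
      (C := {p : ℝ × N | p.1 ≤ 0} ∪ {p : ℝ × N | 1 ≤ p.1}) hf hfG (hO₀.union hO₁)
      ((isClosed_le continuous_fst continuous_const).union
        (isClosed_le continuous_const continuous_fst))
      (by
        rintro p (hp | hp)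
        · exact Or.inl (show p.1 < 1 / 3 from lt_of_le_of_lt hp (by norm_num))
        · exact Or.inr (show 2 / 3 < p.1 from lt_of_lt_of_le (by norm_num) hp))
      (fun g p hp => hp) hfO isOpen_univ (fun _ => trivial)
  refine ⟨fun t => ⟨⟨fun x => F (t, x), hF.continuous.comp (Continuous.prodMk_right t)⟩,
    fun g x => hFG g (t, x)⟩, hF, fun t ht => ?_, fun t ht => ?_⟩
  · refine DFunLike.ext _ _ fun x => (hFC (t, x) (Or.inl ht)).trans (e₀ _ ?_)
    exact lt_of_le_of_lt ht (by norm_num)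
  · refine DFunLike.ext _ _ fun x => (hFC (t, x) (Or.inr ht)).trans (e₁ _ ?_)
    exact lt_of_lt_of_le (by norm_num) ht

end EqMapSmoothing

/-! ### The conjugation action and the homomorphism `DR` -/

section ConjSelf

variable {d : ℕ} {G : Type*} [Group G] [TopologicalSpace G]
  [ChartedSpace (EuclideanSpace ℝ (Fin d)) G]

instance ConjSelf.instT2Space [T2Space G] : T2Space (ConjSelf G) := inferInstanceAs (T2Space G)

instance ConjSelf.instSecondCountableTopology [SecondCountableTopology G] :
    SecondCountableTopology (ConjSelf G) := inferInstanceAs (SecondCountableTopology G)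

instance ConjSelf.instLieGroup [LieGroup (𝓡 d) ∞ G] : LieGroup (𝓡 d) ∞ (ConjSelf G) :=
  inferInstanceAs (LieGroup (𝓡 d) ∞ G)

theorem ConjSelf.contMDiff_ofG [LieGroup (𝓡 d) ∞ G] :
    ContMDiff (𝓡 d) (𝓡 d) ∞ (ConjSelf.ofG : G → ConjSelf G) :=
  contMDiff_id (M := G)

instance ConjSelf.instContMDiffSMul [LieGroup (𝓡 d) ∞ G] :
    ContMDiffSMul (𝓡 d) (𝓡 d) ∞ G (ConjSelf G) where
  contMDiff_smul := by
    have h : ContMDiff ((𝓡 d).prod (𝓡 d)) (𝓡 d) ∞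
        fun p : G × ConjSelf G => ConjSelf.ofG p.1 :=
      ConjSelf.contMDiff_ofG.comp contMDiff_fst
    exact (h.mul contMDiff_snd).mul h.inv

end ConjSelf

section DR

variable {d m : ℕ} {G M : Type*}
    [Group G] [TopologicalSpace G] [IsTopologicalGroup G]
    [ChartedSpace (EuclideanSpace ℝ (Fin d)) G] [LieGroup (𝓡 d) ∞ G]
    [TopologicalSpace M] [ChartedSpace (EuclideanSpace ℝ (Fin m)) M] [MulAction G M]

theorem EqMap.IsSmooth.mul {α β : EqMap G M (ConjSelf G)} (hα : α.IsSmooth m d)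
    (hβ : β.IsSmooth m d) : (α * β).IsSmooth m d :=
  ContMDiff.mul (I := 𝓡 d) (I' := 𝓡 m) (G := ConjSelf G) hα hβ

variable [ContMDiffSMul (𝓡 d) (𝓡 m) ∞ G M]

/-- Equivariance gives `β (α(x) x) = α(x) β(x) α(x)⁻¹`, so applying `α̂` and then `β̂` yields `α(x)
β(x) x`. The order is reversed, which is why `DR` takes inverses. -/
theorem hatDiffeo_mul {α β : EqMap G M (ConjSelf G)} (hα : α.IsSmooth m d)
    (hβ : β.IsSmooth m d) :
    hatDiffeo (α * β) (hα.mul hβ) = hatDiffeo β hβ * hatDiffeo α hα := by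
  refine DFunLike.ext _ _ fun x => ?_
  change ConjSelf.toG (α x * β x) • x =
    ConjSelf.toG (β (ConjSelf.toG (α x) • x)) • ConjSelf.toG (α x) • x
  rw [show β (ConjSelf.toG (α x) • x) = ConjSelf.toG (α x) • β x from β.2 _ _, smul_smul]
  change _ = (ConjSelf.toG (α x) * ConjSelf.toG (β x) * (ConjSelf.toG (α x))⁻¹ *
    ConjSelf.toG (α x)) • x
  rw [inv_mul_cancel_right, map_mul]

variable [CompactSpace G] [T2Space G] [T2Space M] [SecondCountableTopology M]
    [IsManifold (𝓡 m) ∞ M]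

theorem EqMap.exists_smooth_conj (α : EqMap G M (ConjSelf G)) {W : Set (M × G)} (hW : IsOpen W)
    (hα : ∀ x, (x, ConjSelf.toG (α x)) ∈ W) :
    ∃ α' : EqMap G M (ConjSelf G), α'.IsSmooth m d ∧ α.Homotopic α' ∧
        ∀ x, (x, ConjSelf.toG (α' x)) ∈ W := by
  have : SecondCountableTopology G :=
    ChartedSpace.secondCountable_of_sigmaCompact (EuclideanSpace ℝ (Fin d)) G
  have hM : IsManifold (𝓡 d) ∞ (ConjSelf G) := inferInstance
  exact EqMap.exists_smooth_homotopic (d := d) α (Ω := W) hW hα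

/-- Homotopic smooth equivariant maps give isotopic diffeomorphisms. -/
theorem mk_hatDiffeo_inv_eq {α β : EqMap G M (ConjSelf G)} (hα : α.IsSmooth m d)
    (hβ : β.IsSmooth m d) (h : α.Homotopic β) :
    (QuotientGroup.mk (hatDiffeo α hα)⁻¹ : PiZeroDiffG G m M) =
      QuotientGroup.mk (hatDiffeo β hβ)⁻¹ := by
  have : SecondCountableTopology G :=
    ChartedSpace.secondCountable_of_sigmaCompact (EuclideanSpace ℝ (Fin d)) G
  have hM : IsManifold (𝓡 d) ∞ (ConjSelf G) := inferInstance
  obtain ⟨F, hF, hF0, hF1⟩ := h.exists_smooth_homotopy (d := d) hα hβ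
  have hFt (t : ℝ) : (F t).IsSmooth m d :=
    hF.comp (f := fun x : M => (t, x)) (contMDiff_const.prodMk contMDiff_id)
  rw [QuotientGroup.eq]
  have hs1 : SmoothFamily fun t => hatDiffeo (F t) (hFt t) := by
    have h1 : ContMDiff (𝓘(ℝ, ℝ).prod (𝓡 m)) (𝓡 d) ∞
        (fun p : ℝ × M => ConjSelf.toG (F p.1 p.2)) := hF
    exact (h1.smul contMDiff_snd).contMDiffOn
  have hs2 : SmoothFamily fun t => (hatDiffeo (F t) (hFt t))⁻¹ := by
    have h1 : ContMDiff (𝓘(ℝ, ℝ).prod (𝓡 m)) (𝓡 d) ∞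
        (fun p : ℝ × M => ConjSelf.toG (F p.1 p.2)) := hF
    exact (h1.inv.smul contMDiff_snd).contMDiffOn
  -- This path runs from the identity to the quotient of the two elements to be compared.
  refine ⟨fun t => (hatDiffeo α hα)⁻¹⁻¹ * (hatDiffeo (F t) (hFt t))⁻¹, (SmoothFamily.const _).mul hs2,
    ?_, ?_, ?_⟩
  · simpa only [mul_inv_rev, inv_inv] using hs1.mul (.const _)
  · simp [hF0 0 le_rfl]
  · simp [hF1 1 le_rfl]

/-- Every class has a smooth representative, which gives uniqueness; independence of the
representative is the isotopy statement. -/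
theorem existsUnique_DR : ∃! DR : EqHomotopyClasses G M (ConjSelf G) →* PiZeroDiffG G m M,
      ∀ (α' : EqMap G M (ConjSelf G)) (hα' : α'.IsSmooth m d),
        DR α'.toClass = QuotientGroup.mk (hatDiffeo α' hα')⁻¹ := by
  have hex (c : EqHomotopyClasses G M (ConjSelf G)) :
      ∃ α : EqMap G M (ConjSelf G), α.IsSmooth m d ∧ α.toClass = c := by
    obtain ⟨α, rfl⟩ := Quotient.exists_rep c
    obtain ⟨α', h1, h2, -⟩ := EqMap.exists_smooth_conj (m := m) (d := d) α isOpen_univ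
      fun _ => trivial
    exact ⟨α', h1, (Quotient.sound (s := EqMap.homotopySetoid G M (ConjSelf G)) h2).symm⟩
  choose r hr hrc using hex
  have hwd (α : EqMap G M (ConjSelf G)) (hα : α.IsSmooth m d) :
      (QuotientGroup.mk (hatDiffeo (r α.toClass) (hr _))⁻¹ : PiZeroDiffG G m M) =
        QuotientGroup.mk (hatDiffeo α hα)⁻¹ :=
    mk_hatDiffeo_inv_eq _ _
      (Quotient.exact (s := EqMap.homotopySetoid G M (ConjSelf G)) (hrc α.toClass))
  refine ⟨MonoidHom.mk' (fun c => QuotientGroup.mk (hatDiffeo (r c) (hr c))⁻¹) fun a b => ?_,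
    fun α hα => hwd α hα, fun DR hDR => ?_⟩
  · have h1 : a * b = (r a * r b).toClass := by
      nth_rw 1 [← hrc a, ← hrc b]
      rfl
    rw [h1, hwd _ ((hr a).mul (hr b)), hatDiffeo_mul (hr a) (hr b), mul_inv_rev,
      QuotientGroup.mk_mul]
  · ext c
    rw [← hrc c, hDR _ (hr c)]
    exact (hwd _ (hr c)).symm

end DR

/-! ### Gluing manifolds; actions of compact groups are proper -/

section Gluing

/-- A topological space that is covered by the sources of open partial homeomorphisms to manifolds
with smooth transition maps is a manifold. -/
theorem exists_chartedSpace_of_openPartialHomeomorph {n : ℕ} {X N ι : Type*} [TopologicalSpace X]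
    [TopologicalSpace N] [ChartedSpace (EuclideanSpace ℝ (Fin n)) N] [IsManifold (𝓡 n) ∞ N]
    (e : ι → OpenPartialHomeomorph X N) (hcov : ∀ c, ∃ i, c ∈ (e i).source)
    (hcompat : ∀ i j, ContMDiffOn (𝓡 n) (𝓡 n) ∞ (fun z => e j ((e i).symm z))
      ((e i).target ∩ (e i).symm ⁻¹' (e j).source)) :
    ∃ _ : ChartedSpace (EuclideanSpace ℝ (Fin n)) X, IsManifold (𝓡 n) ∞ X ∧
      (∀ i, ContMDiffOn (𝓡 n) (𝓡 n) ∞ (e i) (e i).source) ∧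
      ∀ i, ContMDiffOn (𝓡 n) (𝓡 n) ∞ (e i).symm (e i).target := by
  choose ix hix using hcov
  let E := EuclideanSpace ℝ (Fin n)
  let cs : ChartedSpace E X :=
    { atlas := {c | ∃ i z, c = (e i).trans (chartAt E z)}
      chartAt := fun c => (e (ix c)).trans (chartAt E (e (ix c) c))
      mem_chart_source := fun c => by simp [hix c]
      chart_mem_atlas := fun c => ⟨_, _, rfl⟩ }
  have hman : IsManifold (𝓡 n) ∞ X := by
    refine isManifold_of_contDiffOn (𝓡 n) ∞ X ?_
    rintro _ _ ⟨i, z, rfl⟩ ⟨j, z', rfl⟩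
    rw [← contMDiffOn_iff_contDiffOn]
    have h1 := contMDiffOn_chart_symm (I := 𝓡 n) (n := ∞) (x := z)
    have h2 := contMDiffOn_chart (I := 𝓡 n) (n := ∞) (x := z')
    have h3 := (h2.comp' (hcompat i j)).comp' h1
    refine h3.mono fun u hu => ?_
    simpa [and_assoc, and_comm, and_left_comm] using hu
  refine ⟨cs, hman, fun i c hc => ?_, fun i z hz => ?_⟩
  · have hmem : (e i).trans (chartAt E (e i c)) ∈ IsManifold.maximalAtlas (𝓡 n) ∞ X :=
      IsManifold.subset_maximalAtlas ⟨i, _, rfl⟩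
    have hc' : c ∈ ((e i).trans (chartAt E (e i c))).source := by simp [hc]
    have h1 := (contMDiffOn_of_mem_maximalAtlas hmem).contMDiffAt
      (((e i).trans (chartAt E (e i c))).open_source.mem_nhds hc')
    have h2 : ContMDiffAt (𝓡 n) (𝓡 n) ∞ (chartAt E (e i c)).symm
        ((e i).trans (chartAt E (e i c)) c) :=
      (contMDiffOn_chart_symm (x := e i c)).contMDiffAt
        ((chartAt E (e i c)).open_target.mem_nhds (by simp))
    refine ((h2.comp c h1).congr_of_eventuallyEq ?_).contMDiffWithinAt
    filter_upwards [((e i).trans (chartAt E (e i c))).open_source.mem_nhds hc'] with c' hc''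
    simp only [OpenPartialHomeomorph.trans_source, mem_inter_iff, mem_preimage] at hc''
    simp [(chartAt E (e i c)).left_inv hc''.2]
  · have hmem : (e i).trans (chartAt E z) ∈ IsManifold.maximalAtlas (𝓡 n) ∞ X :=
      IsManifold.subset_maximalAtlas ⟨i, _, rfl⟩
    have h1 : ContMDiffAt (𝓡 n) (𝓡 n) ∞ ((e i).trans (chartAt E z)).symm (chartAt E z z) :=
      (contMDiffOn_symm_of_mem_maximalAtlas hmem).contMDiffAt
        (((e i).trans (chartAt E z)).open_target.mem_nhds (by simp [hz]))
    have h2 : ContMDiffAt (𝓡 n) (𝓡 n) ∞ (chartAt E z) z :=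
      (contMDiffOn_chart (x := z)).contMDiffAt ((chartAt E z).open_source.mem_nhds (by simp))
    refine ((h1.comp z h2).congr_of_eventuallyEq ?_).contMDiffWithinAt
    filter_upwards [(chartAt E z).open_source.mem_nhds (mem_chart_source E z)] with z' hz'
    simp [(chartAt E z).left_inv hz']

/-- In the ultrafilter criterion for properness one needs a limit of the group components, and
compactness of `G` provides it. -/
theorem properSMul_of_compactSpace {G X : Type*} [Group G] [TopologicalSpace G] [CompactSpace G]
    [TopologicalSpace X] [T2Space X] [MulAction G X] [ContinuousSMul G X] : ProperSMul G X := by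
  rw [properSMul_iff_continuousSMul_ultrafilter_tendsto_t2]
  refine ⟨inferInstance, fun 𝒰 x₁ x₂ _ => ?_⟩
  obtain ⟨g, -, hg⟩ := isCompact_univ.ultrafilter_le_nhds (𝒰.map Prod.fst) (by simp)
  exact ⟨g, hg⟩

end Gluing

/-! ### Fibre coordinates of a `⋆`-bundle -/

namespace StarBundle

variable {d m : ℕ} {EP HP : Type*} [NormedAddCommGroup EP]
    [NormedSpace ℝ EP] [TopologicalSpace HP] {IP : ModelWithCorners ℝ EP HP} {G M P : Type u}
    [Group G] [TopologicalSpace G] [ChartedSpace (EuclideanSpace ℝ (Fin d)) G]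
    [TopologicalSpace M] [ChartedSpace (EuclideanSpace ℝ (Fin m)) M] [MulAction G M]
    [TopologicalSpace P] [ChartedSpace HP P] [MulAction (G × G) P]
    (B : StarBundle d m IP G M P)

/-- The fibre coordinate in a local trivialization. -/
def fib (i : B.ι) (y : P) : G := ((B.triv i).toPartialEquiv.symm y).2

variable {B} {i j : B.ι} {x : M} {y : P}

theorem triv_fib (hy : B.proj y ∈ B.U i) : B.triv i (B.proj y, B.fib i y) = y := by
  have h1 : y ∈ (B.triv i).target := by rw [B.triv_target]; exact hy
  have h2 := (B.triv i).map_target h1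
  have h3 : B.triv i ((B.triv i).toPartialEquiv.symm y) = y := (B.triv i).right_inv h1
  rw [B.triv_source] at h2
  have h4 := B.proj_triv i _ h2.1 ((B.triv i).toPartialEquiv.symm y).2
  have h5 : B.proj y = ((B.triv i).toPartialEquiv.symm y).1 := by
    rw [← h4]; exact congrArg B.proj h3.symm
  rw [fib, h5]
  exact h3

theorem fib_triv (hx : x ∈ B.U i) (g : G) : B.fib i (B.triv i (x, g)) = g := by
  have h1 : (x, g) ∈ (B.triv i).source := by rw [B.triv_source]; exact ⟨hx, trivial⟩
  exact congrArg Prod.snd ((B.triv i).left_inv h1)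

theorem smul_mem_U_iff {g : G} : g • x ∈ B.U i ↔ x ∈ B.U i := by
  refine ⟨fun h => ?_, B.smul_mem_U i g x⟩
  simpa using B.smul_mem_U i g⁻¹ _ h

theorem smul_eq_triv (hy : B.proj y ∈ B.U i) (q r : G) :
    (q, r) • y = B.triv i (q • B.proj y, r * B.fib i y * q⁻¹) := by
  conv_lhs => rw [← triv_fib hy]
  exact B.smul_triv i _ hy _ q r

theorem proj_smul (q r : G) (y : P) : B.proj ((q, r) • y) = q • B.proj y := by
  obtain ⟨i, hi⟩ := B.cover (B.proj y)
  rw [smul_eq_triv hi, B.proj_triv i _ (smul_mem_U_iff.2 hi)]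

theorem fib_smul (hy : B.proj y ∈ B.U i) (q r : G) :
    B.fib i ((q, r) • y) = r * B.fib i y * q⁻¹ := by
  rw [smul_eq_triv hy, fib_triv (smul_mem_U_iff.2 hy)]

theorem fib_change (hi : B.proj y ∈ B.U i) (hj : B.proj y ∈ B.U j) :
    B.fib j y = B.fib i y * B.φ i j (B.proj y) := by
  conv_lhs => rw [← triv_fib hi, B.triv_change i j _ ⟨hi, hj⟩]
  rw [fib_triv hj]

/-- Points of the same fibre with the same fibre coordinate agree. -/
theorem eq_of_fib_eq {y' : P} (hy : B.proj y ∈ B.U i) (hp : B.proj y = B.proj y')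
    (h : B.fib i y = B.fib i y') : y = y' := by
  rw [← triv_fib hy, ← triv_fib (y := y') (i := i) (hp ▸ hy), hp, h]

variable (B)

theorem isOpen_preimage_U (i : B.ι) : IsOpen (B.proj ⁻¹' B.U i) :=
  B.triv_target i ▸ (B.triv i).open_target

theorem contMDiffOn_triv (i : B.ι) :
    ContMDiffOn ((𝓡 m).prod (𝓡 d)) IP ∞ (B.triv i) (B.U i ×ˢ univ) :=
  B.triv_source i ▸ (B.triv i).contMDiffOn_toFun

theorem contMDiffOn_symm (i : B.ι) :
    ContMDiffOn IP ((𝓡 m).prod (𝓡 d)) ∞ (B.triv i).toPartialEquiv.symm (B.proj ⁻¹' B.U i) :=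
  B.triv_target i ▸ (B.triv i).contMDiffOn_invFun

theorem contMDiffOn_fib (i : B.ι) : ContMDiffOn IP (𝓡 d) ∞ (B.fib i) (B.proj ⁻¹' B.U i) :=
  contMDiff_snd.comp_contMDiffOn (B.contMDiffOn_symm i)

theorem contMDiff_proj : ContMDiff IP (𝓡 m) ∞ B.proj := by
  intro y
  obtain ⟨i, hi⟩ := B.cover (B.proj y)
  have h1 : ContMDiffOn IP (𝓡 m) ∞ (fun y => ((B.triv i).toPartialEquiv.symm y).1)
    (B.proj ⁻¹' B.U i) := contMDiff_fst.comp_contMDiffOn (B.contMDiffOn_symm i)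
  have h2 : ∀ y ∈ B.proj ⁻¹' B.U i, B.proj y = ((B.triv i).toPartialEquiv.symm y).1 := by
    intro y hy
    have h1 : y ∈ (B.triv i).target := by rw [B.triv_target]; exact hy
    have h2 := (B.triv i).map_target h1
    have h3 : B.triv i ((B.triv i).toPartialEquiv.symm y) = y := (B.triv i).right_inv h1
    rw [B.triv_source] at h2
    rw [← B.proj_triv i _ h2.1 ((B.triv i).toPartialEquiv.symm y).2]
    exact congrArg B.proj h3.symm
  exact (h1.congr h2).contMDiffAt ((B.isOpen_preimage_U i).mem_nhds hi)

variable [LieGroup (𝓡 d) ∞ G] [ContMDiffSMul (𝓡 d) (𝓡 m) ∞ G M]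

include B in
/-- The action of `G × G` on the total space is smooth. -/
theorem contMDiff_smul_total :
    ContMDiff (((𝓡 d).prod (𝓡 d)).prod IP) IP ∞ fun p : (G × G) × P => p.1 • p.2 := by
  rintro ⟨⟨q₀, r₀⟩, y₀⟩
  obtain ⟨i, hi⟩ := B.cover (B.proj y₀)
  have hO : IsOpen {p : (G × G) × P | B.proj p.2 ∈ B.U i} :=
    (B.isOpen_preimage_U i).preimage continuous_snd
  have hq : ContMDiff (((𝓡 d).prod (𝓡 d)).prod IP) (𝓡 d) ∞ fun p : (G × G) × P => p.1.1 :=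
    contMDiff_fst.comp contMDiff_fst
  have hr : ContMDiff (((𝓡 d).prod (𝓡 d)).prod IP) (𝓡 d) ∞ fun p : (G × G) × P => p.1.2 :=
    contMDiff_snd.comp contMDiff_fst
  have hfib : ContMDiffOn (((𝓡 d).prod (𝓡 d)).prod IP) (𝓡 d) ∞
      (fun p : (G × G) × P => B.fib i p.2) {p | B.proj p.2 ∈ B.U i} :=
    (B.contMDiffOn_fib i).comp contMDiffOn_snd fun p hp => hp
  have hpr : ContMDiff (((𝓡 d).prod (𝓡 d)).prod IP) (𝓡 m) ∞
      fun p : (G × G) × P => p.1.1 • B.proj p.2 :=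
    hq.smul (B.contMDiff_proj.comp contMDiff_snd)
  have h1 : ContMDiffOn (((𝓡 d).prod (𝓡 d)).prod IP) IP ∞ (fun p : (G × G) × P =>
      B.triv i (p.1.1 • B.proj p.2, p.1.2 * B.fib i p.2 * p.1.1⁻¹)) {p | B.proj p.2 ∈ B.U i} :=
    (B.contMDiffOn_triv i).comp (hpr.contMDiffOn.prodMk
      ((hr.contMDiffOn.mul hfib).mul hq.contMDiffOn.inv)) fun p hp =>
        ⟨B.smul_mem_U i _ _ hp, trivial⟩
  refine (h1.congr fun p hp => ?_).contMDiffAt (hO.mem_nhds hi)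
  exact smul_eq_triv hp _ _

end StarBundle

/-! ### The quotient of the induced bundle by the `⋆`-action -/

namespace StarBundle

variable {d m n : ℕ} {EP HP : Type*} [NormedAddCommGroup EP]
    [NormedSpace ℝ EP] [TopologicalSpace HP] {IP : ModelWithCorners ℝ EP HP} {G M N P : Type u}
    [Group G] [TopologicalSpace G] [ChartedSpace (EuclideanSpace ℝ (Fin d)) G]
    [TopologicalSpace M] [ChartedSpace (EuclideanSpace ℝ (Fin m)) M] [MulAction G M]
    [TopologicalSpace P] [ChartedSpace HP P] [MulAction (G × G) P]
    [TopologicalSpace N] [MulAction G N]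
    (B : StarBundle d m IP G M P) (f : EqMap G N M)

/-- The total space of the induced bundle, as a type with the `⋆`-action. -/
def Total : Type u := {a : N × P // a ∈ B.pullback f}

instance : TopologicalSpace (B.Total f) := inferInstanceAs (TopologicalSpace (B.pullback f))

variable {B f}

omit [TopologicalSpace N] [MulAction G N] in
theorem mem_pullback {f : N → M} {a : N × P} : a ∈ B.pullback f ↔ f a.1 = B.proj a.2 := Iff.rfl

theorem smul_mem_pullback {a : N × P} (ha : a ∈ B.pullback f) (q r : G) :
    (q • a.1, (q, r) • a.2) ∈ B.pullback f := by
  rw [mem_pullback] at ha ⊢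
  change f (q • a.1) = B.proj ((q, r) • a.2)
  rw [proj_smul, ← ha]
  exact f.2 q a.1

theorem principal_mem_pullback {a : N × P} (ha : a ∈ B.pullback f) (r : G) :
    (a.1, ((1 : G), r) • a.2) ∈ B.pullback f := by
  simpa using smul_mem_pullback ha 1 r

instance : MulAction G (B.Total f) where
  smul q a := ⟨(q • a.1.1, (q, (1 : G)) • a.1.2), smul_mem_pullback a.2 q 1⟩
  one_smul a := Subtype.ext (Prod.ext (one_smul _ _) (one_smul (G × G) _))
  mul_smul q r a := Subtype.ext (Prod.ext (mul_smul _ _ _) (by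
    change (q * r, (1 : G)) • a.1.2 = (q, (1 : G)) • (r, (1 : G)) • a.1.2
    rw [smul_smul, Prod.mk_mul_mk, one_mul]))

theorem Total.coe_smul (q : G) (a : B.Total f) :
    (q • a).1 = (q • a.1.1, (q, (1 : G)) • a.1.2) := rfl

/-- The coordinate `(x, triv i (f x, g)) ↦ g x` on the quotient by the `⋆`-action. -/
def Total.coord (i : B.ι) (a : B.Total f) : N := B.fib i a.1.2 • a.1.1

theorem Total.proj_eq (a : B.Total f) : B.proj a.1.2 = f a.1.1 := (mem_pullback.1 a.2).symm

theorem Total.map_smul_mem {i : B.ι} {a : B.Total f} {q : G} :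
    f (q • a).1.1 ∈ B.U i ↔ f a.1.1 ∈ B.U i := by
  rw [Total.coe_smul, show f (q • a.1.1) = q • f a.1.1 from f.2 _ _, smul_mem_U_iff]

/-- The `⋆`-action of `q` changes `x` into `q x` and the fibre coordinate `g` into `g q⁻¹`, so `g x`
is unchanged. -/
theorem Total.coord_smul {i : B.ι} {a : B.Total f} (ha : f a.1.1 ∈ B.U i) (q : G) :
    (q • a).coord i = a.coord i := by
  rw [coord, coord, Total.coe_smul, fib_smul (a.proj_eq ▸ ha), one_mul, mul_smul, inv_smul_smul]

/-- Over `U i` this is the section with fibre coordinate `1`. Points elsewhere get an arbitrary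
element of the fibre, so that the choice is a function on all of `N`. -/
theorem exists_section (i : B.ι) (x : N) :
    ∃ a : B.Total f, a.1.1 = x ∧ (f x ∈ B.U i → a.1.2 = B.triv i (f x, 1)) := by
  by_cases hx : f x ∈ B.U i
  · exact ⟨⟨(x, B.triv i (f x, 1)), mem_pullback.2 (B.proj_triv i _ hx 1).symm⟩, rfl, fun _ => rfl⟩
  · obtain ⟨j, hj⟩ := B.cover (f x)
    exact ⟨⟨(x, B.triv j (f x, 1)), mem_pullback.2 (B.proj_triv j _ hj 1).symm⟩, rfl,
      fun h => absurd h hx⟩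

variable (B f)

/-- The quotient of the induced bundle by the `⋆`-action. -/
abbrev Quot : Type u := MulAction.orbitRel.Quotient G (B.Total f)

variable {B f}

/-- The class of a point of the induced bundle. -/
abbrev Total.mk (a : B.Total f) : B.Quot f := Quotient.mk (MulAction.orbitRel G (B.Total f)) a

theorem Total.mk_eq_mk {a b : B.Total f} : a.mk = b.mk ↔ ∃ q : G, b = q • a := by
  rw [eq_comm, Quotient.eq, MulAction.orbitRel_apply, MulAction.mem_orbit_iff]
  simp only [eq_comm]

theorem Total.exists_out (a : B.Total f) : ∃ q : G, Quotient.out a.mk = q • a :=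
  Total.mk_eq_mk.1 (Quotient.out_eq a.mk).symm

theorem Total.coord_out {i : B.ι} {a : B.Total f} (ha : f a.1.1 ∈ B.U i) :
    (Quotient.out a.mk).coord i = a.coord i := by
  obtain ⟨q, hq⟩ := a.exists_out
  rw [hq, coord_smul ha]

theorem Total.out_mem {i : B.ι} {a : B.Total f} :
    f (Quotient.out a.mk).1.1 ∈ B.U i ↔ f a.1.1 ∈ B.U i := by
  obtain ⟨q, hq⟩ := a.exists_out
  rw [hq, map_smul_mem]

instance : MulAction G (B.Quot f) where
  smul r := Quotient.map (fun a : B.Total f =>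
      (⟨(a.1.1, ((1 : G), r) • a.1.2), principal_mem_pullback a.2 r⟩ : B.Total f)) (by
    rintro _ b ⟨q, rfl⟩
    refine ⟨q, Subtype.ext (Prod.ext rfl ?_)⟩
    change (q, (1 : G)) • ((1 : G), r) • b.1.2 = ((1 : G), r) • (q, (1 : G)) • b.1.2
    rw [smul_smul, smul_smul, Prod.mk_mul_mk, Prod.mk_mul_mk]
    simp)
  one_smul c := by
    induction c using Quotient.inductionOn with
    | h a => exact congrArg Total.mk (Subtype.ext (Prod.ext rfl (one_smul (G × G) _)))
  mul_smul r s c := by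
    induction c using Quotient.inductionOn with
    | h a =>
      refine congrArg Total.mk (Subtype.ext (Prod.ext rfl ?_))
      change ((1 : G), r * s) • a.1.2 = ((1 : G), r) • ((1 : G), s) • a.1.2
      rw [smul_smul, Prod.mk_mul_mk, one_mul]

theorem Total.smul_mk (r : G) (a : B.Total f) : r • a.mk =
    Total.mk ⟨(a.1.1, ((1 : G), r) • a.1.2), principal_mem_pullback a.2 r⟩ := rfl

variable [LieGroup (𝓡 d) ∞ G] [ContMDiffSMul (𝓡 d) (𝓡 m) ∞ G M]
  [ChartedSpace (EuclideanSpace ℝ (Fin n)) N] [ContMDiffSMul (𝓡 d) (𝓡 n) ∞ G N]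

include n in
theorem Total.continuousSMul : ContinuousSMul G (B.Total f) where
  continuous_smul := by
    have h1 : Continuous fun p : G × N => p.1 • p.2 :=
      (contMDiff_smul (I := 𝓡 d) (I' := 𝓡 n) (n := ∞)).continuous
    have h2 := B.contMDiff_smul_total.continuous
    have hv : Continuous fun p : G × B.Total f => p.2.1 := continuous_subtype_val.comp continuous_snd
    refine Continuous.subtype_mk (Continuous.prodMk ?_ ?_) _
    · exact h1.comp (continuous_fst.prodMk (continuous_fst.comp hv))
    · exact h2.comp (f := fun p : G × B.Total f => ((p.1, (1 : G)), p.2.1.2))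
        ((continuous_fst.prodMk continuous_const).prodMk (continuous_snd.comp hv))

omit [LieGroup (𝓡 d) ∞ G] [ContMDiffSMul (𝓡 d) (𝓡 m) ∞ G M] in
theorem contMDiffOn_fib_smul (i : B.ι) :
    ContMDiffOn ((𝓡 n).prod IP) (𝓡 n) ∞ (fun a : N × P => B.fib i a.2 • a.1)
      {a | B.proj a.2 ∈ B.U i} :=
  ((B.contMDiffOn_fib i).comp contMDiffOn_snd fun _ hp => hp).smul contMDiffOn_fst

include n in
/-- The quotient by the `⋆`-action is glued from invariant open subsets of `N`. -/
theorem exists_quotChart (i : B.ι) : ∃ e : OpenPartialHomeomorph (B.Quot f) N,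
    (∀ a : B.Total f, a.mk ∈ e.source ↔ f a.1.1 ∈ B.U i) ∧ (e.target = {z | f z ∈ B.U i}) ∧
    (∀ a : B.Total f, f a.1.1 ∈ B.U i → e a.mk = a.coord i) := by
  have : ContinuousSMul G (B.Total f) := Total.continuousSMul (n := n)
  have hoq : IsOpenQuotientMap (Total.mk : B.Total f → B.Quot f) :=
    MulAction.isOpenQuotientMap_quotientMk
  choose s hs1 hs2 using fun x => exists_section (B := B) (f := f) i x
  have hmem : ∀ a : B.Total f, a.mk ∈ {c : B.Quot f | f (Quotient.out c).1.1 ∈ B.U i} ↔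
    f a.1.1 ∈ B.U i := fun a => Total.out_mem
  have hs3 (x : N) (hx : f x ∈ B.U i) : (s x).coord i = x := by
    rw [Total.coord, hs1, hs2 x hx, fib_triv hx, one_smul]
  have hO : IsOpen {a : B.Total f | f a.1.1 ∈ B.U i} :=
    (B.isOpen_U i).preimage (f.1.continuous.comp (continuous_fst.comp continuous_subtype_val))
  have hpre : Total.mk ⁻¹' {c : B.Quot f | f (Quotient.out c).1.1 ∈ B.U i} =
      {a : B.Total f | f a.1.1 ∈ B.U i} := Set.ext hmem
  have hopen : IsOpen {c : B.Quot f | f (Quotient.out c).1.1 ∈ B.U i} := by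
    rw [← hoq.isQuotientMap.isOpen_preimage, hpre]
    exact hO
  refine ⟨{ toFun := fun c => (Quotient.out c).coord i
            invFun := fun x => (s x).mk
            source := {c : B.Quot f | f (Quotient.out c).1.1 ∈ B.U i}
            target := {z | f z ∈ B.U i}
            map_source' := ?_
            map_target' := ?_
            left_inv' := ?_
            right_inv' := ?_
            open_source := hopen
            open_target := (B.isOpen_U i).preimage f.1.continuous
            continuousOn_toFun := ?_
            continuousOn_invFun := ?_ }, hmem, rfl, fun a ha => Total.coord_out ha⟩
  · intro c hc
    have h1 : f (Quotient.out c).1.1 ∈ B.U i := hc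
    change f ((Quotient.out c).coord i) ∈ B.U i
    rw [Total.coord, show f (_ • _) = _ from f.2 _ _, smul_mem_U_iff]
    exact h1
  · intro x hx
    rw [hmem, hs1]
    exact hx
  · intro c hc
    have h1 : f (Quotient.out c).1.1 ∈ B.U i := hc
    nth_rw 2 [← Quotient.out_eq c]
    set a := Quotient.out c
    -- Acting on `a` by its own fibre coordinate makes that coordinate `1`, so the result is the
    -- value of the section.
    refine (Total.mk_eq_mk.2 ⟨B.fib i a.1.2, Subtype.ext ?_⟩).symm
    have h2 : f (a.coord i) ∈ B.U i := by
      rw [Total.coord, show f (_ • _) = _ from f.2 _ _, smul_mem_U_iff]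
      exact h1
    refine Prod.ext (hs1 _) ?_
    rw [hs2 _ h2, Total.coe_smul]
    refine eq_of_fib_eq (i := i) ?_ ?_ ?_
    · rw [B.proj_triv _ _ h2]; exact h2
    · rw [B.proj_triv _ _ h2, proj_smul, a.proj_eq]
      exact f.2 _ _
    · rw [fib_triv h2, fib_smul (a.proj_eq ▸ h1)]
      simp
  · intro x hx
    rw [Total.coord_out (by rw [hs1]; exact hx), hs3 x hx]
  -- Continuity is tested on the total space, where the chart is the smooth map `coord`.
  · rw [hoq.isQuotientMap.continuousOn_isOpen_iff hopen, hpre]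
    have h1 : ContinuousOn (fun a : B.Total f => a.coord i) {a | f a.1.1 ∈ B.U i} :=
      (contMDiffOn_fib_smul (n := n) i).continuousOn.comp continuous_subtype_val.continuousOn
        fun a ha => by
          rw [mem_ofPred_eq, a.proj_eq]
          exact ha
    exact h1.congr fun a ha => Total.coord_out ha
  · refine hoq.continuous.comp_continuousOn ?_
    have hind : Topology.IsInducing (fun a : B.Total f => a.1) := Topology.IsInducing.subtypeVal
    rw [hind.continuousOn_iff]
    have h1 : ContinuousOn (fun x : N => (x, B.triv i (f x, 1))) {z | f z ∈ B.U i} :=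
      continuousOn_id.prodMk ((B.contMDiffOn_triv i).continuousOn.comp
        (f := fun x : N => (f x, (1 : G))) (f.1.continuous.prodMk continuous_const).continuousOn
          fun x hx => ⟨hx, trivial⟩)
    exact h1.congr fun x hx => Prod.ext (hs1 x) (hs2 x hx)

/-- The charts differ by `z ↦ φ i j (f z) • z`, which is smooth. In each chart the principal action
is the given action on `N`, because `r` multiplies the fibre coordinate from the left. The quotient
is Hausdorff by properness of the `⋆`-action. -/
theorem exists_isStarQuotient [CompactSpace G] [T2Space N] [SecondCountableTopology N]
    [IsManifold (𝓡 n) ∞ N] [T2Space P] [SecondCountableTopology P] (hf : f.IsSmooth n m) :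
    ∃ X : SmoothGManifold d G, B.IsStarQuotient n f X := by
  classical
  have : ContinuousSMul G (B.Total f) := Total.continuousSMul (n := n)
  have : T2Space (B.Total f) := inferInstanceAs (T2Space (B.pullback f))
  have : SecondCountableTopology (B.Total f) :=
    inferInstanceAs (SecondCountableTopology (B.pullback f))
  have : ProperSMul G (B.Total f) := properSMul_of_compactSpace
  have hT2 : T2Space (B.Quot f) := t2Space_quotient_mulAction_of_properSMul
  have hSC : SecondCountableTopology (B.Quot f) := ContinuousConstSMul.secondCountableTopology
  choose e he1 he2 he3 using fun i => exists_quotChart (n := n) (B := B) (f := f) i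
  have hsymm (i : B.ι) (a : B.Total f) (ha : f a.1.1 ∈ B.U i) : (e i).symm (a.coord i) = a.mk := by
    rw [← he3 i a ha, (e i).left_inv ((he1 i a).2 ha)]
  -- a representative of the inverse of a chart
  have hrep (i : B.ι) (z : N) (hz : f z ∈ B.U i) : ∃ a : B.Total f, a.1 = (z, B.triv i (f z, 1)) ∧
      (e i).symm z = a.mk := by
    obtain ⟨a, h1, h2⟩ := exists_section (B := B) (f := f) i z
    refine ⟨a, Prod.ext h1 (h2 hz), ?_⟩
    have h3 : a.coord i = z := by rw [Total.coord, h1, h2 hz, fib_triv hz, one_smul]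
    rw [← hsymm i a (h1 ▸ hz), h3]
  obtain ⟨cs, hman, hsm, hsm'⟩ := exists_chartedSpace_of_openPartialHomeomorph (n := n) e
    (fun c => by
      induction c using Quotient.inductionOn with
      | h a =>
        obtain ⟨i, hi⟩ := B.cover (f a.1.1)
        exact ⟨i, (he1 i a).2 hi⟩)
    (fun i j => by
      have h1 : ContMDiffOn (𝓡 n) (𝓡 n) ∞ (fun z => B.φ i j (f z) • z)
          {z | f z ∈ B.U i ∩ B.U j} :=
        ((B.smooth_φ i j).comp (ContMDiff.contMDiffOn hf) fun z hz => hz).smul contMDiffOn_id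
      have h2 (z : N) (hz : z ∈ (e i).target ∩ (e i).symm ⁻¹' (e j).source) :
          f z ∈ B.U i ∩ B.U j ∧ e j ((e i).symm z) = B.φ i j (f z) • z := by
        have hzi : f z ∈ B.U i := by
          have := hz.1
          rwa [he2] at this
        obtain ⟨a, ha, hae⟩ := hrep i z hzi
        have hzj : f a.1.1 ∈ B.U j := by
          have := hz.2
          rwa [mem_preimage, hae, he1] at this
        rw [hae, he3 j a hzj, Total.coord]
        rw [ha] at hzj ⊢
        refine ⟨⟨hzi, hzj⟩, ?_⟩
        have hp := B.proj_triv i _ hzi 1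
        rw [fib_change (i := i) (j := j) (by rw [hp]; exact hzi) (by rw [hp]; exact hzj), hp,
          fib_triv hzi, one_mul]
      exact (h1.mono fun z hz => (h2 z hz).1).congr fun z hz => (h2 z hz).2)
  have hcov (c : B.Quot f) : ∃ i, c ∈ (e i).source := by
    induction c using Quotient.inductionOn with
    | h a =>
      obtain ⟨i, hi⟩ := B.cover (f a.1.1)
      exact ⟨i, (he1 i a).2 hi⟩
  have hesmul (i : B.ι) (r : G) (c : B.Quot f) (hc : c ∈ (e i).source) :
      r • c = (e i).symm (r • e i c) := by
    induction c using Quotient.inductionOn with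
    | h a =>
      have ha := (he1 i a).1 hc
      rw [he3 i a ha, Total.smul_mk, ← hsymm i ⟨(a.1.1, ((1 : G), r) • a.1.2), _⟩ ha]
      congr 1
      change B.fib i (((1 : G), r) • a.1.2) • a.1.1 = r • B.fib i a.1.2 • a.1.1
      rw [fib_smul (a.proj_eq ▸ ha), inv_one, mul_one, mul_smul]
  have hsmul : ContMDiffSMul (𝓡 d) (𝓡 n) ∞ G (B.Quot f) := by
    refine ⟨?_⟩
    rintro ⟨r₀, c₀⟩
    obtain ⟨i, hi⟩ := hcov c₀
    have h1 : ContMDiffOn ((𝓡 d).prod (𝓡 n)) (𝓡 n) ∞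
        (fun p : G × B.Quot f => (e i).symm (p.1 • e i p.2)) (univ ×ˢ (e i).source) := by
      refine (hsm' i).comp (contMDiffOn_fst.smul ((hsm i).comp contMDiffOn_snd fun p hp => hp.2))
        fun p hp => ?_
      have h2 := (e i).map_source hp.2
      rw [he2, mem_ofPred_eq] at h2
      rw [he2, mem_preimage, mem_ofPred_eq, show f (_ • _) = _ from f.2 _ _, smul_mem_U_iff]
      exact h2
    exact (h1.congr fun p hp => hesmul i p.1 p.2 hp.2).contMDiffAt
      ((isOpen_univ.prod (e i).open_source).mem_nhds ⟨trivial, hi⟩)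
  let X : SmoothGManifold d G := { carrier := B.Quot f, dim := n }
  -- Off the induced bundle the value of `q` is arbitrary.
  have hq (a : N × P) : ∃ c : B.Quot f, ∀ h : a ∈ B.pullback f, c = Total.mk ⟨a, h⟩ := by
    by_cases h : a ∈ B.pullback f
    · exact ⟨Total.mk ⟨a, h⟩, fun _ => rfl⟩
    · obtain ⟨i, hi⟩ := B.cover (f a.1)
      exact ⟨(e i).symm a.1, fun h' => absurd h' h⟩
  choose q hq using hq
  refine ⟨X, q, ?_, ?_, ?_, ?_, ?_⟩
  · rintro ⟨x, y⟩ ha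
    obtain ⟨i, hi⟩ := B.cover (B.proj y)
    have hO : IsOpen {a : N × P | B.proj a.2 ∈ B.U i} :=
      (B.isOpen_preimage_U i).preimage continuous_snd
    have h1 : ContMDiffOn ((𝓡 n).prod IP) (𝓡 n) ∞ (fun a : N × P => (e i).symm (B.fib i a.2 • a.1))
        (B.pullback f ∩ {a | B.proj a.2 ∈ B.U i}) := by
      refine (hsm' i).comp ((contMDiffOn_fib_smul i).mono inter_subset_right) fun a ha => ?_
      rw [he2, mem_preimage, mem_ofPred_eq, show f (_ • _) = _ from f.2 _ _, smul_mem_U_iff]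
      exact mem_pullback.1 ha.1 ▸ ha.2
    have h2 : ∀ a ∈ B.pullback f ∩ {a | B.proj a.2 ∈ B.U i},
        q a = (e i).symm (B.fib i a.2 • a.1) := fun a ha => by
      rw [hq a ha.1]
      exact (hsymm i ⟨a, ha.1⟩ (mem_pullback.1 ha.1 ▸ ha.2)).symm
    exact ((h1.congr h2) (x, y) ⟨ha, hi⟩).mono_of_mem_nhdsWithin
      (inter_mem_nhdsWithin _ (hO.mem_nhds hi))
  · refine eq_univ_of_forall fun c => ?_
    induction c using Quotient.inductionOn with
    | h a => exact ⟨a.1, a.2, hq _ a.2⟩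
  · intro a ha b hb
    rw [hq a ha, hq b hb]
    refine Iff.trans (Total.mk_eq_mk (a := ⟨a, ha⟩) (b := ⟨b, hb⟩)) ?_
    exact exists_congr fun g => Subtype.ext_iff
  · intro a ha r
    rw [hq a ha, hq _ (principal_mem_pullback ha r)]
    rfl
  · rintro ⟨x₀, y₀⟩ ha
    obtain ⟨i, hi⟩ := B.cover (f x₀)
    have hiy : B.proj y₀ ∈ B.U i := mem_pullback.1 ha ▸ hi
    set g := B.fib i y₀
    have hqe : e i (q (x₀, y₀)) = g • x₀ := by rw [hq _ ha]; exact he3 i ⟨_, ha⟩ hi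
    have hqs : q (x₀, y₀) ∈ (e i).source := by rw [hq _ ha]; exact (he1 i ⟨_, ha⟩).2 hi
    have hfe (c : B.Quot f) (hc : c ∈ (e i).source) : f (g⁻¹ • e i c) ∈ B.U i := by
      have h2 := (e i).map_source hc
      rw [he2, mem_ofPred_eq] at h2
      rw [show f (_ • _) = _ from f.2 _ _, smul_mem_U_iff]
      exact h2
    -- The local section with constant fibre coordinate `g`; taking `g` from `y₀` makes it pass
    -- through the given point.
    refine ⟨(e i).source, (e i).open_source, hqs,
      fun c => (g⁻¹ • e i c, B.triv i (f (g⁻¹ • e i c), g)), ?_, ?_, ?_⟩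
    · have h1 : ContMDiffOn (𝓡 n) (𝓡 n) ∞ (fun c => g⁻¹ • e i c) (e i).source :=
        (contMDiffOn_const (I' := 𝓡 d)).smul (hsm i)
      refine h1.prodMk ((B.contMDiffOn_triv i).comp
        ((ContMDiff.comp_contMDiffOn hf h1).prodMk contMDiffOn_const) fun c hc => ?_)
      exact ⟨hfe c hc, trivial⟩
    · change (g⁻¹ • e i (q (x₀, y₀)), B.triv i (f (g⁻¹ • e i (q (x₀, y₀))), g)) = (x₀, y₀)
      rw [hqe, inv_smul_smul, mem_pullback.1 ha, triv_fib hiy]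
    · intro c hc
      have hmem : (g⁻¹ • e i c, B.triv i (f (g⁻¹ • e i c), g)) ∈ B.pullback f :=
        mem_pullback.2 (B.proj_triv i _ (hfe c hc) g).symm
      refine ⟨hmem, (e i).injOn ?_ hc ?_⟩
      · rw [hq _ hmem]; exact (he1 i ⟨_, hmem⟩).2 (hfe c hc)
      · rw [hq _ hmem]
        refine (he3 i ⟨_, hmem⟩ (hfe c hc)).trans ?_
        change B.fib i (B.triv i (f (g⁻¹ • e i c), g)) • g⁻¹ • e i c = e i c
        rw [fib_triv (hfe c hc), smul_inv_smul]

end StarBundle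

/-! ### Isomorphisms of induced bundles -/

namespace StarBundle

variable {d m n : ℕ} {EP HP : Type*} [NormedAddCommGroup EP]
    [NormedSpace ℝ EP] [TopologicalSpace HP] {IP : ModelWithCorners ℝ EP HP} {G M N P : Type u}
    [Group G] [TopologicalSpace G] [ChartedSpace (EuclideanSpace ℝ (Fin d)) G]
    [TopologicalSpace M] [ChartedSpace (EuclideanSpace ℝ (Fin m)) M] [MulAction G M]
    [TopologicalSpace P] [ChartedSpace HP P] [MulAction (G × G) P]
    [TopologicalSpace N] [ChartedSpace (EuclideanSpace ℝ (Fin n)) N] [MulAction G N]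
    (B : StarBundle d m IP G M P)

variable (n) in
/-- `Θ` is a smooth `G × G`-equivariant map `f₀^*P → f₁^*P` over `N` which is the identity
over the complement of `K`. -/
structure IsStarHom (K : Set N) (f₀ f₁ : N → M) (Θ : N × P → N × P) : Prop where
  contMDiffOn : ContMDiffOn ((𝓡 n).prod IP) ((𝓡 n).prod IP) ∞ Θ (B.pullback f₀)
  mapsTo : MapsTo Θ (B.pullback f₀) (B.pullback f₁)
  fst_eq : ∀ a, (Θ a).1 = a.1
  map_smul : ∀ a ∈ B.pullback f₀, ∀ q r : G,
    Θ (q • a.1, (q, r) • a.2) = (q • (Θ a).1, (q, r) • (Θ a).2)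
  eq_self : ∀ a, a.1 ∉ K → Θ a = a

variable (n) in
/-- The induced bundles of `f₀` and `f₁` are isomorphic by an isomorphism which is the identity
over the complement of `K`. -/
def StarIsoOn (K : Set N) (f₀ f₁ : N → M) : Prop :=
  ∃ Θ Θ' : N × P → N × P, B.IsStarHom n K f₀ f₁ Θ ∧ B.IsStarHom n K f₁ f₀ Θ' ∧
    (∀ a ∈ B.pullback f₀, Θ' (Θ a) = a) ∧ ∀ a ∈ B.pullback f₁, Θ (Θ' a) = a

variable {B} {K : Set N} {f₀ f₁ f₂ : N → M}

theorem IsStarHom.id (f : N → M) : B.IsStarHom n K f f id :=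
  ⟨contMDiffOn_id, fun _ h => h, fun _ => rfl, fun _ _ _ _ => rfl, fun _ _ => rfl⟩

theorem IsStarHom.comp {Θ Ψ : N × P → N × P} (h : B.IsStarHom n K f₁ f₂ Ψ)
    (h' : B.IsStarHom n K f₀ f₁ Θ) : B.IsStarHom n K f₀ f₂ (Ψ ∘ Θ) where
  contMDiffOn := h.contMDiffOn.comp h'.contMDiffOn h'.mapsTo
  mapsTo := h.mapsTo.comp h'.mapsTo
  fst_eq a := (h.fst_eq _).trans (h'.fst_eq _)
  map_smul a ha q r := by
    change Ψ (Θ _) = _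
    rw [h'.map_smul a ha, h.map_smul _ (h'.mapsTo ha)]
    rfl
  eq_self a ha := by
    change Ψ (Θ a) = a
    rw [h'.eq_self a ha, h.eq_self a ha]

theorem IsStarHom.mono {Θ : N × P → N × P} {K' : Set N} (h : B.IsStarHom n K f₀ f₁ Θ)
    (hK : K ⊆ K') : B.IsStarHom n K' f₀ f₁ Θ :=
  ⟨h.1, h.2, h.3, h.4, fun a ha => h.5 a fun h' => ha (hK h')⟩

theorem StarIsoOn.refl (f : N → M) : B.StarIsoOn n K f f :=
  ⟨id, id, .id f, .id f, fun _ _ => rfl, fun _ _ => rfl⟩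

theorem StarIsoOn.trans (h : B.StarIsoOn n K f₀ f₁) (h' : B.StarIsoOn n K f₁ f₂) :
    B.StarIsoOn n K f₀ f₂ := by
  obtain ⟨Θ, Θ', h1, h2, h3, h4⟩ := h
  obtain ⟨Ψ, Ψ', k1, k2, k3, k4⟩ := h'
  refine ⟨Ψ ∘ Θ, Θ' ∘ Ψ', k1.comp h1, h2.comp k2, fun a ha => ?_, fun a ha => ?_⟩
  · change Θ' (Ψ' (Ψ (Θ a))) = a
    rw [k3 _ (h1.mapsTo ha), h3 a ha]
  · change Ψ (Θ (Θ' (Ψ' a))) = a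
    rw [h4 _ (k2.mapsTo ha), k4 a ha]

theorem StarIsoOn.mono {K' : Set N} (h : B.StarIsoOn n K f₀ f₁) (hK : K ⊆ K') :
    B.StarIsoOn n K' f₀ f₁ := by
  obtain ⟨Θ, Θ', h1, h2, h3, h4⟩ := h
  exact ⟨Θ, Θ', h1.mono hK, h2.mono hK, h3, h4⟩

open Classical in
/-- Transport along the fibre coordinate of a trivialization, over `K`. -/
noncomputable def fibTransport (B : StarBundle d m IP G M P) (i : B.ι) (K : Set N) (f₁ : N → M)
    (a : N × P) : N × P :=
  if a.1 ∈ K then (a.1, B.triv i (f₁ a.1, B.fib i a.2)) else a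

section Elementary

variable {i : B.ι} (hK : ∀ x ∈ K, f₀ x ∈ B.U i ∧ f₁ x ∈ B.U i) (hf : ∀ x ∉ K, f₀ x = f₁ x)

-- Off `K` the maps agree and the formula reduces to the identity. The map is thus given by one
-- smooth expression across the boundary of `K`.
omit [TopologicalSpace N] [MulAction G N] in
include hf in
theorem fibTransport_eq {a : N × P} (ha : a ∈ B.pullback f₀) (h0 : f₀ a.1 ∈ B.U i) :
    B.fibTransport i K f₁ a = (a.1, B.triv i (f₁ a.1, B.fib i a.2)) := by
  rw [fibTransport]
  split_ifs with h
  · rfl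
  · have h1 : B.proj a.2 = f₁ a.1 := (mem_pullback.1 ha).symm.trans (hf _ h)
    rw [← h1, triv_fib]
    rw [← mem_pullback.1 ha]
    exact h0

include hK hf in
theorem isStarHom_fibTransport (hKc : IsClosed K) (hs₀ : ContMDiff (𝓡 n) (𝓡 m) ∞ f₀)
    (hs₁ : ContMDiff (𝓡 n) (𝓡 m) ∞ f₁) (he₀ : ∀ (g : G) x, f₀ (g • x) = g • f₀ x)
    (he₁ : ∀ (g : G) x, f₁ (g • x) = g • f₁ x) :
    B.IsStarHom n K f₀ f₁ (B.fibTransport i K f₁) where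
  contMDiffOn := by
    intro a ha
    by_cases h : a.1 ∈ K
    · have hO : IsOpen {a : N × P | f₀ a.1 ∈ B.U i ∧ f₁ a.1 ∈ B.U i} :=
        ((B.isOpen_U i).preimage (hs₀.continuous.comp continuous_fst)).inter
          ((B.isOpen_U i).preimage (hs₁.continuous.comp continuous_fst))
      have h1 : ContMDiffOn ((𝓡 n).prod IP) ((𝓡 n).prod IP) ∞
          (fun a : N × P => (a.1, B.triv i (f₁ a.1, B.fib i a.2)))
          (B.pullback f₀ ∩ {a : N × P | f₀ a.1 ∈ B.U i ∧ f₁ a.1 ∈ B.U i}) := by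
        refine contMDiffOn_fst.prodMk ((B.contMDiffOn_triv i).comp
          ((hs₁.comp_contMDiffOn contMDiffOn_fst).prodMk
            ((B.contMDiffOn_fib i).comp contMDiffOn_snd fun a ha => ?_)) fun a ha => ?_)
        · have h2 := ha.2.1
          rw [mem_pullback.1 ha.1] at h2
          exact h2
        · exact ⟨ha.2.2, trivial⟩
      have h2 := h1.congr fun a ha => fibTransport_eq (K := K) hf ha.1 ha.2.1
      exact (h2 a ⟨ha, hK _ h⟩).mono_of_mem_nhdsWithin
        (inter_mem_nhdsWithin _ (hO.mem_nhds (hK _ h)))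
    · have hO : IsOpen {a : N × P | a.1 ∉ K} := hKc.isOpen_compl.preimage continuous_fst
      refine (contMDiffAt_id.congr_of_eventuallyEq ?_).contMDiffWithinAt
      filter_upwards [hO.mem_nhds h] with b hb
      exact if_neg hb
  mapsTo a ha := by
    rw [fibTransport, mem_pullback]
    split_ifs with h
    · exact (B.proj_triv i _ (hK _ h).2 _).symm
    · exact (hf _ h).symm.trans ha
  fst_eq a := by rw [fibTransport]; split_ifs <;> rfl
  map_smul a ha q r := by
    have hm : (q • a.1, (q, r) • a.2) ∈ B.pullback f₀ := by
      rw [mem_pullback, he₀, proj_smul, ← mem_pullback.1 ha]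
    -- `K` need not be invariant, but this condition is, and it holds on `K`.
    by_cases h0 : f₀ a.1 ∈ B.U i ∧ f₁ a.1 ∈ B.U i
    · have h0' : f₀ (q • a.1) ∈ B.U i := by rw [he₀, smul_mem_U_iff]; exact h0.1
      rw [fibTransport_eq hf hm h0', fibTransport_eq hf ha h0.1]
      refine Prod.ext rfl ?_
      change B.triv i (f₁ (q • a.1), B.fib i ((q, r) • a.2)) =
        (q, r) • B.triv i (f₁ a.1, B.fib i a.2)
      rw [B.smul_triv i _ h0.2, he₁, fib_smul]
      rw [← mem_pullback.1 ha]
      exact h0.1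
    · have h1 : a.1 ∉ K := fun h => h0 (hK _ h)
      have h2 : q • a.1 ∉ K := fun h => h0 (by
        have := hK _ h
        rwa [he₀, he₁, smul_mem_U_iff, smul_mem_U_iff] at this)
      rw [fibTransport, fibTransport, if_neg h1, if_neg h2]
  eq_self a ha := if_neg ha

omit [TopologicalSpace N] [MulAction G N] in
theorem fibTransport_fibTransport {a : N × P} (hK : ∀ x ∈ K, f₀ x ∈ B.U i ∧ f₁ x ∈ B.U i)
    (ha : a ∈ B.pullback f₀) : B.fibTransport i K f₀ (B.fibTransport i K f₁ a) = a := by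
  by_cases h : a.1 ∈ K
  · have h1 : B.fibTransport i K f₁ a = (a.1, B.triv i (f₁ a.1, B.fib i a.2)) := if_pos h
    rw [h1, fibTransport, if_pos h, fib_triv (hK _ h).2, mem_pullback.1 ha, triv_fib]
    rw [← mem_pullback.1 ha]
    exact (hK _ h).1
  · rw [show B.fibTransport i K f₁ a = a from if_neg h, fibTransport, if_neg h]

include hK hf in
theorem starIsoOn_of_trivialization (hKc : IsClosed K) (hs₀ : ContMDiff (𝓡 n) (𝓡 m) ∞ f₀)
    (hs₁ : ContMDiff (𝓡 n) (𝓡 m) ∞ f₁) (he₀ : ∀ (g : G) x, f₀ (g • x) = g • f₀ x)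
    (he₁ : ∀ (g : G) x, f₁ (g • x) = g • f₁ x) : B.StarIsoOn n K f₀ f₁ :=
  ⟨_, _, isStarHom_fibTransport hK hf hKc hs₀ hs₁ he₀ he₁,
    isStarHom_fibTransport (fun x hx => (hK x hx).symm) (fun x hx => (hf x hx).symm) hKc hs₁ hs₀
      he₁ he₀, fun _ ha => fibTransport_fibTransport hK ha,
    fun _ ha => fibTransport_fibTransport (fun x hx => (hK x hx).symm) ha⟩

end Elementary

/-- A locally finite infinite composition of isomorphisms of induced bundles. -/
theorem starIsoOn_of_locally_eventually_eq {K : ℕ → Set N} {f : ℕ → N → M} {f' : N → M}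
    (h : ∀ k, B.StarIsoOn n (K k) (f k) (f (k + 1)))
    (hloc : ∀ x, ∃ V ∈ 𝓝 x, ∃ k₀, ∀ k ≥ k₀, ∀ z ∈ V, z ∉ K k ∧ f k z = f' z) :
    B.StarIsoOn n univ (f 0) f' := by
  choose Θ Θ' h1 h2 h3 h4 using h
  choose V hV k₀ hk₀ using hloc
  -- `T k` composes the first `k` isomorphisms and `T' k` composes their inverses in the opposite
  -- order.
  let T : ℕ → N × P → N × P := fun k => Nat.rec id (fun k S => Θ k ∘ S) k
  let T' : ℕ → N × P → N × P := fun k => Nat.rec id (fun k S => S ∘ Θ' k) k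
  have hT (k : ℕ) : B.IsStarHom n univ (f 0) (f k) (T k) := by
    induction k with
    | zero => exact .id _
    | succ k ih => exact ((h1 k).mono (subset_univ _)).comp ih
  have hT' (k : ℕ) : B.IsStarHom n univ (f k) (f 0) (T' k) := by
    induction k with
    | zero => exact .id _
    | succ k ih => exact ih.comp ((h2 k).mono (subset_univ _))
  have hTT' (k : ℕ) : ∀ a ∈ B.pullback (f 0), T' k (T k a) = a := by
    induction k with
    | zero => exact fun _ _ => rfl
    | succ k ih =>
      intro a ha
      change T' k (Θ' k (Θ k (T k a))) = a
      rw [h3 k _ ((hT k).mapsTo ha), ih a ha]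
  have hT'T (k : ℕ) : ∀ a ∈ B.pullback (f k), T k (T' k a) = a := by
    induction k with
    | zero => exact fun _ _ => rfl
    | succ k ih =>
      intro a ha
      change Θ k (T k (T' k (Θ' k a))) = a
      rw [ih _ ((h2 k).mapsTo ha), h4 k a ha]
  have hst (x : N) (a : N × P) (ha : a.1 ∈ V x) (k : ℕ) (hk : k₀ x ≤ k) :
      T k a = T (k₀ x) a ∧ T' k a = T' (k₀ x) a := by
    induction k, hk using Nat.le_induction with
    | base => exact ⟨rfl, rfl⟩
    | succ k hk ih =>
      have hnot := (hk₀ x k hk _ ha).1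
      refine ⟨?_, ?_⟩
      · change Θ k (T k a) = _
        rw [(h1 k).eq_self _ (by rw [(hT k).fst_eq]; exact hnot), ih.1]
      · change T' k (Θ' k a) = _
        rw [(h2 k).eq_self _ hnot, ih.2]
  -- Over each point only finitely many factors act, so the composites are eventually constant, and
  -- `S` is their stable value.
  let S : N × P → N × P := fun a => T (k₀ a.1) a
  let S' : N × P → N × P := fun a => T' (k₀ a.1) a
  have hS (x : N) (a : N × P) (ha : a.1 ∈ V x) (k : ℕ) (hk : k₀ x ≤ k) :
      S a = T k a ∧ S' a = T' k a := by
    have e1 := hst x a ha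
    have e2 := hst a.1 a (mem_of_mem_nhds (hV a.1))
    constructor
    · rw [(e1 k hk).1, ← (e1 _ (le_max_left _ (k₀ a.1))).1, (e2 _ (le_max_right _ _)).1]
    · rw [(e1 k hk).2, ← (e1 _ (le_max_left _ (k₀ a.1))).2, (e2 _ (le_max_right _ _)).2]
  have hS0 (a : N × P) (k : ℕ) (hk : k₀ a.1 ≤ k) := hS a.1 a (mem_of_mem_nhds (hV a.1)) k hk
  have hf (x : N) (k : ℕ) (hk : k₀ x ≤ k) : f k x = f' x :=
    (hk₀ x k hk x (mem_of_mem_nhds (hV x))).2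
  have hnear (x : N) (y : P) : {a : N × P | a.1 ∈ V x} ∈ 𝓝 (x, y) :=
    continuous_fst.continuousAt.preimage_mem_nhds (hV x)
  refine ⟨S, S', ⟨?_, ?_, ?_, ?_, fun a ha => absurd (mem_univ _) ha⟩,
    ⟨?_, ?_, ?_, ?_, fun a ha => absurd (mem_univ _) ha⟩, ?_, ?_⟩
  · rintro ⟨x, y⟩ ha
    refine ((hT (k₀ x)).contMDiffOn (x, y) ha).congr_of_eventuallyEq ?_ (hS0 (x, y) _ le_rfl).1
    filter_upwards [mem_nhdsWithin_of_mem_nhds (hnear x y)] with b hb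
    exact (hS x b hb _ le_rfl).1
  · intro a ha
    have e := (hT (k₀ a.1)).mapsTo ha
    rw [mem_pullback, (hT _).fst_eq] at e
    rw [(hS0 a _ le_rfl).1, mem_pullback, (hT _).fst_eq, ← hf _ _ le_rfl]
    exact e
  · exact fun a => (hT _).fst_eq a
  · intro a ha q r
    -- One index that is stable for both the point and its translate.
    rw [(hS0 a _ (le_max_left _ (k₀ (q • a.1)))).1,
      (hS0 (q • a.1, (q, r) • a.2) _ (le_max_right (k₀ a.1) _)).1]
    exact (hT _).map_smul a ha q r
  · rintro ⟨x, y⟩ ha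
    have e1 : ∀ b ∈ B.pullback f' ∩ {a : N × P | a.1 ∈ V x}, b ∈ B.pullback (f (k₀ x)) := by
      rintro b ⟨hb, hbx⟩
      rw [mem_pullback, (hk₀ x _ le_rfl _ hbx).2]
      exact hb
    have e2 := (((hT' (k₀ x)).contMDiffOn.mono e1).congr
      fun b hb => (hS x b hb.2 _ le_rfl).2) (x, y) ⟨ha, mem_of_mem_nhds (hnear x y)⟩
    exact e2.mono_of_mem_nhdsWithin (inter_mem_nhdsWithin _ (hnear x y))
  · intro a ha
    have e : a ∈ B.pullback (f (k₀ a.1)) := by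
      rw [mem_pullback, hf _ _ le_rfl]; exact ha
    exact (hT' _).mapsTo e
  · exact fun a => (hT' _).fst_eq a
  · intro a ha q r
    rw [(hS0 a _ (le_max_left _ (k₀ (q • a.1)))).2,
      (hS0 (q • a.1, (q, r) • a.2) _ (le_max_right (k₀ a.1) _)).2]
    refine (hT' _).map_smul a ?_ q r
    rw [mem_pullback, hf _ _ (le_max_left _ _)]
    exact ha
  · intro a ha
    rw [(hS0 (S a) (k₀ a.1) (by rw [show (S a).1 = a.1 from (hT _).fst_eq a])).2]
    exact hTT' _ a ha
  · intro a ha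
    rw [(hS0 (S' a) (k₀ a.1) (by rw [show (S' a).1 = a.1 from (hT' _).fst_eq a])).1]
    refine hT'T _ a ?_
    rw [mem_pullback, hf _ _ le_rfl]
    exact ha

/-! ### Descent to the quotients -/

section Quotient

variable {f f' : EqMap G N M} {X X' : SmoothGManifold d G}

/-- Equivariance makes `q' ∘ Θ` constant on the `⋆`-orbits, so it descends. The descended map is
smooth because locally it is `q' ∘ Θ ∘ s` for a smooth section `s` of `q`. -/
theorem IsStarHom.exists_quotient_map {Θ : N × P → N × P} (hΘ : B.IsStarHom n K f f' Θ)
    {q : N × P → X.carrier} {q' : N × P → X'.carrier}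
    (hs : q '' B.pullback f = univ)
    (ho : ∀ a ∈ B.pullback f, ∀ b ∈ B.pullback f,
      q a = q b ↔ ∃ g : G, b = (g • a.1, (g, (1 : G)) • a.2))
    (hp : ∀ a ∈ B.pullback f, ∀ r : G, q (a.1, ((1 : G), r) • a.2) = r • q a)
    (hl : ∀ a ∈ B.pullback f, ∃ V : Set X.carrier, IsOpen V ∧ q a ∈ V ∧
      ∃ s : X.carrier → N × P, ContMDiffOn (𝓡 X.dim) ((𝓡 n).prod IP) ∞ s V ∧ s (q a) = a ∧
      ∀ y ∈ V, s y ∈ B.pullback f ∧ q (s y) = y)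
    (hq' : ContMDiffOn ((𝓡 n).prod IP) (𝓡 X'.dim) ∞ q' (B.pullback f'))
    (ho' : ∀ a ∈ B.pullback f', ∀ b ∈ B.pullback f',
      q' a = q' b ↔ ∃ g : G, b = (g • a.1, (g, (1 : G)) • a.2))
    (hp' : ∀ a ∈ B.pullback f', ∀ r : G, q' (a.1, ((1 : G), r) • a.2) = r • q' a) :
    ∃ h : X.carrier → X'.carrier, ContMDiff (𝓡 X.dim) (𝓡 X'.dim) ∞ h ∧
      (∀ a ∈ B.pullback f, h (q a) = q' (Θ a)) ∧ ∀ (r : G) c, h (r • c) = r • h c := by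
  have hs' (c : X.carrier) : ∃ a ∈ B.pullback f, q a = c := by
    have : c ∈ q '' B.pullback f := hs ▸ mem_univ c
    exact this
  choose σ hσ hσq using hs'
  have key (a) (ha : a ∈ B.pullback f) : q' (Θ (σ (q a))) = q' (Θ a) := by
    obtain ⟨g, hg⟩ := (ho a ha _ (hσ (q a))).1 (hσq (q a)).symm
    refine ((ho' _ (hΘ.mapsTo ha) _ (hΘ.mapsTo (hσ _))).2 ⟨g, ?_⟩).symm
    rw [hg]
    exact hΘ.map_smul a ha g 1
  refine ⟨fun c => q' (Θ (σ c)), fun c => ?_, key, fun r c => ?_⟩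
  · obtain ⟨V, hV, hcV, s, hsm, -, hs2⟩ := hl _ (hσ c)
    rw [hσq] at hcV
    have h1 := (hq'.comp hΘ.contMDiffOn hΘ.mapsTo).comp hsm fun y hy => (hs2 y hy).1
    refine (h1.congr fun y hy => ?_).contMDiffAt (hV.mem_nhds hcV)
    have h2 := key (s y) (hs2 y hy).1
    rw [(hs2 y hy).2] at h2
    exact h2
  · have h1 := hp _ (hσ c) r
    rw [hσq] at h1
    have h2 := key _ (principal_mem_pullback (hσ c) r)
    have h3 := hΘ.map_smul _ (hσ c) 1 r
    rw [one_smul, one_smul] at h3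
    rw [h1, h3] at h2
    change q' (Θ (σ (r • c))) = _
    rw [h2]
    exact hp' _ (hΘ.mapsTo (hσ c)) r

theorem StarIsoOn.nonempty_eqDiffeo (h : B.StarIsoOn n K f f') (hX : B.IsStarQuotient n f X)
    (hX' : B.IsStarQuotient n f' X') :
    Nonempty (EqDiffeo G X.dim X'.dim X.carrier X'.carrier) := by
  obtain ⟨Θ, Θ', h1, h2, h3, h4⟩ := h
  obtain ⟨q, a1, a2, a3, a4, a5⟩ := hX
  obtain ⟨q', b1, b2, b3, b4, b5⟩ := hX'
  obtain ⟨φ, c1, c2, c3⟩ := h1.exists_quotient_map a2 a3 a4 a5 b1 b3 b4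
  obtain ⟨ψ, d1, d2, -⟩ := h2.exists_quotient_map b2 b3 b4 b5 a1 a3 a4
  refine ⟨⟨⟨⟨φ, ψ, fun c => ?_, fun c => ?_⟩, c1, d1⟩, c3⟩⟩
  · have : c ∈ q '' B.pullback f := a2 ▸ mem_univ c
    obtain ⟨a, ha, rfl⟩ := this
    rw [c2 a ha, d2 _ (h1.mapsTo ha), h3 a ha]
  · have : c ∈ q' '' B.pullback f' := b2 ▸ mem_univ c
    obtain ⟨a, ha, rfl⟩ := this
    rw [d2 a ha, c2 _ (h2.mapsTo ha), h4 a ha]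

theorem IsStarQuotient.of_eqDiffeo (hX : B.IsStarQuotient n f X)
    (φ : EqDiffeo G X.dim X'.dim X.carrier X'.carrier) : B.IsStarQuotient n f X' := by
  obtain ⟨q, a1, a2, a3, a4, a5⟩ := hX
  refine ⟨fun a => φ.toDiffeo (q a), φ.toDiffeo.contMDiff.comp_contMDiffOn a1, ?_, ?_, ?_, ?_⟩
  · rw [← Function.comp_def, image_comp, a2, image_univ]
    exact φ.toDiffeo.surjective.range_eq
  · intro a ha b hb
    exact φ.toDiffeo.injective.eq_iff.trans (a3 a ha b hb)
  · intro a ha r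
    exact (congrArg φ.toDiffeo (a4 a ha r)).trans (φ.map_smul r _)
  · intro a ha
    obtain ⟨V, hV, haV, s, s1, s2, s3⟩ := a5 a ha
    refine ⟨φ.toDiffeo.symm ⁻¹' V, hV.preimage φ.toDiffeo.symm.continuous, ?_,
      fun c => s (φ.toDiffeo.symm c), ?_, ?_, fun c hc => ⟨(s3 _ hc).1, ?_⟩⟩
    · rw [mem_preimage, Diffeomorph.symm_apply_apply]
      exact haV
    · exact s1.comp φ.toDiffeo.symm.contMDiff.contMDiffOn fun c hc => hc
    · exact (congrArg s (φ.toDiffeo.symm_apply_apply _)).trans s2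
    · exact (congrArg φ.toDiffeo (s3 _ hc).2).trans (φ.toDiffeo.apply_symm_apply c)

end Quotient

end StarBundle

/-! ### Invariant cutoff functions -/

section BumpCover
open MeasureTheory Function

variable {d n : ℕ} {G N : Type*} [Group G] [TopologicalSpace G] [IsTopologicalGroup G]
  [CompactSpace G] [T2Space G] [ChartedSpace (EuclideanSpace ℝ (Fin d)) G] [LieGroup (𝓡 d) ∞ G]
  [TopologicalSpace N] [T2Space N] [SecondCountableTopology N]
  [ChartedSpace (EuclideanSpace ℝ (Fin n)) N] [IsManifold (𝓡 n) ∞ N]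
  [MulAction G N] [ContMDiffSMul (𝓡 d) (𝓡 n) ∞ G N]

include d n in
omit [T2Space G] [T2Space N] [SecondCountableTopology N] in
/-- An invariant cutoff function which is `1` where `ψ` is. -/
theorem exists_invariant_cutoff {ψ : N → ℝ} (hψ : ContMDiff (𝓡 n) 𝓘(ℝ, ℝ) ∞ ψ) (h0 : ∀ x, 0 ≤ ψ x)
    (hc : HasCompactSupport ψ) : ∃ u : N → ℝ, ContMDiff (𝓡 n) 𝓘(ℝ, ℝ) ∞ u ∧
      (∀ (g : G) x, u (g • x) = u x) ∧ (∀ x, 0 ≤ u x) ∧ (∀ x, u x ≤ 1) ∧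
      (∀ x, ψ x = 1 → u x = 1) ∧ ∀ x ∈ tsupport u, ∃ g : G, g • x ∈ tsupport ψ := by
  have : ContinuousSMul G N := ⟨(contMDiff_smul (I := 𝓡 d) (I' := 𝓡 n) (n := ∞)).continuous⟩
  borelize G
  let μ : Measure G := Measure.haarMeasure ⊤
  have : IsProbabilityMeasure μ := ⟨Measure.haarMeasure_self (G := G) (K₀ := ⊤)⟩
  let A : N → ℝ := fun x => orbitAverage (G := G) μ (fun x (_ : N) => ψ x) x x
  have hA : ContMDiff (𝓡 n) 𝓘(ℝ, ℝ) ∞ A :=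
    (orbitAverage_contMDiff (d := d) μ (F := fun x (_ : N) => ψ x)
      (hψ.comp contMDiff_fst)).comp (contMDiff_id.prodMk contMDiff_id)
  have hcont (x : N) : Continuous fun g : G => ψ (g⁻¹ • x) :=
    hψ.continuous.comp (continuous_inv.smul continuous_const)
  have hpos (x : N) (hx : ψ x = 1) : 0 < A x := by
    refine (hcont x).integral_pos_of_hasCompactSupport_nonneg_nonzero
      (HasCompactSupport.of_compactSpace _) (fun g => h0 _) (x := 1) ?_
    simp [hx]
  have hK : IsCompact (tsupport ψ ∩ {x | ψ x = 1}) :=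
    hc.isCompact.inter_right (isClosed_eq hψ.continuous continuous_const)
  -- The average is positive where `ψ = 1`, and this set is compact. Rescaling by `ε` before
  -- applying the smooth transition makes the cutoff equal to `1` there.
  obtain ⟨ε, hε, hεA⟩ : ∃ ε > 0, ∀ x, ψ x = 1 → ε ≤ A x := by
    rcases (tsupport ψ ∩ {x | ψ x = 1}).eq_empty_or_nonempty with h | h
    · refine ⟨1, one_pos, fun x hx => ?_⟩
      have : x ∈ tsupport ψ ∩ {x | ψ x = 1} :=
        ⟨subset_tsupport ψ (by simp [hx]), hx⟩
      rw [h] at this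
      exact this.elim
    · obtain ⟨z, hz, hmin⟩ := hK.exists_isMinOn h hA.continuous.continuousOn
      exact ⟨A z, hpos z hz.2, fun x hx => hmin ⟨subset_tsupport ψ (by simp [hx]), hx⟩⟩
  refine ⟨fun x => Real.smoothTransition (A x / ε), ?_, fun g x => ?_, fun x => ?_, fun x => ?_,
    fun x hx => ?_, ?_⟩
  · exact (Real.smoothTransition.contDiff.contMDiff).comp
      ((contDiff_id.div_const ε).contMDiff.comp hA)
  · have : A (g • x) = A x := orbitAverage_smul μ _ g x x
    simp only [this]
  · exact Real.smoothTransition.nonneg _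
  · exact Real.smoothTransition.le_one _
  · exact Real.smoothTransition.one_of_one_le ((one_le_div hε).2 (hεA x hx))
  -- The saturation of the support is closed because `G` is compact.
  · have hcl : IsClosed {x : N | ∃ g : G, g • x ∈ tsupport ψ} := by
      have h1 : {x : N | ∃ g : G, g • x ∈ tsupport ψ} =
          Prod.snd '' {p : G × N | p.1 • p.2 ∈ tsupport ψ} := by
        ext x; simp
      rw [h1]
      exact isClosedMap_snd_of_compactSpace _ ((isClosed_tsupport ψ).preimage continuous_smul)
    refine fun x hx => closure_minimal (fun y hy => ?_) hcl hx
    by_contra hne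
    refine hy ?_
    have : A y = 0 := by
      refine integral_eq_zero_of_ae (Filter.Eventually.of_forall fun g => ?_)
      by_contra h
      exact hne ⟨g⁻¹, subset_tsupport ψ h⟩
    simp only [this, zero_div]
    exact Real.smoothTransition.zero

-- Replace an ordinary bump covering by invariant cutoffs. Local finiteness survives because the
-- saturation of a compact set is compact and so meets finitely many of the original supports.
include d n in
theorem exists_invariant_bumpCover (G : Type*) [Group G] [TopologicalSpace G]
    [IsTopologicalGroup G] [CompactSpace G] [T2Space G] [ChartedSpace (EuclideanSpace ℝ (Fin d)) G]
    [LieGroup (𝓡 d) ∞ G] [MulAction G N] [ContMDiffSMul (𝓡 d) (𝓡 n) ∞ G N]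
    {V : N → Set N} (hV : ∀ x, V x ∈ 𝓝 x) (hinv : ∀ x, ∀ (g : G), ∀ z, g • z ∈ V x → z ∈ V x) :
    ∃ u : ℕ → N → ℝ, (∀ k, ContMDiff (𝓡 n) 𝓘(ℝ, ℝ) ∞ (u k)) ∧
      (∀ k (g : G) x, u k (g • x) = u k x) ∧ (∀ k x, 0 ≤ u k x) ∧ (∀ k x, u k x ≤ 1) ∧
      (∀ k, tsupport (u k) = ∅ ∨ ∃ x, tsupport (u k) ⊆ V x) ∧
      LocallyFinite (fun k => tsupport (u k)) ∧ ∀ x, ∃ k, u k x = 1 := by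
  classical
  have : ContinuousSMul G N := ⟨(contMDiff_smul (I := 𝓡 d) (I' := 𝓡 n) (n := ∞)).continuous⟩
  have hlc : LocallyCompactSpace N := ChartedSpace.locallyCompactSpace (EuclideanSpace ℝ (Fin n)) N
  obtain ⟨ι, b, hb⟩ := SmoothBumpCovering.exists_isSubordinate (𝓡 n) (s := (univ : Set N))
    isClosed_univ fun x _ => hV x
  have hcount : Countable ι :=
    countable_univ_iff.1 (b.locallyFinite.countable_univ fun i => (b i).nonempty_support)
  obtain ⟨e, he⟩ := exists_injective_nat ι
  choose u h1 h2 h3 h4 h5 h6 using fun i => exists_invariant_cutoff (d := d) (n := n) (G := G)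
    (b i).contMDiff (fun x => (b i).nonneg) (b i).hasCompactSupport
  have hlf : LocallyFinite fun i => tsupport (u i) := by
    intro x
    obtain ⟨C, hC, hCx⟩ := exists_compact_mem_nhds x
    refine ⟨C, hCx, ?_⟩
    have hGC : IsCompact ((fun p : G × N => p.1 • p.2) '' univ ×ˢ C) :=
      (isCompact_univ.prod hC).image continuous_smul
    refine (b.locallyFinite.closure.finite_nonempty_inter_compact hGC).subset ?_
    rintro i ⟨z, hz, hzC⟩
    obtain ⟨g, hg⟩ := h6 i z hz
    exact ⟨g • z, hg, (g, z), ⟨trivial, hzC⟩, rfl⟩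
  -- Unused indices carry the zero function; this is why an empty support is allowed.
  let w : ℕ → N → ℝ := fun k => if h : ∃ i, e i = k then u h.choose else 0
  have hw (k : ℕ) : (∃ i, e i = k ∧ w k = u i) ∨ (∀ i, e i ≠ k) ∧ w k = 0 := by
    by_cases h : ∃ i, e i = k
    · exact .inl ⟨h.choose, h.choose_spec, dif_pos h⟩
    · exact .inr ⟨fun i hi => h ⟨i, hi⟩, dif_neg h⟩
  have hts : tsupport (0 : N → ℝ) = ∅ := by simp [tsupport]
  refine ⟨w, fun k => ?_, fun k g x => ?_, fun k x => ?_, fun k x => ?_, fun k => ?_, ?_,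
    fun x => ?_⟩
  · rcases hw k with ⟨i, -, h⟩ | ⟨-, h⟩ <;> rw [h]
    · exact h1 i
    · exact contMDiff_const
  · rcases hw k with ⟨i, -, h⟩ | ⟨-, h⟩ <;> rw [h]
    · exact h2 i g x
    · rfl
  · rcases hw k with ⟨i, -, h⟩ | ⟨-, h⟩ <;> rw [h]
    · exact h3 i x
    · exact le_rfl
  · rcases hw k with ⟨i, -, h⟩ | ⟨-, h⟩ <;> rw [h]
    · exact h4 i x
    · exact zero_le_one
  · rcases hw k with ⟨i, -, h⟩ | ⟨-, h⟩ <;> rw [h]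
    · refine .inr ⟨b.c i, fun z hz => ?_⟩
      obtain ⟨g, hg⟩ := h6 i z hz
      exact hinv _ g z (hb i hg)
    · exact .inl hts
  · intro x
    obtain ⟨C, hC, hfin⟩ := hlf x
    refine ⟨C, hC, (hfin.image e).subset ?_⟩
    rintro k ⟨z, hz, hzC⟩
    have hz' : z ∈ tsupport (w k) := hz
    rcases hw k with ⟨i, hi, h⟩ | ⟨-, h⟩ <;> rw [h] at hz'
    · exact ⟨i, ⟨z, hz', hzC⟩, hi⟩
    · rw [hts] at hz'
      exact hz'.elim
  · obtain ⟨i, hi⟩ := b.eventuallyEq_one' x trivial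
    refine ⟨e i, ?_⟩
    rcases hw (e i) with ⟨j, hj, h⟩ | ⟨h, -⟩
    · rw [h, he hj]
      exact h5 i x hi.eq_of_nhds
    · exact absurd rfl (h i)

end BumpCover

/-! ### Homotopic maps induce isomorphic bundles -/

namespace StarBundle

variable {d m n : ℕ} {EP HP : Type*} [NormedAddCommGroup EP]
    [NormedSpace ℝ EP] [TopologicalSpace HP] {IP : ModelWithCorners ℝ EP HP} {G M N P : Type u}
    [Group G] [TopologicalSpace G] [ChartedSpace (EuclideanSpace ℝ (Fin d)) G]
    [TopologicalSpace M] [ChartedSpace (EuclideanSpace ℝ (Fin m)) M] [MulAction G M]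
    [TopologicalSpace P] [ChartedSpace HP P] [MulAction (G × G) P]
    [TopologicalSpace N] [ChartedSpace (EuclideanSpace ℝ (Fin n)) N] [MulAction G N]
    {B : StarBundle d m IP G M P}

variable {F : ℝ → N → M}
    (hF : ContMDiff (𝓘(ℝ, ℝ).prod (𝓡 n)) (𝓡 m) ∞ (fun p : ℝ × N => F p.1 p.2))
    (hFG : ∀ t (g : G) x, F t (g • x) = g • F t x)

/-- The points whose tracks are covered by the sets `U (i l)`, in steps of length `1 / k`. -/
def trackSet (B : StarBundle d m IP G M P) (F : ℝ → N → M) (k : ℕ) (i : ℕ → B.ι) : Set N :=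
  {x | ∀ l < k, ∀ t ∈ Icc ((l - 1 : ℝ) / k) ((l + 3 : ℝ) / k), F t x ∈ B.U (i l)}

omit [TopologicalSpace N] in
include hFG in
theorem smul_mem_trackSet {k : ℕ} {i : ℕ → B.ι} {g : G} {x : N} :
    g • x ∈ B.trackSet F k i ↔ x ∈ B.trackSet F k i := by
  simp only [trackSet, mem_ofPred_eq, hFG, smul_mem_U_iff]

omit [MulAction G N] in
include hF in
theorem exists_trackSet_mem_nhds (x : N) :
    ∃ (k : ℕ) (i : ℕ → B.ι), 0 < k ∧ B.trackSet F k i ∈ 𝓝 x := by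
  have hc : Continuous fun t : ℝ => F t x :=
    hF.continuous.comp (continuous_id.prodMk continuous_const)
  obtain ⟨δ, hδ, hδU⟩ := lebesgue_number_lemma_of_metric (isCompact_Icc (a := (0 : ℝ)) (b := 2))
    (c := fun i => {t | F t x ∈ B.U i}) (fun i => (B.isOpen_U i).preimage hc)
    (fun t _ => mem_iUnion.2 (B.cover (F t x)))
  obtain ⟨k, hk⟩ := exists_nat_gt (2 / δ)
  have hk0 : (0 : ℝ) < k := (div_pos two_pos hδ).trans hk
  have hk0' : 0 < k := by exact_mod_cast hk0
  have h1 (l : ℕ) : ∃ i, l < k → ∀ t ∈ Icc ((l - 1 : ℝ) / k) ((l + 3 : ℝ) / k), F t x ∈ B.U i := by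
    by_cases hl : l < k
    · have hlk : (l : ℝ) + 1 ≤ k := by exact_mod_cast hl
      -- The interval has centre `(l + 1) / k` and radius `2 / k`, which is less than the Lebesgue
      -- number `δ`.
      obtain ⟨i, hi⟩ := hδU ((l + 1 : ℝ) / k) ⟨by positivity, by
        rw [div_le_iff₀ hk0]; linarith⟩
      refine ⟨i, fun _ t ht => hi ?_⟩
      rw [Metric.mem_ball, Real.dist_eq]
      have h2 : 2 / (k : ℝ) < δ := by
        rw [div_lt_iff₀ hk0]
        rwa [div_lt_iff₀ hδ, mul_comm] at hk
      refine lt_of_le_of_lt ?_ h2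
      rw [abs_le]
      have e1 : ((l - 1 : ℝ) / k) = (l + 1 : ℝ) / k - 2 / k := by ring
      have e2 : ((l + 3 : ℝ) / k) = (l + 1 : ℝ) / k + 2 / k := by ring
      rw [e1, e2] at ht
      exact ⟨by linarith [ht.1], by linarith [ht.2]⟩
    · obtain ⟨i, -⟩ := B.cover (F 0 x)
      exact ⟨i, fun h => absurd h hl⟩
  choose i hi using h1
  refine ⟨k, i, hk0', ?_⟩
  have h2 : ∀ l ∈ Finset.range k, ∀ᶠ z in 𝓝 x,
      ∀ t ∈ Icc ((l - 1 : ℝ) / k) ((l + 3 : ℝ) / k), F t z ∈ B.U (i l) := by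
    intro l hl
    refine isCompact_Icc.eventually_forall_of_forall_eventually fun t ht => ?_
    have h3 : Continuous fun p : N × ℝ => F p.2 p.1 := hF.continuous.comp continuous_swap
    exact h3.continuousAt.eventually ((B.isOpen_U (i l)).mem_nhds (hi l (Finset.mem_range.1 hl) t ht))
  filter_upwards [(Filter.eventually_all_finset _).2 h2] with z hz l hl
  exact hz l (Finset.mem_range.2 hl)

variable (n) in
/-- Smooth invariant real functions. -/
structure IsTime (G : Type*) {N : Type*} [TopologicalSpace N]
    [ChartedSpace (EuclideanSpace ℝ (Fin n)) N] [SMul G N] (s : N → ℝ) : Prop where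
  contMDiff : ContMDiff (𝓡 n) 𝓘(ℝ, ℝ) ∞ s
  map_smul : ∀ (g : G) x, s (g • x) = s x

include hF hFG in
/-- Advancing time inside a set over which the tracks are covered by finitely many
trivializations. -/
theorem exists_advance {k : ℕ} {i : ℕ → B.ι} (hk : 0 < k) {u : N → ℝ} (hu : IsTime n G u)
    (hu0 : ∀ x, 0 ≤ u x) (hu1 : ∀ x, u x ≤ 1) (hts : tsupport u ⊆ B.trackSet F k i)
    {s : N → ℝ} (hs : IsTime n G s) :
    ∃ s' : N → ℝ, IsTime n G s' ∧ (∀ x, s x ≤ s' x) ∧ (∀ x ∉ tsupport u, s' x = s x) ∧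
      (∀ x, u x = 1 → 0 ≤ s x → 1 ≤ s' x) ∧
      B.StarIsoOn n (tsupport u) (fun x => F (s x) x) (fun x => F (s' x) x) := by
  have hk0 : (0 : ℝ) < k := by exact_mod_cast hk
  -- A bump equal to `1` on `[0, 1]` and to `0` outside `(-1, 2)`.
  let c : ContDiffBump (1 / 2 : ℝ) := ⟨1 / 2, 3 / 2, by norm_num, by norm_num⟩
  have hsm (t : N → ℝ) (ht : IsTime n G t) : ContMDiff (𝓡 n) (𝓡 m) ∞ fun x => F (t x) x :=
    hF.comp (ht.contMDiff.prodMk contMDiff_id)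
  have heq (t : N → ℝ) (ht : IsTime n G t) (g : G) (x : N) :
      F (t (g • x)) (g • x) = g • F (t x) x := by rw [ht.map_smul, hFG]
  suffices H : ∀ l ≤ k, ∃ s' : N → ℝ, IsTime n G s' ∧ (∀ x, s x ≤ s' x) ∧
      (∀ x ∉ tsupport u, s' x = s x) ∧ (∀ x, u x = 1 → 0 ≤ s x → (l : ℝ) / k ≤ s' x) ∧
      B.StarIsoOn n (tsupport u) (fun x => F (s x) x) (fun x => F (s' x) x) by
    simpa only [div_self hk0.ne'] using H k le_rfl
  intro l
  induction l with
  | zero => exact fun _ => ⟨s, hs, fun _ => le_rfl, fun _ _ => rfl, by simp, .refl _⟩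
  | succ l ih =>
    intro hl
    obtain ⟨t, ht, h1, h2, h3, h4⟩ := ih (by omega)
    -- Only times in the window from `(l - 1) / k` to `(l + 2) / k` change, and by at most `1 / k`.
    -- Old and new times thus lie in the interval up to `(l + 3) / k` that `trackSet` assigns to `U
    -- (i l)`.
    let t' : N → ℝ := fun x => t x + u x * (c (k * t x - l) / k)
    have hc0 (x : N) : 0 ≤ c (k * t x - l) / k := div_nonneg c.nonneg hk0.le
    have ht' : IsTime n G t' := by
      refine ⟨?_, fun g x => by simp only [t', ht.map_smul, hu.map_smul]⟩
      have e1 : ContDiff ℝ ∞ fun r : ℝ => c (k * r - l) / k :=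
        (c.contDiff.comp ((contDiff_const.mul contDiff_id).sub contDiff_const)).div_const _
      exact ht.contMDiff.add (hu.contMDiff.mul (e1.contMDiff.comp ht.contMDiff))
    have hle (x : N) : t x ≤ t' x := le_add_of_nonneg_right (mul_nonneg (hu0 x) (hc0 x))
    have hle' (x : N) : t' x ≤ t x + 1 / k := by
      refine add_le_add_right ?_ _
      have e1 : c (k * t x - l) / k ≤ 1 / k := div_le_div_of_nonneg_right c.le_one hk0.le
      calc u x * (c (k * t x - l) / k) ≤ 1 * (1 / k) :=
            mul_le_mul (hu1 x) e1 (hc0 x) zero_le_one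
        _ = 1 / k := one_mul _
    have hoff (x : N) (hx : x ∉ tsupport u) : t' x = t x := by
      simp [t', image_eq_zero_of_notMem_tsupport hx]
    refine ⟨t', ht', fun x => (h1 x).trans (hle x), fun x hx => (hoff x hx).trans (h2 x hx),
      fun x hx hx0 => ?_, h4.trans ?_⟩
    · have e1 := h3 x hx hx0
      rw [div_le_iff₀ hk0] at e1 ⊢
      push_cast
      -- By induction `k * t x - l` is nonnegative. Up to `1` the bump equals `1` and time advances
      -- by a full `1 / k`; beyond `1` the goal is already reached.
      rcases le_total (k * t x - l) 1 with e2 | e2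
      · have e3 : c (k * t x - l) = 1 := c.one_of_mem_closedBall (by
          rw [Metric.mem_closedBall, Real.dist_eq, abs_le]
          change _ ≤ _ ∧ _ ≤ (1 / 2 : ℝ)
          exact ⟨by change -(1 / 2 : ℝ) ≤ _; linarith, by linarith⟩)
        have e4 : t' x * k = t x * k + 1 := by
          simp only [t', e3, hx]
          field_simp
        linarith
      · have := mul_le_mul_of_nonneg_right (hle x) hk0.le
        linarith
    · let K : Set N := tsupport u ∩ t ⁻¹' Icc ((l - 1 : ℝ) / k) ((l + 2 : ℝ) / k)
      have hK : IsClosed K := (isClosed_tsupport u).inter (isClosed_Icc.preimage ht.contMDiff.continuous)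
      refine StarIsoOn.mono (K := K) (starIsoOn_of_trivialization (i := i l) ?_ ?_ hK (hsm t ht)
        (hsm t' ht') (heq t ht) (heq t' ht')) inter_subset_left
      · rintro x ⟨hx, hxt⟩
        have e1 := hts hx l (by omega)
        have e2 : ((l + 3 : ℝ) / k) = (l + 2 : ℝ) / k + 1 / k := by ring
        have e3 : (0 : ℝ) ≤ 1 / k := by positivity
        exact ⟨e1 _ ⟨hxt.1, by linarith [hxt.2]⟩,
          e1 _ ⟨hxt.1.trans (hle x), by linarith [hle' x, hxt.2]⟩⟩
      · intro x hx
        have : t' x = t x := by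
          by_cases hxu : x ∈ tsupport u
          · have e1 : c (k * t x - l) = 0 := by
              refine c.zero_of_le_dist ?_
              change (3 / 2 : ℝ) ≤ _
              rw [Real.dist_eq, le_abs]
              by_contra hne
              push Not at hne
              refine hx ⟨hxu, ?_, ?_⟩
              · rw [div_le_iff₀ hk0]; linarith
              · rw [le_div_iff₀ hk0]; linarith
            simp [t', e1]
          · exact hoff x hxu
        simp only [this]

include hF hFG in
/-- The bundles induced by the two ends of a smooth equivariant homotopy are isomorphic. -/
theorem starIsoOn_of_smooth_homotopy [IsTopologicalGroup G] [CompactSpace G] [T2Space G]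
    [LieGroup (𝓡 d) ∞ G] [T2Space N] [SecondCountableTopology N] [IsManifold (𝓡 n) ∞ N]
    [ContMDiffSMul (𝓡 d) (𝓡 n) ∞ G N] (hF1 : ∀ t, 1 ≤ t → F t = F 1) : B.StarIsoOn n univ (F 0) (F 1) := by
  choose κ ix hκ hnhds using exists_trackSet_mem_nhds (B := B) hF
  obtain ⟨u, u1, u2, u3, u4, u5, u6, u7⟩ := exists_invariant_bumpCover (d := d) (n := n) G hnhds
    fun x g z hz => (smul_mem_trackSet hFG).1 hz
  have step (k : ℕ) (s : N → ℝ) (hs : IsTime n G s) :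
      ∃ s' : N → ℝ, IsTime n G s' ∧ (∀ x, s x ≤ s' x) ∧ (∀ x ∉ tsupport (u k), s' x = s x) ∧
      (∀ x, u k x = 1 → 0 ≤ s x → 1 ≤ s' x) ∧
      B.StarIsoOn n (tsupport (u k)) (fun x => F (s x) x) (fun x => F (s' x) x) := by
    rcases u5 k with h | ⟨x, hx⟩
    · refine ⟨s, hs, fun _ => le_rfl, fun _ _ => rfl, fun x hx _ => ?_, .refl _⟩
      have : x ∈ tsupport (u k) := subset_tsupport _ (by simp [hx])
      rw [h] at this
      exact this.elim
    · exact exists_advance hF hFG (hκ x) ⟨u1 k, u2 k⟩ (u3 k) (u4 k) hx hs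
  choose! A a1 a2 a3 a4 a5 using step
  -- Time starts at `0` everywhere and the `k`-th step advances it inside the support of `u k`.
  let s : ℕ → N → ℝ := fun k => Nat.rec (fun _ => 0) (fun k t => A k t) k
  have hs (k : ℕ) : IsTime n G (s k) := by
    induction k with
    | zero => exact ⟨contMDiff_const, fun _ _ => rfl⟩
    | succ k ih => exact a1 k _ ih
  have hmono (x : N) : Monotone fun k => s k x :=
    monotone_nat_of_le_succ fun k => a2 k (s k) (hs k) x
  have h0 (k : ℕ) (x : N) : 0 ≤ s k x := hmono x (Nat.zero_le k)
  refine starIsoOn_of_locally_eventually_eq (K := fun k => tsupport (u k))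
    (f := fun k x => F (s k x) x) (fun k => a5 k (s k) (hs k)) fun x => ?_
  obtain ⟨V, hV, hfin⟩ := u6 x
  obtain ⟨b, hb⟩ := hfin.bddAbove
  refine ⟨V, hV, b + 1, fun k hk z hz => ?_⟩
  have hnot (j : ℕ) (hj : b + 1 ≤ j) : z ∉ tsupport (u j) := fun h => by
    have : j ≤ b := hb ⟨z, h, hz⟩
    omega
  refine ⟨hnot k hk, ?_⟩
  obtain ⟨j, hj⟩ := u7 z
  have hjb : j + 1 ≤ b + 1 := by
    by_contra h
    exact hnot j (by omega) (subset_tsupport _ (by simp [hj]))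
  -- The step `j` with `u j z = 1` brings the time at `z` to `1` or beyond. Overshooting is
  -- harmless, since `F` is constant from time `1` on.
  have h1 : 1 ≤ s k z := (a4 j (s j) (hs j) z hj (h0 j z)).trans (hmono z (hjb.trans hk))
  change F (s k z) z = F 1 z
  rw [hF1 _ h1]

end StarBundle

/-! ### Assembly -/

theorem mainTheorem9 {d m : ℕ} (G M : Type u)
    [Group G] [TopologicalSpace G] [IsTopologicalGroup G] [CompactSpace G] [T2Space G]
    [ChartedSpace (EuclideanSpace ℝ (Fin d)) G] [LieGroup (𝓡 d) ∞ G]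
    [TopologicalSpace M] [T2Space M] [SecondCountableTopology M]
    [ChartedSpace (EuclideanSpace ℝ (Fin m)) M] [IsManifold (𝓡 m) ∞ M]
    [MulAction G M] [ContMDiffSMul (𝓡 d) (𝓡 m) ∞ G M] :
    -- equivariant smooth approximations `α'` of `α` exist
    (∀ (α : EqMap G M (ConjSelf G)) (W : Set (M × G)), IsOpen W →
      (∀ x, (x, ConjSelf.toG (α x)) ∈ W) →
      ∃ α' : EqMap G M (ConjSelf G), α'.IsSmooth m d ∧ α.Homotopic α' ∧
        ∀ x, (x, ConjSelf.toG (α' x)) ∈ W) ∧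
    -- the homomorphism `DR`
    (∃! DR : EqHomotopyClasses G M (ConjSelf G) →* PiZeroDiffG G m M,
      ∀ (α' : EqMap G M (ConjSelf G)) (hα' : α'.IsSmooth m d),
        DR α'.toClass = QuotientGroup.mk (hatDiffeo α' hα')⁻¹) ∧
    -- the map `DR_π`
    (∀ (n : ℕ) (N P : Type u)
      [TopologicalSpace N] [T2Space N] [SecondCountableTopology N]
      [ChartedSpace (EuclideanSpace ℝ (Fin n)) N] [IsManifold (𝓡 n) ∞ N]
      [MulAction G N] [ContMDiffSMul (𝓡 d) (𝓡 n) ∞ G N]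
      (EP HP : Type*) [NormedAddCommGroup EP] [NormedSpace ℝ EP] [TopologicalSpace HP]
      (IP : ModelWithCorners ℝ EP HP)
      [TopologicalSpace P] [T2Space P] [SecondCountableTopology P]
      [ChartedSpace HP P] [IsManifold IP ∞ P] [MulAction (G × G) P]
      (B : StarBundle d m IP G M P),
      (∀ f : EqMap G N M, ∃ f' : EqMap G N M, f'.IsSmooth n m ∧ f.Homotopic f') ∧
      ∃! DRπ : EqHomotopyClasses G N M → GManifoldClasses d G,
        ∀ f : EqMap G N M, f.IsSmooth n m → ∀ X : SmoothGManifold d G,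
          DRπ f.toClass = X.toClass ↔ B.IsStarQuotient n f X) := by
  refine ⟨fun α W hW hα => α.exists_smooth_conj hW hα, existsUnique_DR, ?_⟩
  intro n N P _ _ _ _ _ _ _ EP HP _ _ _ IP _ _ _ _ _ _ B
  have hsmooth (f : EqMap G N M) : ∃ f' : EqMap G N M, f'.IsSmooth n m ∧ f.Homotopic f' := by
    obtain ⟨f', h1, h2, -⟩ := EqMap.exists_smooth_homotopic (d := d) (n := n) (m := m) f
      (Ω := univ) isOpen_univ fun _ => trivial
    exact ⟨f', h1, h2⟩
  refine ⟨hsmooth, ?_⟩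
  have hiff (f f' : EqMap G N M) : f.toClass = f'.toClass ↔ f.Homotopic f' :=
    Quotient.eq (r := EqMap.homotopySetoid G N M)
  have hrep (c : EqHomotopyClasses G N M) : ∃ f : EqMap G N M, f.IsSmooth n m ∧ f.toClass = c := by
    induction c using Quotient.inductionOn with
    | h f =>
      obtain ⟨f', h1, h2⟩ := hsmooth f
      exact ⟨f', h1, ((hiff f f').2 h2).symm⟩
  choose r hr hrc using hrep
  choose Y hY using fun (f : EqMap G N M) (hf : f.IsSmooth n m) => B.exists_isStarQuotient hf
  have hclass (X X' : SmoothGManifold d G) : X.toClass = X'.toClass ↔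
      Nonempty (EqDiffeo G X.dim X'.dim X.carrier X'.carrier) :=
    Quotient.eq (r := SmoothGManifold.diffeoSetoid d G)
  have hiso (f : EqMap G N M) (hf : f.IsSmooth n m) (X : SmoothGManifold d G)
      (hX : B.IsStarQuotient n f X) :
      Nonempty (EqDiffeo G (Y _ (hr f.toClass)).dim X.dim (Y _ (hr f.toClass)).carrier X.carrier) := by
    obtain ⟨F, h1, h2, h3⟩ := ((hiff _ _).1 (hrc f.toClass)).exists_smooth_homotopy (d := d)
      (hr _) hf
    have h4 := B.starIsoOn_of_smooth_homotopy (F := fun t x => F t x) h1 (fun t g x => (F t).2 g x)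
      fun t ht => by rw [h3 t ht, h3 1 le_rfl]
    rw [h2 0 le_rfl, h3 1 le_rfl] at h4
    exact h4.nonempty_eqDiffeo (hY _ _) hX
  -- The value on a class is the quotient for a chosen smooth representative. Uniqueness follows by
  -- applying the characterisation to that same representative.
  refine ⟨fun c => (Y _ (hr c)).toClass, fun f hf X => ?_, fun D hD => funext fun c => ?_⟩
  · refine ⟨fun h => ?_, fun h => (hclass _ _).2 (hiso f hf X h)⟩
    obtain ⟨φ⟩ := hiso f hf _ (hY f hf)
    obtain ⟨ψ⟩ := (hclass _ _).1 h
    exact (hY f hf).of_eqDiffeo (φ.symm.trans ψ)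
  · have h := (hD (r c) (hr c) _).2 (hY _ (hr c))
    rwa [hrc] at h
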